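/- **Theorem (existence of a global solution of the Thirring equation).** Let $\mathbb{R}^{1,1}$ be two-dimensional Minkowski space with coordinates $(t,x)$, metric $g$ of signature $(+,-)$, orthonormal frame $e_0=\partial_t$, $e_1=\partial_x$ and $\epsilon_j=g(e_j,e_j)=\pm1$. Let $\Sigma\mathbb{R}^{1,1}=\mathbb{R}^{1,1}\times\mathbb{C}^2$ be its (flat, trivialized) spinor bundle. It carries a nondegenerate Hermitian scalar product $\langle\cdot,\cdot\rangle$, linear in the first and antilinear in the second slot, and a Clifford multiplication $X\cdot\psi$ that satisfies $\langle X\cdot\psi,\varphi\rangle=\langle\psi,X\cdot\varphi\rangle$ and $$X\cdot Y\cdot\psi+Y\cdot X\cdot\psi=2\sigma\,g(X,Y)\,\psi,$$ where $\sigma\in\{1,-1\}$ is a fixed sign (either convention is allowed). Let $D=\sum_j\epsilon_j\,e_j\cdot\nabla_{e_j}=\partial_t\cdot\nabla_{\partial_t}-\partial_x\cdot\nabla_{\partial_x}$ be the Dirac operator. Let $\lambda,\kappa\in\mathbb{R}$; both the massless case $\lambda=0$ and the massive case $\lambda\neq0$ are included. Then for every $\psi_0\in H^1(\mathbb{R},\mathbb{C}^2)$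 the initial value problem $$iD\psi=\lambda\psi+\kappa\sum_j\epsilon_j\langle\psi,e_j\cdot\psi\rangle\,e_j\cdot\psi,\qquad \psi(0,\cdot)=\psi_0,$$ has a global weak solution $\psi\colon\mathbb{R}^{1,1}\to\mathbb{C}^2$ with $\psi\in H^1\big((-T,T)\times\mathbb{R},\mathbb{C}^2\big)$ for every $T>0$, and any two such solutions with the same initial datum agree almost everywhere. Here a weak solution is one in the sense of distributions on $\mathbb{R}^{1,1}$, with $\psi$ and the right-hand side locally integrable, and $\psi(0,\cdot)=\psi_0$ means that, after modification on a null set, $t\mapsto\psi(t,\cdot)$ is a continuous curve in $L^2(\mathbb{R},\mathbb{C}^2)$ with value $\psi_0$ at $t=0$. -/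

import Mathlib

open MeasureTheory Set Filter Topology
open scoped ContDiff ENNReal

/-! ### Two-dimensional Minkowski space and its spinors -/

/-- The metric of signature `(+,-)` of two-dimensional Minkowski space, in the global
coordinates `(t, x)`. -/
def minkowskiMetric (X Y : ℝ × ℝ) : ℝ := X.1 * Y.1 - X.2 * Y.2

/-- The pseudo-orthonormal basis `e₀ = ∂_t`, `e₁ = ∂_x`. -/
def frame : Fin 2 → ℝ × ℝ := ![(1, 0), (0, 1)]

/-- `ε_j = g(e_j, e_j)`. -/
def frameSign (j : Fin 2) : ℝ := minkowskiMetric (frame j) (frame j)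

/-- The fibre of the (trivial, flat) spinor bundle of two-dimensional Minkowski space. -/
abbrev Spinor : Type := EuclideanSpace ℂ (Fin 2)

/-- The algebraic structure of the spinor bundle of two-dimensional Minkowski space in a parallel
trivialization: Clifford multiplication by tangent vectors, and a nondegenerate Hermitian scalar
product on spinors, linear in the first and antilinear in the second slot, for which Clifford
multiplication is symmetric. Both sign conventions for the Clifford relations are
allowed: `X · Y · ψ + Y · X · ψ = 2 σ g(X, Y) ψ` with `σ = 1` or `σ = -1`. -/
structure SpinorStructure where
  /-- the sign in the Clifford relations -/
  sign : ℝ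
  sign_eq : sign = 1 ∨ sign = -1
  /-- Clifford multiplication `X · ψ` -/
  cliff : (ℝ × ℝ) →ₗ[ℝ] (Spinor →ₗ[ℂ] Spinor)
  /-- the Hermitian scalar product `⟨ψ, φ⟩` -/
  form : Spinor →ₗ[ℂ] Spinor →ₗ⋆[ℂ] ℂ
  clifford : ∀ (X Y : ℝ × ℝ) (ψ : Spinor),
    cliff X (cliff Y ψ) + cliff Y (cliff X ψ) = (2 * sign * minkowskiMetric X Y) • ψ
  form_conj : ∀ ψ φ : Spinor, starRingEnd ℂ (form ψ φ) = form φ ψ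
  form_nondegenerate : ∀ ψ : Spinor, (∀ φ : Spinor, form ψ φ = 0) → ψ = 0
  cliff_symm : ∀ (X : ℝ × ℝ) (ψ φ : Spinor), form (cliff X ψ) φ = form ψ (cliff X φ)

/-! ### Weak derivatives and the Sobolev space `H¹` -/

section Sobolev

variable {E F : Type*} [NormedAddCommGroup E] [NormedSpace ℝ E] [MeasureSpace E]
  [NormedAddCommGroup F] [NormedSpace ℝ F]

/-- Smooth, compactly supported real functions on `E` with support in `Ω`. -/
def IsTestFunction (Ω : Set E) (φ : E → ℝ) : Prop :=
  ContDiff ℝ ∞ φ ∧ HasCompactSupport φ ∧ tsupport φ ⊆ Ω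

/-- `g` is the weak derivative of `f` in the direction `v` on the open set `Ω`. -/
def HasWeakDirDeriv (Ω : Set E) (f : E → F) (v : E) (g : E → F) : Prop :=
  ∀ φ : E → ℝ, IsTestFunction Ω φ →
    ∫ p in Ω, fderiv ℝ φ p v • f p = -∫ p in Ω, φ p • g p

/-- `f ∈ H¹(Ω, F)`: `f` is square integrable on the open set `Ω`, with square integrable weak
derivatives in all directions. -/
def MemH1 (Ω : Set E) (f : E → F) : Prop :=
  MemLp f 2 (volume.restrict Ω) ∧
    ∀ v : E, ∃ g : E → F, MemLp g 2 (volume.restrict Ω) ∧ HasWeakDirDeriv Ω f v g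

end Sobolev

/-- The time slab `(-T, T) × ℝ` in two-dimensional Minkowski space. -/
def slab (T : ℝ) : Set (ℝ × ℝ) := Ioo (-T) T ×ˢ univ

/-! ### The Thirring equation -/

namespace SpinorStructure

variable (S : SpinorStructure)

/-- The right-hand side `λ ψ + κ ∑_j ε_j ⟨ψ, e_j · ψ⟩ e_j · ψ` of the Thirring equation. -/
noncomputable def thirringRhs (lam κ : ℝ) (ψ : Spinor) : Spinor :=
  lam • ψ + κ • ∑ j : Fin 2,
    frameSign j • (S.form ψ (S.cliff (frame j) ψ) • S.cliff (frame j) ψ)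

/-- `ψ` is a weak (distributional) solution on all of Minkowski space of
`i D ψ = λ ψ + κ ∑_j ε_j ⟨ψ, e_j · ψ⟩ e_j · ψ`, where `D = ∑_j ε_j e_j · ∇_{e_j}`: the derivatives
are moved to the test function. -/
def IsWeakThirringSolution (lam κ : ℝ) (ψ : ℝ × ℝ → Spinor) : Prop :=
  LocallyIntegrable ψ ∧
  LocallyIntegrable (fun p => S.thirringRhs lam κ (ψ p)) ∧
  ∀ φ : ℝ × ℝ → ℝ, IsTestFunction univ φ →
    -∫ p, Complex.I • ∑ j : Fin 2,
        frameSign j • (fderiv ℝ φ p (frame j) • S.cliff (frame j) (ψ p)) =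
      ∫ p, φ p • S.thirringRhs lam κ (ψ p)

end SpinorStructure

/-- `ψ(0, ·) = ψ₀`: up to modification on a null set, `t ↦ ψ(t, ·)` is a continuous curve
in `L²(ℝ)` that takes the value `ψ₀` at `t = 0`. -/
def HasInitialValue (ψ : ℝ × ℝ → Spinor) (ψ₀ : ℝ → Spinor) : Prop :=
  ∃ u : ℝ → Lp Spinor 2 (volume : Measure ℝ),
    Continuous u ∧ (∀ᵐ t : ℝ, ∀ᵐ x : ℝ, u t x = ψ (t, x)) ∧ ∀ᵐ x : ℝ, u 0 x = ψ₀ x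

/-- `ψ` is a global weak solution of class `H¹` of the initial value problem for the Thirring
equation: it lies in `H¹` of every slab `(-T, T) × ℝ`. -/
def IsGlobalThirringSolution (S : SpinorStructure) (lam κ : ℝ) (ψ₀ : ℝ → Spinor)
    (ψ : ℝ × ℝ → Spinor) : Prop :=
  (∀ T : ℝ, 0 < T → MemH1 (slab T) ψ) ∧ S.IsWeakThirringSolution lam κ ψ ∧ HasInitialValue ψ ψ₀

/-!
In a basis of spinors adapted to the null directions (`SpinorStructure.exists_isNullBasis`) the
Thirring equation becomes a pair of transport equations for the components `u` and `w` of `ψ`,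
`(∂_t - ∂_x) u = -i (λ₁ w + κ₁ |w|² u)` and `(∂_t + ∂_x) w = -i (λ₂ u + κ₂ |u|² w)`, with real
coefficients. Integrated along characteristics they form the system `IsMildThirring`.

The cubic term in the equation of `u` is a real multiple of `u` times `-i`, so that it only rotates
the phase of `u` along a characteristic. Hence `|u|` and `|w|` grow along characteristics as in the
linear equation, and a linear Gronwall argument bounds both by `M exp (2 ℓ |t|)` as soon as the
initial values are bounded by `M` (`norm_le_growthBound`); they are, because `H¹(ℝ) ⊆ L^∞(ℝ)`
(`HasWeakDirDeriv.exists_ae_norm_le`). The same bound holds if the cubic term is truncated at that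
radius (`truncNonlin`), so that the truncation changes nothing, while it makes the nonlinearity
Lipschitz at each time.

For Lipschitz nonlinearities everything follows from one linear estimate: in the `L²` space with a
weight decaying fast enough in time, integration along characteristics has norm at most `1 / 4`
(`lintegral_sq_charLInt_le`, a Hardy-type inequality). This gives existence by Banach's fixed point
theorem (`exists_isMildTransport`), Lipschitz dependence on the initial values
(`lintegral_sq_sub_le_of_isMildTransport`), and uniqueness (`IsMildThirring.ae_eq`). As the equation
is invariant under translations in `x`, Lipschitz dependence bounds the difference quotients in `x`
of the solution by those of the initial values, which yields the weak derivative `∂_x`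
(`exists_hasWeakDirDeriv_of_isMildTransport`); the derivative in the null direction is the
right-hand side, and the two directions span.

A weak solution that is a continuous curve in `L²` satisfies the integrated equation
(`IsMildTransport.of_hasWeakDirDeriv`): tested with products in straightened coordinates, the weak
equation is an ordinary differential equation in `t`. This transfers uniqueness from the integrated
system to weak solutions.
-/

/-! ### Primitives of locally integrable functions of one variable -/

theorem MeasureTheory.LocallyIntegrable.intervalIntegrable_real {E : Type*} [NormedAddCommGroup E]
    {f : ℝ → E} (hf : LocallyIntegrable f) (a b : ℝ) : IntervalIntegrable f volume a b :=
  intervalIntegrable_iff.mpr <|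
    (hf.integrableOn_isCompact isCompact_uIcc).mono_set uIoc_subset_uIcc

theorem continuous_add_primitive {E : Type*} [NormedAddCommGroup E] [NormedSpace ℝ E]
    {f : ℝ → E} (hf : LocallyIntegrable f) (z : E) :
    Continuous fun t => z + ∫ s in (0 : ℝ)..t, f s :=
  continuous_const.add
    (intervalIntegral.continuous_primitive (fun a b => hf.intervalIntegrable_real a b) 0)

theorem locallyIntegrable_re {f : ℝ → ℂ} (hf : LocallyIntegrable f) :
    LocallyIntegrable fun t => (f t).re := fun x =>
  let ⟨s, hs, h⟩ := hf x; ⟨s, hs, h.re⟩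

theorem locallyIntegrable_im {f : ℝ → ℂ} (hf : LocallyIntegrable f) :
    LocallyIntegrable fun t => (f t).im := fun x =>
  let ⟨s, hs, h⟩ := hf x; ⟨s, hs, h.im⟩

theorem re_intervalIntegral {f : ℝ → ℂ} (hf : LocallyIntegrable f) (a b : ℝ) :
    (∫ s in a..b, f s).re = ∫ s in a..b, (f s).re :=
  (Complex.reCLM.intervalIntegral_comp_comm (hf.intervalIntegrable_real a b)).symm

theorem im_intervalIntegral {f : ℝ → ℂ} (hf : LocallyIntegrable f) (a b : ℝ) :
    (∫ s in a..b, f s).im = ∫ s in a..b, (f s).im :=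
  (Complex.imCLM.intervalIntegral_comp_comm (hf.intervalIntegrable_real a b)).symm

theorem absolutelyContinuousOnInterval_add_primitive {f : ℝ → ℝ} (hf : LocallyIntegrable f)
    (z a b : ℝ) :
    AbsolutelyContinuousOnInterval (fun t => z + ∫ s in (0 : ℝ)..t, f s) a b := by
  have h0 : AbsolutelyContinuousOnInterval (fun t => ∫ s in a..t, f s) a b :=
    (hf.intervalIntegrable_real a b).absolutelyContinuousOnInterval_intervalIntegral (by simp)
  have h1 : AbsolutelyContinuousOnInterval (fun _ : ℝ => z + ∫ s in (0 : ℝ)..a, f s) a b :=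
    (contDiff_const.contDiffOn).absolutelyContinuousOnInterval
  have e : (fun t => z + ∫ s in (0 : ℝ)..t, f s) =
      (fun _ : ℝ => z + ∫ s in (0 : ℝ)..a, f s) + fun t => ∫ s in a..t, f s := by
    ext t
    have := intervalIntegral.integral_add_adjacent_intervals (hf.intervalIntegrable_real 0 a)
      (hf.intervalIntegrable_real a t)
    simp only [Pi.add_apply, add_assoc, this]
  rw [e]
  exact h1.add h0

theorem ae_deriv_add_primitive {f : ℝ → ℝ} (hf : LocallyIntegrable f) (z : ℝ) :
    ∀ᵐ t, deriv (fun t => z + ∫ s in (0 : ℝ)..t, f s) t = f t := by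
  filter_upwards [LocallyIntegrable.ae_hasDerivAt_integral hf] with t ht
  exact ((ht 0).const_add z).deriv

/-- The square of a primitive is a primitive. -/
theorem sq_add_primitive {f : ℝ → ℝ} (hf : LocallyIntegrable f) (z t : ℝ) :
    (z + ∫ s in (0 : ℝ)..t, f s) ^ 2 =
      z ^ 2 + 2 * ∫ s in (0 : ℝ)..t, (z + ∫ r in (0 : ℝ)..s, f r) * f s := by
  have h := absolutelyContinuousOnInterval_add_primitive hf z 0 t
  have key := h.integral_deriv_mul_eq_sub h
  have e : ∫ x in (0 : ℝ)..t, deriv (fun t => z + ∫ s in (0 : ℝ)..t, f s) x *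
        (z + ∫ s in (0 : ℝ)..x, f s) + (z + ∫ s in (0 : ℝ)..x, f s) *
        deriv (fun t => z + ∫ s in (0 : ℝ)..t, f s) x =
      ∫ s in (0 : ℝ)..t, 2 * ((z + ∫ r in (0 : ℝ)..s, f r) * f s) := by
    refine intervalIntegral.integral_congr_ae ?_
    filter_upwards [ae_deriv_add_primitive hf z] with x hx _
    rw [hx]; ring
  rw [e, intervalIntegral.integral_const_mul] at key
  simp only [intervalIntegral.integral_same, add_zero] at key
  linarith [key]

theorem integral_deriv_mul_add_primitive_real {g : ℝ → ℝ} (hg : LocallyIntegrable g) (z : ℝ)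
    {α : ℝ → ℝ} (hα : ContDiff ℝ ∞ α) (hc : HasCompactSupport α) :
    ∫ t, deriv α t * (z + ∫ s in (0 : ℝ)..t, g s) = -∫ t, α t * g t := by
  obtain ⟨R, hR⟩ : ∃ R : ℝ, tsupport α ⊆ Metric.ball 0 R :=
    hc.isCompact.isBounded.subset_ball 0
  have hsub : tsupport α ⊆ Ioc (-R) R := by
    refine hR.trans ?_
    rw [Real.ball_eq_Ioo]; simpa using Ioo_subset_Ioc_self
  have hzero : ∀ t, |t| = R → α t = 0 := by
    intro t ht
    refine image_eq_zero_of_notMem_tsupport fun h => ?_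
    have := hR h
    rw [Metric.mem_ball, dist_zero_right, Real.norm_eq_abs, ht] at this
    exact lt_irrefl _ this
  have hRR : 0 ≤ R ∨ α = 0 := by
    rcases le_or_gt 0 R with h | h
    · exact Or.inl h
    · right; ext t
      refine image_eq_zero_of_notMem_tsupport fun h' => ?_
      have := hR h'
      rw [Metric.mem_ball] at this
      linarith [dist_nonneg (x := t) (y := 0)]
  rcases hRR with hRR | rfl
  swap
  · have : deriv (0 : ℝ → ℝ) = 0 := by ext t; simp
    simp [this]
  have h1 : AbsolutelyContinuousOnInterval α (-R) R :=
    ((hα.of_le (by simp)).contDiffOn).absolutelyContinuousOnInterval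
  have h2 := absolutelyContinuousOnInterval_add_primitive hg z (-R) R
  have key := h1.integral_mul_deriv_eq_deriv_mul h2
  rw [hzero R (abs_of_nonneg hRR), hzero (-R) (by rw [abs_neg, abs_of_nonneg hRR])] at key
  have e : ∫ x in (-R)..R, α x * deriv (fun t => z + ∫ s in (0 : ℝ)..t, g s) x =
      ∫ x in (-R)..R, α x * g x := by
    refine intervalIntegral.integral_congr_ae ?_
    filter_upwards [ae_deriv_add_primitive hg z] with x hx _
    rw [hx]
  have s1 : Function.support (fun x => α x * g x) ⊆ Ioc (-R) R :=
    (Function.support_mul_subset_left _ _).trans ((subset_tsupport _).trans hsub)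
  have s2 : Function.support (fun x => deriv α x * (z + ∫ s in (0 : ℝ)..x, g s)) ⊆ Ioc (-R) R :=
    (Function.support_mul_subset_left _ _).trans (support_deriv_subset.trans hsub)
  rw [e, intervalIntegral.integral_eq_integral_of_support_subset s1,
    intervalIntegral.integral_eq_integral_of_support_subset s2] at key
  linarith

theorem integral_deriv_smul_add_primitive {g : ℝ → ℂ} (hg : LocallyIntegrable g) (z : ℂ)
    {α : ℝ → ℝ} (hα : ContDiff ℝ ∞ α) (hc : HasCompactSupport α) :
    ∫ t, deriv α t • (z + ∫ s in (0 : ℝ)..t, g s) = -∫ t, α t • g t := by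
  have hα' : Continuous (deriv α) := hα.continuous_deriv (by simp)
  have i1 : Integrable fun t => deriv α t • (z + ∫ s in (0 : ℝ)..t, g s) :=
    (continuous_add_primitive hg z).locallyIntegrable.integrable_smul_left_of_hasCompactSupport
      hα' hc.deriv
  have i2 : Integrable fun t => α t • g t :=
    hg.integrable_smul_left_of_hasCompactSupport hα.continuous hc
  apply Complex.ext
  · have h := integral_deriv_mul_add_primitive_real (locallyIntegrable_re hg) z.re hα hc
    rw [Complex.neg_re, ← Complex.reCLM_apply, ← Complex.reCLM_apply,
      ← Complex.reCLM.integral_comp_comm i1, ← Complex.reCLM.integral_comp_comm i2]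
    simpa [← re_intervalIntegral hg, mul_add] using h
  · have h := integral_deriv_mul_add_primitive_real (locallyIntegrable_im hg) z.im hα hc
    rw [Complex.neg_im, ← Complex.imCLM_apply, ← Complex.imCLM_apply,
      ← Complex.imCLM.integral_comp_comm i1, ← Complex.imCLM.integral_comp_comm i2]
    simpa [← im_intervalIntegral hg, mul_add] using h

/-- A test function on the line with vanishing integral is the derivative of a test function. -/
theorem exists_deriv_eq_of_integral_eq_zero {β : ℝ → ℝ} (hβ : ContDiff ℝ ∞ β)
    (hc : HasCompactSupport β) (h0 : ∫ t, β t = 0) :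
    ∃ α : ℝ → ℝ, ContDiff ℝ ∞ α ∧ HasCompactSupport α ∧ deriv α = β := by
  obtain ⟨R, hR⟩ : ∃ R : ℝ, tsupport β ⊆ Metric.closedBall 0 R :=
    hc.isCompact.isBounded.subset_closedBall 0
  have hz : ∀ t, R < |t| → β t = 0 := by
    intro t ht
    refine image_eq_zero_of_notMem_tsupport fun h => ?_
    have := hR h
    rw [Metric.mem_closedBall, dist_zero_right, Real.norm_eq_abs] at this
    linarith
  have hd : ∀ t, HasDerivAt (fun t => ∫ s in (-R - 1)..t, β s) (β t) t := fun t =>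
    intervalIntegral.integral_hasDerivAt_right (hβ.continuous.intervalIntegrable _ _)
      (hβ.continuous.stronglyMeasurableAtFilter _ _) hβ.continuous.continuousAt
  have hde : deriv (fun t => ∫ s in (-R - 1)..t, β s) = β := funext fun t => (hd t).deriv
  refine ⟨fun t => ∫ s in (-R - 1)..t, β s, ?_, ?_, hde⟩
  · rw [contDiff_infty_iff_deriv, hde]
    exact ⟨fun t => (hd t).differentiableAt, hβ⟩
  · refine HasCompactSupport.intro (isCompact_closedBall (0 : ℝ) (|R| + 1)) fun t ht => ?_
    rw [Metric.mem_closedBall, dist_zero_right, Real.norm_eq_abs, not_le] at ht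
    have hRa := le_abs_self R
    rcases lt_abs.mp ht with h | h
    · rw [intervalIntegral.integral_eq_integral_of_support_subset, h0]
      intro s hs
      have : |s| ≤ R := by
        by_contra hcon
        exact hs (hz s (not_le.mp hcon))
      rw [abs_le] at this
      constructor <;> linarith
    · refine intervalIntegral.integral_zero_ae (ae_of_all _ fun s hs => hz s ?_)
      rw [mem_uIoc] at hs
      rw [lt_abs]
      right
      rcases hs with hs | hs
      · linarith [neg_abs_le R]
      · linarith

/-- du Bois-Reymond: a locally integrable function on the line with weak derivative `g` is a
primitive of `g`. -/
theorem ae_eq_add_primitive_of_weak {f g : ℝ → ℂ} (hf : LocallyIntegrable f)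
    (hg : LocallyIntegrable g)
    (h : ∀ α : ℝ → ℝ, ContDiff ℝ ∞ α → HasCompactSupport α →
      ∫ t, deriv α t • f t = -∫ t, α t • g t) :
    ∃ z : ℂ, ∀ᵐ t, f t = z + ∫ s in (0 : ℝ)..t, g s := by
  have hG := continuous_add_primitive hg 0
  set G : ℝ → ℂ := fun t => 0 + ∫ s in (0 : ℝ)..t, g s with hGdef
  have hD : LocallyIntegrable (fun t => f t - G t) := hf.sub hG.locallyIntegrable
  have hweak : ∀ α : ℝ → ℝ, ContDiff ℝ ∞ α → HasCompactSupport α →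
      ∫ t, deriv α t • (f t - G t) = 0 := by
    intro α hα hc
    have hα' : Continuous (deriv α) := hα.continuous_deriv (by simp)
    simp_rw [smul_sub]
    rw [integral_sub, h α hα hc, integral_deriv_smul_add_primitive hg 0 hα hc, sub_self]
    · exact hf.integrable_smul_left_of_hasCompactSupport hα' hc.deriv
    · exact hG.locallyIntegrable.integrable_smul_left_of_hasCompactSupport hα' hc.deriv
  -- a test function differs from a multiple of the bump function `η` by a derivative
  let b : ContDiffBump (0 : ℝ) := default
  set η : ℝ → ℝ := b.normed volume
  have hη : ContDiff ℝ ∞ η := b.contDiff_normed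
  have hηc : HasCompactSupport η := b.hasCompactSupport_normed
  have hη1 : ∫ t, η t = 1 := b.integral_normed
  refine ⟨∫ t, η t • (f t - G t), ?_⟩
  have key : ∀ᵐ t, f t - G t = ∫ t, η t • (f t - G t) := by
    refine ae_eq_of_integral_contDiff_smul_eq hD (locallyIntegrable_const _) fun α hα hc => ?_
    have iα : Integrable α := hα.continuous.integrable_of_hasCompactSupport hc
    have iη : Integrable η := hη.continuous.integrable_of_hasCompactSupport hηc
    obtain ⟨γ, hγ, hγc, hγd⟩ := exists_deriv_eq_of_integral_eq_zero
      (β := fun t => α t - (∫ s, α s) * η t) (hα.sub (contDiff_const.mul hη))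
      (hc.sub (hηc.mul_left))
      (by rw [integral_sub iα (iη.const_mul _), integral_const_mul, hη1]; ring)
    have := hweak γ hγ hγc
    rw [hγd] at this
    simp_rw [sub_smul, mul_smul] at this
    have i2 : Integrable fun t => (∫ s, α s) • η t • (f t - G t) :=
      (hD.integrable_smul_left_of_hasCompactSupport hη.continuous hηc).smul (∫ s, α s)
    rw [integral_sub (hD.integrable_smul_left_of_hasCompactSupport hα.continuous hc) i2,
      integral_smul, sub_eq_zero] at this
    rw [this, integral_smul_const]
  filter_upwards [key] with t ht
  rw [← ht]; simp [hGdef]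

/-- If the velocity `F` of a curve `U` in the plane has radial component at most `q`, in absolute
value, then `|U|` grows at most by twice the integral of `q`. -/
theorem norm_add_primitive_le {F : ℝ → ℂ} (hF : LocallyIntegrable F) {q : ℝ → ℝ}
    (hq : LocallyIntegrable q) (hq0 : ∀ t, 0 ≤ q t) (z : ℂ)
    (h : ∀ᵐ s, |((starRingEnd ℂ) (z + ∫ r in (0 : ℝ)..s, F r) * F s).re| ≤
      ‖z + ∫ r in (0 : ℝ)..s, F r‖ * q s) (t : ℝ) :
    ‖z + ∫ s in (0 : ℝ)..t, F s‖ ≤ ‖z‖ + 2 * ∫ s in uIoc 0 t, q s := by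
  set U : ℝ → ℂ := fun t => z + ∫ s in (0 : ℝ)..t, F s with hU
  have hUc : Continuous U := continuous_add_primitive hF z
  have hsq : ∀ τ, ‖U τ‖ ^ 2 =
      ‖z‖ ^ 2 + 2 * ∫ s in (0 : ℝ)..τ, ((starRingEnd ℂ) (U s) * F s).re := by
    intro τ
    have h1 := sq_add_primitive (locallyIntegrable_re hF) z.re τ
    have h2 := sq_add_primitive (locallyIntegrable_im hF) z.im τ
    have e1 : ∀ s, z.re + ∫ r in (0 : ℝ)..s, (F r).re = (U s).re := fun s => by
      simp [hU, re_intervalIntegral hF]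
    have e2 : ∀ s, z.im + ∫ r in (0 : ℝ)..s, (F r).im = (U s).im := fun s => by
      simp [hU, im_intervalIntegral hF]
    simp only [e1] at h1
    simp only [e2] at h2
    have i1 : IntervalIntegrable (fun s => (U s).re * (F s).re) volume 0 τ :=
      ((locallyIntegrable_re hF).intervalIntegrable_real 0 τ).continuousOn_mul
        (Complex.continuous_re.comp hUc).continuousOn
    have i2 : IntervalIntegrable (fun s => (U s).im * (F s).im) volume 0 τ :=
      ((locallyIntegrable_im hF).intervalIntegrable_real 0 τ).continuousOn_mul
        (Complex.continuous_im.comp hUc).continuousOn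
    have e3 : ∀ s, ((starRingEnd ℂ) (U s) * F s).re = (U s).re * (F s).re + (U s).im * (F s).im :=
      fun s => by simp [Complex.mul_re]
    simp_rw [e3]
    rw [intervalIntegral.integral_add i1 i2, ← Complex.normSq_eq_norm_sq,
      ← Complex.normSq_eq_norm_sq, Complex.normSq_apply, Complex.normSq_apply]
    linarith
  -- the identity for `‖U‖ ^ 2` is used at the time `τ` at which `‖U‖` is maximal
  obtain ⟨τ, hτ, hmax⟩ := (isCompact_uIcc (a := (0 : ℝ)) (b := t)).exists_isMaxOn
    nonempty_uIcc hUc.norm.continuousOn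
  have hmax' : ∀ s ∈ uIcc 0 t, ‖U s‖ ≤ ‖U τ‖ := fun s hs => hmax hs
  have hqi : IntegrableOn q (uIoc 0 t) :=
    (hq.integrableOn_isCompact isCompact_uIcc).mono_set uIoc_subset_uIcc
  have hsub : uIoc 0 τ ⊆ uIoc 0 t := by
    rcases le_total 0 t with h0 | h0
    · rw [uIcc_of_le h0] at hτ
      rw [uIoc_of_le h0, uIoc_of_le hτ.1]
      exact Ioc_subset_Ioc_right hτ.2
    · rw [uIcc_of_ge h0] at hτ
      rw [uIoc_of_ge h0, uIoc_of_ge hτ.2]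
      exact Ioc_subset_Ioc_left hτ.1
  have hint : |∫ s in (0 : ℝ)..τ, ((starRingEnd ℂ) (U s) * F s).re| ≤
      ‖U τ‖ * ∫ s in uIoc 0 t, q s := by
    have h1 := intervalIntegral.norm_integral_le_integral_norm_uIoc (a := 0) (b := τ)
      (f := fun s => ((starRingEnd ℂ) (U s) * F s).re) (μ := volume)
    refine h1.trans ?_
    have h2 : ∫ s in uIoc 0 τ, ‖((starRingEnd ℂ) (U s) * F s).re‖ ≤
        ∫ s in uIoc 0 τ, ‖U τ‖ * q s := by
      refine integral_mono_of_nonneg (ae_of_all _ fun _ => norm_nonneg _)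
        ((hqi.mono_set hsub).const_mul _) ?_
      filter_upwards [ae_restrict_of_ae h, ae_restrict_mem measurableSet_uIoc] with s hs hm
      refine hs.trans (mul_le_mul_of_nonneg_right ?_ (hq0 s))
      exact hmax' s (uIoc_subset_uIcc (hsub hm))
    refine h2.trans ?_
    rw [integral_const_mul]
    refine mul_le_mul_of_nonneg_left ?_ (norm_nonneg _)
    exact setIntegral_mono_set hqi (ae_of_all _ hq0) (LE.le.eventuallyLE hsub)
  have hz : ‖z‖ ≤ ‖U τ‖ := by
    have := hmax' 0 left_mem_uIcc
    simpa [hU] using this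
  have hQ : 0 ≤ ∫ s in uIoc 0 t, q s := integral_nonneg hq0
  have hfin : ‖U τ‖ ≤ ‖z‖ + 2 * ∫ s in uIoc 0 t, q s := by
    rcases (norm_nonneg (U τ)).eq_or_lt with h0 | h0
    · rw [← h0]; positivity
    · have h1 := hsq τ
      have h2 := (abs_le.mp hint).2
      have h3 : ‖U τ‖ * ‖U τ‖ ≤ ‖U τ‖ * (‖z‖ + 2 * ∫ s in uIoc 0 t, q s) := by
        nlinarith [mul_le_mul_of_nonneg_left hz (norm_nonneg z)]
      exact le_of_mul_le_mul_left h3 h0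
  exact (hmax' t right_mem_uIcc).trans hfin

/-! ### A weighted inequality for primitives -/

/-- Cauchy–Schwarz for lower Lebesgue integrals. -/
theorem sq_lintegral_mul_le {X : Type*} [MeasurableSpace X] (m : Measure X) {f g : X → ℝ≥0∞}
    (hf : AEMeasurable f m) (hg : AEMeasurable g m) :
    (∫⁻ x, f x * g x ∂m) ^ 2 ≤ (∫⁻ x, f x ^ 2 ∂m) * ∫⁻ x, g x ^ 2 ∂m := by
  have h := ENNReal.lintegral_mul_le_Lp_mul_Lq m Real.HolderConjugate.two_two hf hg
  simp only [Pi.mul_apply, ENNReal.rpow_two] at h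
  have e : ∀ a : ℝ≥0∞, (a ^ (1 / 2 : ℝ)) ^ 2 = a := fun a => by
    rw [← ENNReal.rpow_natCast, ← ENNReal.rpow_mul]; norm_num
  calc (∫⁻ x, f x * g x ∂m) ^ 2
      ≤ ((∫⁻ x, f x ^ 2 ∂m) ^ (1 / 2 : ℝ) * (∫⁻ x, g x ^ 2 ∂m) ^ (1 / 2 : ℝ)) ^ 2 :=
        pow_le_pow_left' h 2
    _ = _ := by rw [mul_pow, e, e]

theorem ENNReal.add_sq_le (a b : ℝ≥0∞) : (a + b) ^ 2 ≤ 2 * a ^ 2 + 2 * b ^ 2 := by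
  rcases eq_or_ne a ∞ with rfl | ha
  · simp
  rcases eq_or_ne b ∞ with rfl | hb
  · simp
  lift a to NNReal using ha
  lift b to NNReal using hb
  norm_cast
  rw [← NNReal.coe_le_coe]
  push_cast
  nlinarith [sq_nonneg ((a : ℝ) - b)]

theorem hasDerivAt_primitive {L : ℝ → ℝ} (hL : Continuous L) (t : ℝ) :
    HasDerivAt (fun t => ∫ s in (0 : ℝ)..t, L s) (L t) t :=
  intervalIntegral.integral_hasDerivAt_right (hL.intervalIntegrable _ _)
    (hL.stronglyMeasurableAtFilter _ _) hL.continuousAt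

theorem continuous_mul_exp_primitive {L : ℝ → ℝ} (hL : Continuous L) (κ : ℝ) :
    Continuous fun t => L t * Real.exp (κ * ∫ s in (0 : ℝ)..t, L s) := by
  have : Continuous fun t => ∫ s in (0 : ℝ)..t, L s :=
    intervalIntegral.continuous_primitive (fun _ _ => hL.intervalIntegrable _ _) 0
  fun_prop

theorem lintegral_Ioc_mul_exp_primitive {L : ℝ → ℝ} (hL : Continuous L) (hpos : ∀ t, 0 < L t)
    {κ : ℝ} (hκ : κ ≠ 0) {a b : ℝ} (hab : a ≤ b) :
    ∫⁻ t in Ioc a b, ENNReal.ofReal (L t * Real.exp (κ * ∫ s in (0 : ℝ)..t, L s)) =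
      ENNReal.ofReal ((Real.exp (κ * ∫ s in (0 : ℝ)..b, L s) -
        Real.exp (κ * ∫ s in (0 : ℝ)..a, L s)) / κ) := by
  have hc := continuous_mul_exp_primitive hL κ
  rw [← ofReal_integral_eq_lintegral_ofReal]
  · rw [← intervalIntegral.integral_of_le hab, sub_div]
    congr 1
    have := intervalIntegral.integral_eq_sub_of_hasDerivAt (a := a) (b := b)
      (f := fun t => Real.exp (κ * ∫ s in (0 : ℝ)..t, L s) / κ)
      (f' := fun t => L t * Real.exp (κ * ∫ s in (0 : ℝ)..t, L s)) ?_ ?_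
    · exact this
    · intro t _
      have h := (((hasDerivAt_primitive hL t).const_mul κ).exp).div_const κ
      exact h.congr_deriv (by rw [div_eq_iff hκ]; ring)
    · exact hc.intervalIntegrable _ _
  · exact (hc.integrableOn_Icc).mono_set Ioc_subset_Icc_self
  · exact ae_of_all _ fun t => mul_nonneg (hpos t).le (Real.exp_pos _).le

theorem lintegral_Ioi_mul_exp_primitive_le {L : ℝ → ℝ} (hL : Continuous L)
    (hpos : ∀ t, 0 < L t) {k : ℝ} (hk : 0 < k) (a : ℝ) :
    ∫⁻ t in Ioi a, ENNReal.ofReal (L t * Real.exp (-k * ∫ s in (0 : ℝ)..t, L s)) ≤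
      ENNReal.ofReal (Real.exp (-k * ∫ s in (0 : ℝ)..a, L s) / k) := by
  have hU : Ioi a = ⋃ n : ℕ, Ioc a (a + n) := by
    ext t
    simp only [mem_Ioi, mem_iUnion, mem_Ioc]
    constructor
    · intro h
      obtain ⟨n, hn⟩ := exists_nat_ge (t - a)
      exact ⟨n, h, by linarith⟩
    · rintro ⟨n, h, _⟩; exact h
  have hmono : Monotone fun n : ℕ => Ioc a (a + n) := fun n m h =>
    Ioc_subset_Ioc_right (by have : (n : ℝ) ≤ m := by exact_mod_cast h
                             linarith)
  rw [hU, setLIntegral_iUnion_of_directed _ (directed_of_isDirected_le hmono)]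
  refine iSup_le fun n => ?_
  rw [lintegral_Ioc_mul_exp_primitive hL hpos (by linarith : -k ≠ 0)
    (by simp : a ≤ a + (n : ℝ))]
  refine ENNReal.ofReal_le_ofReal ?_
  rw [div_neg, ← neg_div]
  gcongr
  linarith [Real.exp_pos (-k * ∫ s in (0 : ℝ)..(a + n), L s)]

/-- Hardy-type inequality on the half-line: integrating with density `L` gains the factor `1 / k`
in the `L²` norm with weight `L exp (-2 k ∫ L)`. -/
theorem lintegral_Ioi_sq_primitive_le {L : ℝ → ℝ} (hL : Continuous L) (hpos : ∀ t, 0 < L t)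
    {k : ℝ} (hk : 0 < k) {f : ℝ → ℝ≥0∞} (hf : Measurable f) :
    ∫⁻ t in Ioi 0, ENNReal.ofReal (L t * Real.exp (-(2 * k) * ∫ s in (0 : ℝ)..t, L s)) *
        (∫⁻ s in Ioc 0 t, ENNReal.ofReal (L s) * f s) ^ 2 ≤
      ENNReal.ofReal ((1 / k) ^ 2) * ∫⁻ t in Ioi 0,
        ENNReal.ofReal (L t * Real.exp (-(2 * k) * ∫ s in (0 : ℝ)..t, L s)) * f t ^ 2 := by
  set E : ℝ → ℝ := fun t => ∫ s in (0 : ℝ)..t, L s with hE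
  have hEc : Continuous E :=
    intervalIntegral.continuous_primitive (fun _ _ => hL.intervalIntegrable _ _) 0
  have mP : Measurable fun t => ENNReal.ofReal (L t * Real.exp (k * E t)) :=
    (hL.mul (Real.continuous_exp.comp (continuous_const.mul hEc))).measurable.ennreal_ofReal
  have mN : Measurable fun t => ENNReal.ofReal (L t * Real.exp (-k * E t)) :=
    (hL.mul (Real.continuous_exp.comp (continuous_const.mul hEc))).measurable.ennreal_ofReal
  set B : ℝ → ℝ≥0∞ := fun s => ENNReal.ofReal (L s * Real.exp (-k * E s)) * f s ^ 2 with hB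
  have mB : Measurable B := mN.mul (hf.pow_const 2)
  -- Cauchy–Schwarz, splitting `L = √(L exp (k E)) √(L exp (-k E))`
  have step1 : ∀ t ∈ Ioi (0 : ℝ),
      ENNReal.ofReal (L t * Real.exp (-(2 * k) * E t)) *
        (∫⁻ s in Ioc 0 t, ENNReal.ofReal (L s) * f s) ^ 2 ≤
      ENNReal.ofReal (1 / k) * (ENNReal.ofReal (L t * Real.exp (-k * E t)) *
        ∫⁻ s in Ioc 0 t, B s) := by
    intro t ht
    have cs := sq_lintegral_mul_le (volume.restrict (Ioc 0 t))
      (f := fun s => ENNReal.ofReal (Real.sqrt (L s * Real.exp (k * E s))))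
      (g := fun s => ENNReal.ofReal (Real.sqrt (L s * Real.exp (-k * E s))) * f s)
      (by fun_prop) (by fun_prop)
    have e1 : ∀ s, ENNReal.ofReal (Real.sqrt (L s * Real.exp (k * E s))) *
        (ENNReal.ofReal (Real.sqrt (L s * Real.exp (-k * E s))) * f s) =
        ENNReal.ofReal (L s) * f s := by
      intro s
      rw [← mul_assoc, ← ENNReal.ofReal_mul (Real.sqrt_nonneg _), ← Real.sqrt_mul
        (mul_nonneg (hpos s).le (Real.exp_pos _).le)]
      have : L s * Real.exp (k * E s) * (L s * Real.exp (-k * E s)) = L s ^ 2 := by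
        rw [mul_mul_mul_comm, ← Real.exp_add]; ring_nf; simp
      rw [this, Real.sqrt_sq (hpos s).le]
    have e2 : ∀ s, ENNReal.ofReal (Real.sqrt (L s * Real.exp (k * E s))) ^ 2 =
        ENNReal.ofReal (L s * Real.exp (k * E s)) := fun s => by
      rw [← ENNReal.ofReal_pow (Real.sqrt_nonneg _),
        Real.sq_sqrt (mul_nonneg (hpos s).le (Real.exp_pos _).le)]
    have e3 : ∀ s, (ENNReal.ofReal (Real.sqrt (L s * Real.exp (-k * E s))) * f s) ^ 2 = B s :=
      fun s => by
        rw [mul_pow, ← ENNReal.ofReal_pow (Real.sqrt_nonneg _),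
          Real.sq_sqrt (mul_nonneg (hpos s).le (Real.exp_pos _).le)]
    simp_rw [e1, e2, e3] at cs
    have i1 : ∫⁻ s in Ioc 0 t, ENNReal.ofReal (L s * Real.exp (k * E s)) ≤
        ENNReal.ofReal (Real.exp (k * E t) / k) := by
      rw [lintegral_Ioc_mul_exp_primitive hL hpos hk.ne' (le_of_lt ht)]
      refine ENNReal.ofReal_le_ofReal ?_
      gcongr
      linarith [Real.exp_pos (k * ∫ s in (0 : ℝ)..0, L s)]
    calc _ ≤ ENNReal.ofReal (L t * Real.exp (-(2 * k) * E t)) *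
          (ENNReal.ofReal (Real.exp (k * E t) / k) * ∫⁻ s in Ioc 0 t, B s) := by
          gcongr
          exact cs.trans (by gcongr)
      _ = _ := by
          rw [← mul_assoc, ← mul_assoc, ← ENNReal.ofReal_mul, ← ENNReal.ofReal_mul]
          · congr 2
            have : Real.exp (-k * E t) = Real.exp (-(2 * k) * E t) * Real.exp (k * E t) := by
              rw [← Real.exp_add]; ring_nf
            rw [this]; ring
          · positivity
          · exact mul_nonneg (hpos t).le (Real.exp_pos _).le
  have step2 : ∫⁻ t in Ioi 0, ENNReal.ofReal (L t * Real.exp (-k * E t)) *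
        ∫⁻ s in Ioc 0 t, B s =
      ∫⁻ s in Ioi 0, B s * ∫⁻ t in Ici s, ENNReal.ofReal (L t * Real.exp (-k * E t)) := by
    set A : ℝ → ℝ≥0∞ := fun t => ENNReal.ofReal (L t * Real.exp (-k * E t)) with hA
    have mS : MeasurableSet {q : ℝ × ℝ | 0 < q.2 ∧ q.2 ≤ q.1} :=
      (measurableSet_lt measurable_const measurable_snd).inter
        (measurableSet_le measurable_snd measurable_fst)
    have mf : Measurable (({q : ℝ × ℝ | 0 < q.2 ∧ q.2 ≤ q.1}).indicator
        fun q => A q.1 * B q.2) :=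
      ((mN.comp measurable_fst).mul (mB.comp measurable_snd)).indicator mS
    have l1 : ∫⁻ t in Ioi 0, A t * ∫⁻ s in Ioc 0 t, B s =
        ∫⁻ t, ∫⁻ s, ({q : ℝ × ℝ | 0 < q.2 ∧ q.2 ≤ q.1}).indicator
          (fun q => A q.1 * B q.2) (t, s) := by
      rw [← lintegral_indicator measurableSet_Ioi]
      refine lintegral_congr fun t => ?_
      by_cases ht : t ∈ Ioi (0 : ℝ)
      · rw [indicator_of_mem ht, ← lintegral_const_mul _ mB,
          ← lintegral_indicator measurableSet_Ioc]
        rfl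
      · rw [indicator_of_notMem ht]
        symm
        refine lintegral_eq_zero_of_ae_eq_zero (ae_of_all _ fun s => indicator_of_notMem ?_ _)
        rintro ⟨h1, h2⟩
        exact ht (h1.trans_le h2)
    have l2 : ∫⁻ s in Ioi 0, B s * ∫⁻ t in Ici s, A t =
        ∫⁻ s, ∫⁻ t, ({q : ℝ × ℝ | 0 < q.2 ∧ q.2 ≤ q.1}).indicator
          (fun q => A q.1 * B q.2) (t, s) := by
      rw [← lintegral_indicator measurableSet_Ioi]
      refine lintegral_congr fun s => ?_
      by_cases hs : s ∈ Ioi (0 : ℝ)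
      · rw [indicator_of_mem hs, ← lintegral_const_mul _ mN,
          ← lintegral_indicator measurableSet_Ici]
        refine lintegral_congr fun t => ?_
        simp only [indicator, mem_Ici, mem_ofPred_eq, mem_Ioi.mp hs, true_and, mul_comm]
      · rw [indicator_of_notMem hs]
        symm
        refine lintegral_eq_zero_of_ae_eq_zero (ae_of_all _ fun t => indicator_of_notMem ?_ _)
        rintro ⟨h1, _⟩
        exact hs h1
    rw [l1, l2]
    exact lintegral_lintegral_swap mf.aemeasurable
  have mI : Measurable fun t => ENNReal.ofReal (L t * Real.exp (-(2 * k) * E t)) * f t ^ 2 :=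
    ((hL.mul (Real.continuous_exp.comp (continuous_const.mul hEc))).measurable.ennreal_ofReal).mul
      (hf.pow_const 2)
  calc _ ≤ ∫⁻ t in Ioi 0, ENNReal.ofReal (1 / k) * (ENNReal.ofReal (L t * Real.exp (-k * E t)) *
        ∫⁻ s in Ioc 0 t, B s) := setLIntegral_mono' measurableSet_Ioi step1
    _ = ENNReal.ofReal (1 / k) * ∫⁻ s in Ioi 0,
          B s * ∫⁻ t in Ici s, ENNReal.ofReal (L t * Real.exp (-k * E t)) := by
        rw [lintegral_const_mul' _ _ ENNReal.ofReal_ne_top, step2]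
    _ ≤ ENNReal.ofReal (1 / k) * ∫⁻ s in Ioi 0, ENNReal.ofReal (1 / k) *
          (ENNReal.ofReal (L s * Real.exp (-(2 * k) * E s)) * f s ^ 2) := by
        refine mul_le_mul_right (lintegral_mono fun s => ?_) _
        rw [setLIntegral_congr Ioi_ae_eq_Ici.symm]
        calc B s * ∫⁻ t in Ioi s, ENNReal.ofReal (L t * Real.exp (-k * E t))
            ≤ B s * ENNReal.ofReal (Real.exp (-k * E s) / k) := by
              gcongr
              exact lintegral_Ioi_mul_exp_primitive_le hL hpos hk s
          _ = ENNReal.ofReal (L s * Real.exp (-k * E s)) *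
                ENNReal.ofReal (Real.exp (-k * E s) / k) * f s ^ 2 := by rw [hB]; ring
          _ = _ := by
              rw [← mul_assoc, ← ENNReal.ofReal_mul (mul_nonneg (hpos s).le (Real.exp_pos _).le),
                ← ENNReal.ofReal_mul (by positivity)]
              congr 2
              have : Real.exp (-(2 * k) * E s) = Real.exp (-k * E s) * Real.exp (-k * E s) := by
                rw [← Real.exp_add]; ring_nf
              rw [this]; ring
    _ = _ := by
        rw [lintegral_const_mul' _ _ ENNReal.ofReal_ne_top, ← mul_assoc,
          ← ENNReal.ofReal_mul (by positivity), pow_two]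

/-- The weight `L(t) exp (-8 |∫₀ᵗ L|)`: the rate `8 = 2 · 4` makes integration with density `L` a
map of norm at most `1 / 4` in the weighted `L²` space. -/
noncomputable def timeWeight (L : ℝ → ℝ) (t : ℝ) : ℝ :=
  L t * Real.exp (-8 * |∫ s in (0 : ℝ)..t, L s|)

theorem continuous_timeWeight {L : ℝ → ℝ} (hL : Continuous L) : Continuous (timeWeight L) := by
  have : Continuous fun t => ∫ s in (0 : ℝ)..t, L s :=
    intervalIntegral.continuous_primitive (fun _ _ => hL.intervalIntegrable _ _) 0
  unfold timeWeight
  fun_prop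

theorem timeWeight_pos {L : ℝ → ℝ} (hpos : ∀ t, 0 < L t) (t : ℝ) : 0 < timeWeight L t :=
  mul_pos (hpos t) (Real.exp_pos _)

theorem timeWeight_of_nonneg {L : ℝ → ℝ} (hpos : ∀ t, 0 < L t) {t : ℝ} (ht : 0 ≤ t) :
    timeWeight L t = L t * Real.exp (-(2 * 4) * ∫ s in (0 : ℝ)..t, L s) := by
  rw [timeWeight, abs_of_nonneg (intervalIntegral.integral_nonneg ht fun s _ => (hpos s).le)]
  norm_num

theorem timeWeight_neg (L : ℝ → ℝ) (t : ℝ) :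
    timeWeight L (-t) = timeWeight (fun s => L (-s)) t := by
  have : ∫ s in (0 : ℝ)..t, L (-s) = -∫ s in (0 : ℝ)..(-t), L s := by
    rw [intervalIntegral.integral_comp_neg, neg_zero, intervalIntegral.integral_symm]
  rw [timeWeight, timeWeight, this, abs_neg]

theorem lintegral_eq_Ioi_add_Ioi_neg {f : ℝ → ℝ≥0∞} (hf : Measurable f) :
    ∫⁻ t, f t = (∫⁻ t in Ioi 0, f t) + ∫⁻ t in Ioi 0, f (-t) := by
  rw [← lintegral_add_compl f measurableSet_Ioi (A := Ioi (0 : ℝ)), compl_Ioi,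
    setLIntegral_congr Iio_ae_eq_Iic.symm]
  congr 1
  have := (Measure.measurePreserving_neg (volume : Measure ℝ)).setLIntegral_comp_preimage
    (measurableSet_Iio (a := (0 : ℝ))) hf
  rw [← this]
  congr 2
  ext; simp

theorem lintegral_uIoc_neg (f : ℝ → ℝ≥0∞) (hf : Measurable f) {t : ℝ} (ht : 0 ≤ t) :
    ∫⁻ s in uIoc 0 (-t), f s = ∫⁻ s in Ioc 0 t, f (-s) := by
  rw [uIoc_of_ge (by linarith), setLIntegral_congr Ioo_ae_eq_Ioc.symm,
    setLIntegral_congr (Ioo_ae_eq_Ioc (a := (0 : ℝ)) (b := t)).symm]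
  have := (Measure.measurePreserving_neg (volume : Measure ℝ)).setLIntegral_comp_preimage
    (measurableSet_Ioo (a := -t) (b := (0 : ℝ))) hf
  rw [← this]
  congr 2
  ext s; simp [and_comm]

/-- The Hardy-type inequality on the whole line, integrating from the origin. -/
theorem lintegral_sq_primitive_le {L : ℝ → ℝ} (hL : Continuous L) (hpos : ∀ t, 0 < L t)
    {f : ℝ → ℝ≥0∞} (hf : Measurable f) :
    ∫⁻ t, ENNReal.ofReal (timeWeight L t) *
        (∫⁻ s in uIoc 0 t, ENNReal.ofReal (L s) * f s) ^ 2 ≤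
      ENNReal.ofReal (1 / 16) * ∫⁻ t, ENNReal.ofReal (timeWeight L t) * f t ^ 2 := by
  have mS : MeasurableSet {q : ℝ × ℝ | q.2 ∈ uIoc 0 q.1} :=
    (measurableSet_lt (measurable_const.min measurable_fst) measurable_snd).inter
      (measurableSet_le measurable_snd (measurable_const.max measurable_fst))
  have mLf : Measurable fun s => ENNReal.ofReal (L s) * f s :=
    hL.measurable.ennreal_ofReal.mul hf
  have mI : Measurable fun t => ∫⁻ s in uIoc 0 t, ENNReal.ofReal (L s) * f s := by
    have h : Measurable fun t => ∫⁻ s, ({q : ℝ × ℝ | q.2 ∈ uIoc 0 q.1}).indicator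
        (fun q => ENNReal.ofReal (L q.2) * f q.2) (t, s) :=
      ((mLf.comp measurable_snd).indicator mS).lintegral_prod_right'
    convert h using 2 with t
    rw [← lintegral_indicator measurableSet_uIoc]
    rfl
  have mw := (continuous_timeWeight hL).measurable.ennreal_ofReal
  rw [lintegral_eq_Ioi_add_Ioi_neg (f := fun t => ENNReal.ofReal (timeWeight L t) *
      (∫⁻ s in uIoc 0 t, ENNReal.ofReal (L s) * f s) ^ 2) (mw.mul (mI.pow_const 2)),
    lintegral_eq_Ioi_add_Ioi_neg (f := fun t => ENNReal.ofReal (timeWeight L t) * f t ^ 2)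
      (mw.mul (hf.pow_const 2)), mul_add]
  have hL' : Continuous fun s => L (-s) := hL.comp continuous_neg
  have h16 : ENNReal.ofReal (1 / 16) = ENNReal.ofReal ((1 / 4) ^ 2) := by norm_num
  have wpos : ∀ {M : ℝ → ℝ}, (∀ t, 0 < M t) → ∀ {h : ℝ → ℝ≥0∞},
      ∫⁻ t in Ioi 0, ENNReal.ofReal (timeWeight M t) * h t = ∫⁻ t in Ioi 0,
        ENNReal.ofReal (M t * Real.exp (-(2 * 4) * ∫ s in (0 : ℝ)..t, M s)) * h t :=
    fun hM h => setLIntegral_congr_fun measurableSet_Ioi fun t ht => by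
      simp only [timeWeight_of_nonneg hM (le_of_lt ht)]
  refine add_le_add ?_ ?_
  · rw [h16, wpos hpos, wpos hpos]
    refine le_trans (le_of_eq ?_) (lintegral_Ioi_sq_primitive_le hL hpos four_pos hf)
    refine setLIntegral_congr_fun measurableSet_Ioi fun t ht => ?_
    simp only [uIoc_of_le (le_of_lt (mem_Ioi.mp ht))]
  · simp_rw [timeWeight_neg]
    rw [h16, wpos fun t => hpos (-t), wpos fun t => hpos (-t)]
    refine le_trans (le_of_eq ?_) (lintegral_Ioi_sq_primitive_le hL' (fun t => hpos (-t)) four_pos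
      (hf.comp measurable_neg))
    refine setLIntegral_congr_fun measurableSet_Ioi fun t ht => ?_
    simp only [lintegral_uIoc_neg _ mLf (le_of_lt ht)]

theorem lintegral_timeWeight_lt_top {L : ℝ → ℝ} (hL : Continuous L) (hpos : ∀ t, 0 < L t) :
    ∫⁻ t, ENNReal.ofReal (timeWeight L t) < ⊤ := by
  have key : ∀ {M : ℝ → ℝ}, Continuous M → (∀ t, 0 < M t) →
      ∫⁻ t in Ioi 0, ENNReal.ofReal (timeWeight M t) < ⊤ := by
    intro M hM hp
    have : ∫⁻ t in Ioi 0, ENNReal.ofReal (timeWeight M t) = ∫⁻ t in Ioi 0,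
        ENNReal.ofReal (M t * Real.exp (-(2 * 4) * ∫ s in (0 : ℝ)..t, M s)) :=
      setLIntegral_congr_fun measurableSet_Ioi fun t ht => by
        simp only [timeWeight_of_nonneg hp (le_of_lt ht)]
    rw [this]
    exact (lintegral_Ioi_mul_exp_primitive_le hM hp (by norm_num) 0).trans_lt
      ENNReal.ofReal_lt_top
  rw [lintegral_eq_Ioi_add_Ioi_neg (continuous_timeWeight hL).measurable.ennreal_ofReal]
  simp_rw [timeWeight_neg]
  exact ENNReal.add_lt_top.mpr ⟨key hL hpos, key (hL.comp continuous_neg) fun t => hpos (-t)⟩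

/-! ### Integration along characteristics -/

/-- The shear `(t, x) ↦ (t, x + c t)`, which straightens the characteristics of `∂_t - c ∂_x`. -/
noncomputable def shear (c : ℝ) : (ℝ × ℝ) ≃L[ℝ] (ℝ × ℝ) :=
  ContinuousLinearEquiv.equivOfInverse
    ((ContinuousLinearMap.fst ℝ ℝ ℝ).prod
      (ContinuousLinearMap.snd ℝ ℝ ℝ + c • ContinuousLinearMap.fst ℝ ℝ ℝ))
    ((ContinuousLinearMap.fst ℝ ℝ ℝ).prod
      (ContinuousLinearMap.snd ℝ ℝ ℝ - c • ContinuousLinearMap.fst ℝ ℝ ℝ))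
    (fun p => by simp) (fun p => by simp)

theorem shear_apply (c : ℝ) (p : ℝ × ℝ) : shear c p = (p.1, p.2 + c * p.1) := rfl

theorem shear_symm_apply (c : ℝ) (p : ℝ × ℝ) : (shear c).symm p = (p.1, p.2 - c * p.1) := rfl

theorem measurePreserving_shear (c : ℝ) : MeasurePreserving (shear c) volume volume :=
  (MeasurePreserving.id (volume : Measure ℝ)).skew_product
    (g := fun t x => x + c * t) (by fun_prop)
    (ae_of_all _ fun t => (measurePreserving_add_right volume (c * t)).map_eq)

theorem measurePreserving_shear_symm (c : ℝ) :
    MeasurePreserving (shear c).symm volume volume :=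
  MeasurePreserving.symm (shear c).toHomeomorph.toMeasurableEquiv (measurePreserving_shear c)

theorem lintegral_shear (c : ℝ) {f : ℝ × ℝ → ℝ≥0∞} (hf : Measurable f) :
    ∫⁻ p, f (shear c p) = ∫⁻ p, f p :=
  (measurePreserving_shear c).lintegral_comp hf

theorem LocallyIntegrable.comp_shear_symm {E : Type*} [NormedAddCommGroup E] {f : ℝ × ℝ → E}
    (hf : LocallyIntegrable f) (c : ℝ) : LocallyIntegrable fun p => f ((shear c).symm p) := by
  have h := locallyIntegrable_map_homeomorph (shear c).symm.toHomeomorph (f := f)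
    (μ := (volume : Measure (ℝ × ℝ)))
  exact h.mp (by
    have := (measurePreserving_shear_symm c).map_eq
    change LocallyIntegrable f (Measure.map (shear c).symm volume)
    rwa [this])

theorem ae_slice {P : ℝ × ℝ → Prop} (h : ∀ᵐ p : ℝ × ℝ, P p) : ∀ᵐ y : ℝ, ∀ᵐ t : ℝ, P (t, y) := by
  have h' : ∀ᵐ q : ℝ × ℝ, P q.swap :=
    (Measure.measurePreserving_swap (μ := (volume : Measure ℝ))
      (ν := (volume : Measure ℝ))).quasiMeasurePreserving.ae h
  exact Measure.ae_ae_of_ae_prod h'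

theorem ae_slice_shear (c : ℝ) {P : ℝ × ℝ → Prop} (h : ∀ᵐ p : ℝ × ℝ, P p) :
    ∀ᵐ y : ℝ, ∀ᵐ t : ℝ, P (t, y - c * t) :=
  ae_slice ((measurePreserving_shear_symm c).quasiMeasurePreserving.ae h)

/-- A property of almost all `y` holds at the foot of the characteristic through almost every
point. -/
theorem ae_foot (c : ℝ) {Q : ℝ → Prop} (h : ∀ᵐ y, Q y) :
    ∀ᵐ p : ℝ × ℝ, Q (p.2 + c * p.1) :=
  ((Measure.quasiMeasurePreserving_snd (μ := (volume : Measure ℝ))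
    (ν := (volume : Measure ℝ))).comp (measurePreserving_shear c).quasiMeasurePreserving).ae h

/-- A property of almost all points holds almost everywhere on almost every characteristic. -/
theorem ae_characteristic (c : ℝ) {P : ℝ × ℝ → Prop} (h : ∀ᵐ p : ℝ × ℝ, P p) :
    ∀ᵐ p : ℝ × ℝ, ∀ᵐ s : ℝ, P (s, p.2 + c * (p.1 - s)) := by
  filter_upwards [ae_foot c (ae_slice_shear c h)] with p hp
  filter_upwards [hp] with s hs
  convert hs using 2
  ring

theorem ae_locallyIntegrable_slice {E : Type*} [NormedAddCommGroup E] {G : ℝ × ℝ → E}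
    (hG : LocallyIntegrable G) : ∀ᵐ y : ℝ, LocallyIntegrable fun t => G (t, y) := by
  have key : ∀ n : ℕ, ∀ᵐ y : ℝ, y ∈ Icc (-(n : ℝ)) n →
      IntegrableOn (fun t => G (t, y)) (Icc (-(n : ℝ)) n) := by
    intro n
    have h : IntegrableOn G (Icc (-(n : ℝ)) n ×ˢ Icc (-(n : ℝ)) n) :=
      hG.integrableOn_isCompact (isCompact_Icc.prod isCompact_Icc)
    rw [IntegrableOn, Measure.volume_eq_prod, ← Measure.prod_restrict] at h
    have := h.swap.prod_right_ae
    rw [ae_restrict_iff' measurableSet_Icc] at this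
    exact this
  filter_upwards [ae_all_iff.mpr key] with y hy
  rw [locallyIntegrable_iff]
  intro K hK
  obtain ⟨R, hR⟩ := hK.isBounded.subset_closedBall 0
  obtain ⟨n, hn⟩ := exists_nat_ge (max R |y|)
  have h1 : y ∈ Icc (-(n : ℝ)) n := by
    rw [mem_Icc, ← abs_le]; exact (le_max_right _ _).trans hn
  refine (hy n h1).mono_set (hR.trans ?_)
  rw [Real.closedBall_eq_Icc]
  have := (le_max_left _ _).trans hn
  exact Icc_subset_Icc (by linarith) (by linarith)

/-- The integral of `f ≥ 0` along the characteristic `x + c t = const` between the point `p` and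
the line `t = 0`. -/
noncomputable def charLInt (c : ℝ) (f : ℝ × ℝ → ℝ≥0∞) (p : ℝ × ℝ) : ℝ≥0∞ :=
  ∫⁻ s in uIoc 0 p.1, f (s, p.2 + c * (p.1 - s))

theorem measurableSet_uIoc_fst {X : Type*} [MeasurableSpace X] {g : X → ℝ} (hg : Measurable g) :
    MeasurableSet {q : X × ℝ | q.2 ∈ uIoc 0 (g q.1)} :=
  (measurableSet_lt (measurable_const.min (hg.comp measurable_fst)) measurable_snd).inter
    (measurableSet_le measurable_snd (measurable_const.max (hg.comp measurable_fst)))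

theorem measurable_charLInt (c : ℝ) {f : ℝ × ℝ → ℝ≥0∞} (hf : Measurable f) :
    Measurable (charLInt c f) := by
  have h : Measurable fun p : ℝ × ℝ => ∫⁻ s,
      ({q : (ℝ × ℝ) × ℝ | q.2 ∈ uIoc 0 q.1.1}).indicator
        (fun q => f (q.2, q.1.2 + c * (q.1.1 - q.2))) (p, s) :=
    ((hf.comp (by fun_prop : Measurable fun q : (ℝ × ℝ) × ℝ =>
      (q.2, q.1.2 + c * (q.1.1 - q.2)))).indicator
        (measurableSet_uIoc_fst measurable_fst)).lintegral_prod_right'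
  convert h using 2 with p
  rw [charLInt, ← lintegral_indicator measurableSet_uIoc]
  rfl

theorem charLInt_mono (c : ℝ) {f g : ℝ × ℝ → ℝ≥0∞} {p : ℝ × ℝ}
    (h : ∀ᵐ s : ℝ, f (s, p.2 + c * (p.1 - s)) ≤ g (s, p.2 + c * (p.1 - s))) :
    charLInt c f p ≤ charLInt c g p :=
  lintegral_mono_ae (ae_restrict_of_ae h)

/-- Lebesgue measure on the plane, weighted by `timeWeight`. -/
noncomputable def weightedVolume (L : ℝ → ℝ) : Measure (ℝ × ℝ) :=
  volume.withDensity fun p => ENNReal.ofReal (timeWeight L p.1)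

section Weighted

variable {L : ℝ → ℝ}

theorem measurable_timeWeight_fst (hL : Continuous L) :
    Measurable fun p : ℝ × ℝ => ENNReal.ofReal (timeWeight L p.1) :=
  (continuous_timeWeight hL).measurable.ennreal_ofReal.comp measurable_fst

theorem lintegral_weightedVolume (hL : Continuous L) {f : ℝ × ℝ → ℝ≥0∞} (hf : Measurable f) :
    ∫⁻ p, f p ∂weightedVolume L = ∫⁻ p, ENNReal.ofReal (timeWeight L p.1) * f p :=
  lintegral_withDensity_eq_lintegral_mul _ (measurable_timeWeight_fst hL) hf

theorem ae_weightedVolume_iff (hL : Continuous L) (hpos : ∀ t, 0 < L t) {P : ℝ × ℝ → Prop} :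
    (∀ᵐ p ∂weightedVolume L, P p) ↔ ∀ᵐ p, P p := by
  constructor
  · intro h
    refine Measure.AbsolutelyContinuous.ae_le
      (withDensity_absolutelyContinuous' (measurable_timeWeight_fst hL).aemeasurable
        (ae_of_all _ fun p => ?_)) h
    simp [timeWeight_pos hpos]
  · exact fun h => (withDensity_absolutelyContinuous _ _).ae_le h

/-- Integration along characteristics with density `L` has norm at most `1 / 4` in the weighted
`L²` space. -/
theorem lintegral_sq_charLInt_le (hL : Continuous L) (hpos : ∀ t, 0 < L t) (c : ℝ)
    {f : ℝ × ℝ → ℝ≥0∞} (hf : Measurable f) :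
    ∫⁻ p, charLInt c (fun q => ENNReal.ofReal (L q.1) * f q) p ^ 2 ∂weightedVolume L ≤
      ENNReal.ofReal (1 / 16) * ∫⁻ p, f p ^ 2 ∂weightedVolume L := by
  have mLf : Measurable fun q : ℝ × ℝ => ENNReal.ofReal (L q.1) * f q :=
    (hL.measurable.ennreal_ofReal.comp measurable_fst).mul hf
  have mg : Measurable fun q : ℝ × ℝ => f (q.1, q.2 - c * q.1) := hf.comp (by fun_prop)
  set H : ℝ × ℝ → ℝ≥0∞ := fun q => ENNReal.ofReal (timeWeight L q.1) *
    (∫⁻ s in uIoc 0 q.1, ENNReal.ofReal (L s) * f (s, q.2 - c * s)) ^ 2 with hH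
  have e1 : ∀ p, ENNReal.ofReal (timeWeight L p.1) *
      charLInt c (fun q => ENNReal.ofReal (L q.1) * f q) p ^ 2 = H (shear c p) := by
    intro p
    simp only [hH, shear_apply, charLInt]
    congr 2
    refine lintegral_congr fun s => ?_
    congr 3
    ring
  have mH : Measurable H := by
    have : H = fun q => ENNReal.ofReal (timeWeight L q.1) *
      charLInt c (fun q => ENNReal.ofReal (L q.1) * f q) ((shear c).symm q) ^ 2 := by
      ext q
      have := e1 ((shear c).symm q)
      rw [ContinuousLinearEquiv.apply_symm_apply] at this
      rw [← this]; rfl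
    rw [this]
    exact (measurable_timeWeight_fst hL).mul
      (((measurable_charLInt c mLf).comp (shear c).symm.continuous.measurable).pow_const 2)
  have mK : Measurable fun q : ℝ × ℝ =>
      ENNReal.ofReal (timeWeight L q.1) * f (q.1, q.2 - c * q.1) ^ 2 :=
    (measurable_timeWeight_fst hL).mul (mg.pow_const 2)
  rw [lintegral_weightedVolume hL ((measurable_charLInt c mLf).pow_const 2),
    lintegral_weightedVolume hL (hf.pow_const 2)]
  simp_rw [e1]
  rw [lintegral_shear c mH, Measure.volume_eq_prod, lintegral_prod_symm _ mH.aemeasurable]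
  calc ∫⁻ y, ∫⁻ t, H (t, y)
      ≤ ∫⁻ y, ENNReal.ofReal (1 / 16) *
          ∫⁻ t, ENNReal.ofReal (timeWeight L t) * f (t, y - c * t) ^ 2 :=
        lintegral_mono fun y => lintegral_sq_primitive_le hL hpos
          (f := fun s => f (s, y - c * s)) (hf.comp (by fun_prop))
    _ = ENNReal.ofReal (1 / 16) * ∫⁻ q : ℝ × ℝ,
          ENNReal.ofReal (timeWeight L q.1) * f (q.1, q.2 - c * q.1) ^ 2 := by
        rw [lintegral_const_mul' _ _ ENNReal.ofReal_ne_top, Measure.volume_eq_prod,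
          lintegral_prod_symm _ mK.aemeasurable]
    _ = _ := by
        rw [← lintegral_shear c mK]
        congr 1
        refine lintegral_congr fun p => ?_
        simp only [shear_apply]
        congr 3
        ext <;> simp

/-- Gronwall's inequality for a pair of functions that are controlled along two families of
characteristics. -/
theorem gronwall_characteristics (hL : Continuous L) (hpos : ∀ t, 0 < L t) (c c' : ℝ)
    {f g a b : ℝ × ℝ → ℝ≥0∞} (mf : Measurable f) (mg : Measurable g) (ma : Measurable a)
    (mb : Measurable b)
    (hf : ∀ᵐ p, f p ≤ a p + charLInt c (fun q => ENNReal.ofReal (L q.1) * (f q + g q)) p)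
    (hg : ∀ᵐ p, g p ≤ b p + charLInt c' (fun q => ENNReal.ofReal (L q.1) * (f q + g q)) p)
    (hff : ∫⁻ p, f p ^ 2 ∂weightedVolume L ≠ ⊤) (hgf : ∫⁻ p, g p ^ 2 ∂weightedVolume L ≠ ⊤) :
    (∫⁻ p, f p ^ 2 ∂weightedVolume L) + ∫⁻ p, g p ^ 2 ∂weightedVolume L ≤
      4 * ((∫⁻ p, a p ^ 2 ∂weightedVolume L) + ∫⁻ p, b p ^ 2 ∂weightedVolume L) := by
  have aux : ∀ (c : ℝ) {f' a : ℝ × ℝ → ℝ≥0∞}, Measurable a →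
      (∀ᵐ p, f' p ≤ a p + charLInt c (fun q => ENNReal.ofReal (L q.1) * (f q + g q)) p) →
      ∫⁻ p, f' p ^ 2 ∂weightedVolume L ≤ 2 * (∫⁻ p, a p ^ 2 ∂weightedVolume L) +
        ENNReal.ofReal (1 / 4) * ((∫⁻ p, f p ^ 2 ∂weightedVolume L) +
          ∫⁻ p, g p ^ 2 ∂weightedVolume L) := by
    intro c f' a ma h
    have h1 : ∫⁻ p, f' p ^ 2 ∂weightedVolume L ≤ ∫⁻ p, (2 * a p ^ 2 + 2 *
        charLInt c (fun q => ENNReal.ofReal (L q.1) * (f q + g q)) p ^ 2) ∂weightedVolume L := by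
      refine lintegral_mono_ae ?_
      filter_upwards [(ae_weightedVolume_iff hL hpos).mpr h] with p hp
      exact (pow_le_pow_left' hp 2).trans (ENNReal.add_sq_le _ _)
    have h2 : ∫⁻ p, (f p + g p) ^ 2 ∂weightedVolume L ≤
        2 * ((∫⁻ p, f p ^ 2 ∂weightedVolume L) + ∫⁻ p, g p ^ 2 ∂weightedVolume L) := by
      rw [mul_add, ← lintegral_const_mul' _ _ ENNReal.ofNat_ne_top,
        ← lintegral_const_mul' _ _ ENNReal.ofNat_ne_top,
        ← lintegral_add_left ((mf.pow_const 2).const_mul _)]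
      exact lintegral_mono fun p => ENNReal.add_sq_le _ _
    refine h1.trans ?_
    rw [lintegral_add_left ((ma.pow_const 2).const_mul _),
      lintegral_const_mul' _ _ ENNReal.ofNat_ne_top,
      lintegral_const_mul' _ _ ENNReal.ofNat_ne_top]
    refine add_le_add le_rfl ?_
    calc _ ≤ 2 * (ENNReal.ofReal (1 / 16) * ∫⁻ p, (f p + g p) ^ 2 ∂weightedVolume L) := by
          gcongr
          exact lintegral_sq_charLInt_le hL hpos c (f := fun q => f q + g q) (mf.add mg)
      _ ≤ 2 * (ENNReal.ofReal (1 / 16) * (2 * ((∫⁻ p, f p ^ 2 ∂weightedVolume L) +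
            ∫⁻ p, g p ^ 2 ∂weightedVolume L))) := by gcongr
      _ = _ := by
          have : (2 : ℝ≥0∞) * (ENNReal.ofReal (1 / 16) * 2) = ENNReal.ofReal (1 / 4) := by
            rw [← ENNReal.ofReal_ofNat, ← ENNReal.ofReal_mul (by norm_num),
              ← ENNReal.ofReal_mul (by norm_num)]
            norm_num
          rw [← this]; ring
  have h1 := aux c ma hf
  have h2 := aux c' mb hg
  clear aux
  generalize (∫⁻ p, f p ^ 2 ∂weightedVolume L) = Sf at *
  generalize (∫⁻ p, g p ^ 2 ∂weightedVolume L) = Sg at *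
  generalize (∫⁻ p, a p ^ 2 ∂weightedVolume L) = A at *
  generalize (∫⁻ p, b p ^ 2 ∂weightedVolume L) = B at *
  rcases eq_or_ne A ⊤ with hA | hA
  · simp [hA]
  rcases eq_or_ne B ⊤ with hB | hB
  · simp [hB]
  lift Sf to NNReal using hff
  lift Sg to NNReal using hgf
  lift A to NNReal using hA
  lift B to NNReal using hB
  have hq : ENNReal.ofReal (1 / 4) = ((1 / 4 : NNReal) : ℝ≥0∞) := by
    rw [ENNReal.ofReal, Real.toNNReal_of_nonneg (by norm_num)]
    congr 1
  rw [hq] at h1 h2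
  norm_cast at h1 h2 ⊢
  rw [← NNReal.coe_le_coe] at h1 h2 ⊢
  push_cast at h1 h2 ⊢
  linarith

theorem setLIntegral_weightedVolume_slab_lt_top (hL : Continuous L) {f : ℝ × ℝ → ℝ≥0∞}
    (hf : Measurable f) (T : ℝ) (hfin : ∫⁻ p in slab T, f p < ⊤) :
    ∫⁻ p in slab T, f p ∂weightedVolume L < ⊤ := by
  have hT : MeasurableSet (slab T) := measurableSet_Ioo.prod MeasurableSet.univ
  obtain ⟨C, hC⟩ := (isCompact_Icc (a := -T) (b := T)).exists_bound_of_continuousOn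
    (continuous_timeWeight hL).continuousOn
  rw [← lintegral_indicator hT, lintegral_weightedVolume hL (hf.indicator hT)]
  calc _ ≤ ∫⁻ p, ENNReal.ofReal C * (slab T).indicator f p := by
        refine lintegral_mono fun p => ?_
        by_cases hp : p ∈ slab T
        · refine mul_le_mul_left (ENNReal.ofReal_le_ofReal ?_) _
          have h : p.1 ∈ Ioo (-T) T := hp.1
          exact (le_abs_self _).trans (hC p.1 (Ioo_subset_Icc_self h))
        · simp [hp]
    _ < ⊤ := by
        rw [lintegral_const_mul _ (hf.indicator hT), lintegral_indicator hT]
        exact ENNReal.mul_lt_top ENNReal.ofReal_lt_top hfin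

theorem exists_setLIntegral_slab_le (hL : Continuous L) (hpos : ∀ t, 0 < L t) (T : ℝ) :
    ∃ C : ℝ, ∀ f : ℝ × ℝ → ℝ≥0∞, Measurable f → ∫⁻ p in slab T, f p ≤
      ENNReal.ofReal C * ∫⁻ p, f p ∂weightedVolume L := by
  have hT : MeasurableSet (slab T) := measurableSet_Ioo.prod MeasurableSet.univ
  obtain ⟨C, hC⟩ := (isCompact_Icc (a := -T) (b := T)).exists_bound_of_continuousOn
    ((continuous_timeWeight hL).inv₀ fun t => (timeWeight_pos hpos t).ne').continuousOn
  refine ⟨max C 1, fun f hf => ?_⟩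
  rw [← lintegral_indicator hT, lintegral_weightedVolume hL hf,
    ← lintegral_const_mul' _ _ ENNReal.ofReal_ne_top]
  refine lintegral_mono fun p => ?_
  by_cases hp : p ∈ slab T
  · rw [indicator_of_mem hp]
    have h : p.1 ∈ Ioo (-T) T := hp.1
    have h1 := (le_abs_self _).trans (hC p.1 (Ioo_subset_Icc_self h))
    have hw := timeWeight_pos hpos p.1
    simp only [Pi.inv_apply] at h1
    rw [← mul_assoc, ← ENNReal.ofReal_mul (by positivity)]
    refine le_mul_of_one_le_left' ?_
    rw [ENNReal.one_le_ofReal]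
    calc (1 : ℝ) = (timeWeight L p.1)⁻¹ * timeWeight L p.1 := (inv_mul_cancel₀ hw.ne').symm
      _ ≤ _ := by gcongr; exact h1.trans (le_max_left _ _)
  · simp [hp]

/-- A pair of functions, square integrable on every slab, that is dominated by its own integrals
along characteristics, vanishes. -/
theorem ae_eq_zero_of_le_charLInt (hL : Continuous L) (hpos : ∀ t, 0 < L t) (c c' : ℝ)
    {f g : ℝ × ℝ → ℝ≥0∞} (mf : Measurable f) (mg : Measurable g)
    (hf : ∀ᵐ p, f p ≤ charLInt c (fun q => ENNReal.ofReal (L q.1) * (f q + g q)) p)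
    (hg : ∀ᵐ p, g p ≤ charLInt c' (fun q => ENNReal.ofReal (L q.1) * (f q + g q)) p)
    (hff : ∀ T, 0 < T → ∫⁻ p in slab T, f p ^ 2 < ⊤)
    (hgf : ∀ T, 0 < T → ∫⁻ p in slab T, g p ^ 2 < ⊤) :
    ∀ᵐ p, f p = 0 ∧ g p = 0 := by
  have key : ∀ n : ℕ, ∀ᵐ p : ℝ × ℝ, p ∈ slab (n + 1) → f p = 0 ∧ g p = 0 := by
    intro n
    set T : ℝ := n + 1
    have hT0 : 0 < T := by positivity
    have hT : MeasurableSet (slab T) := measurableSet_Ioo.prod MeasurableSet.univ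
    set F := (slab T).indicator f
    set G := (slab T).indicator g
    have mF : Measurable F := mf.indicator hT
    have mG : Measurable G := mg.indicator hT
    -- a characteristic from a point of the slab to the line `t = 0` stays in the slab
    have loc : ∀ (c : ℝ) (p : ℝ × ℝ), p ∈ slab T →
        charLInt c (fun q => ENNReal.ofReal (L q.1) * (f q + g q)) p =
        charLInt c (fun q => ENNReal.ofReal (L q.1) * (F q + G q)) p := by
      intro c p hp
      refine setLIntegral_congr_fun measurableSet_uIoc fun s hs => ?_
      have h : p.1 ∈ Ioo (-T) T := hp.1
      have hs' : s ∈ Ioo (-T) T := by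
        rw [mem_uIoc] at hs
        rcases hs with hs | hs <;> constructor <;> linarith [h.1, h.2]
      have hm : (s, p.2 + c * (p.1 - s)) ∈ slab T := ⟨hs', mem_univ _⟩
      simp only [F, G, indicator_of_mem hm]
    have sq : ∀ h : ℝ × ℝ → ℝ≥0∞, (fun p => (slab T).indicator h p ^ 2) =
        (slab T).indicator fun p => h p ^ 2 := by
      intro h; ext p
      by_cases hp : p ∈ slab T <;> simp [hp]
    have fin : ∀ h : ℝ × ℝ → ℝ≥0∞, Measurable h → ∫⁻ p in slab T, h p ^ 2 < ⊤ →
        ∫⁻ p, (slab T).indicator h p ^ 2 ∂weightedVolume L ≠ ⊤ := by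
      intro h mh hh
      rw [sq, lintegral_indicator hT]
      exact (setLIntegral_weightedVolume_slab_lt_top hL (mh.pow_const 2) T hh).ne
    have hF : ∀ᵐ p, F p ≤ (0 : ℝ × ℝ → ℝ≥0∞) p +
        charLInt c (fun q => ENNReal.ofReal (L q.1) * (F q + G q)) p := by
      filter_upwards [hf] with p hp
      by_cases hps : p ∈ slab T
      · rw [← loc c p hps]; simpa [F, hps] using hp
      · simp [F, hps]
    have hG : ∀ᵐ p, G p ≤ (0 : ℝ × ℝ → ℝ≥0∞) p +
        charLInt c' (fun q => ENNReal.ofReal (L q.1) * (F q + G q)) p := by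
      filter_upwards [hg] with p hp
      by_cases hps : p ∈ slab T
      · rw [← loc c' p hps]; simpa [G, hps] using hp
      · simp [G, hps]
    have := gronwall_characteristics hL hpos c c' mF mG measurable_zero measurable_zero hF hG
      (fin f mf (hff T hT0)) (fin g mg (hgf T hT0))
    simp only [Pi.zero_apply, ne_eq, OfNat.ofNat_ne_zero, not_false_eq_true, zero_pow,
      lintegral_const, zero_mul, add_zero, mul_zero, nonpos_iff_eq_zero, add_eq_zero] at this
    have hF0 := (ae_weightedVolume_iff hL hpos).mp
      ((lintegral_eq_zero_iff (mF.pow_const 2)).mp this.1)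
    have hG0 := (ae_weightedVolume_iff hL hpos).mp
      ((lintegral_eq_zero_iff (mG.pow_const 2)).mp this.2)
    filter_upwards [hF0, hG0] with p h1 h2 hp
    simpa [F, G, hp] using And.intro h1 h2
  filter_upwards [ae_all_iff.mpr key] with p hp
  obtain ⟨n, hn⟩ := exists_nat_ge |p.1|
  refine hp n ⟨?_, mem_univ _⟩
  rw [mem_Ioo, ← abs_lt]
  linarith

end Weighted

/-! ### Transport equations: weak and integrated form -/

/-- The integral of `F` along the characteristic `x + c t = const` from the line `t = 0` to the
point `p`. -/
noncomputable def charInt (c : ℝ) (F : ℝ × ℝ → ℂ) (p : ℝ × ℝ) : ℂ :=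
  ∫ s in (0 : ℝ)..p.1, F (s, p.2 + c * (p.1 - s))

/-- The integrated form of the transport equation `(∂_t - c ∂_x) f = F`, `f(0, ·) = f₀`. -/
def IsMildTransport (c : ℝ) (f₀ : ℝ → ℂ) (F f : ℝ × ℝ → ℂ) : Prop :=
  ∀ᵐ p : ℝ × ℝ, f p = f₀ (p.2 + c * p.1) + charInt c F p

theorem charInt_shear_symm (c : ℝ) (F : ℝ × ℝ → ℂ) (t y : ℝ) :
    charInt c F (t, y - c * t) = ∫ s in (0 : ℝ)..t, F (s, y - c * s) := by
  refine intervalIntegral.integral_congr fun s _ => ?_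
  congr 2
  ring

theorem charInt_congr (c : ℝ) {F G : ℝ × ℝ → ℂ} (h : F =ᵐ[volume] G) :
    charInt c F =ᵐ[volume] charInt c G := by
  filter_upwards [ae_characteristic c h] with p hp
  refine intervalIntegral.integral_congr_ae ?_
  filter_upwards [hp] with s hs _
  exact hs

theorem stronglyMeasurable_charInt (c : ℝ) {F : ℝ × ℝ → ℂ} (hF : StronglyMeasurable F) :
    StronglyMeasurable (charInt c F) := by
  have hG : StronglyMeasurable fun q : (ℝ × ℝ) × ℝ => F (q.2, q.1.2 + c * (q.1.1 - q.2)) :=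
    hF.comp_measurable (by fun_prop)
  have m1 : MeasurableSet {q : (ℝ × ℝ) × ℝ | q.2 ∈ Ioc 0 q.1.1} :=
    (measurableSet_lt measurable_const measurable_snd).inter
      (measurableSet_le measurable_snd (measurable_fst.comp measurable_fst))
  have m2 : MeasurableSet {q : (ℝ × ℝ) × ℝ | q.2 ∈ Ioc q.1.1 0} :=
    (measurableSet_lt (measurable_fst.comp measurable_fst) measurable_snd).inter
      (measurableSet_le measurable_snd measurable_const)
  have h1 := (hG.indicator m1).integral_prod_right' (ν := (volume : Measure ℝ))
  have h2 := (hG.indicator m2).integral_prod_right' (ν := (volume : Measure ℝ))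
  convert h1.sub h2 using 1
  ext p
  simp only [charInt, intervalIntegral, Pi.sub_apply]
  rw [← integral_indicator measurableSet_Ioc, ← integral_indicator measurableSet_Ioc]
  rfl

theorem aestronglyMeasurable_charInt (c : ℝ) {F : ℝ × ℝ → ℂ} (hF : AEStronglyMeasurable F) :
    AEStronglyMeasurable (charInt c F) :=
  ⟨_, stronglyMeasurable_charInt c hF.stronglyMeasurable_mk, charInt_congr c hF.ae_eq_mk⟩

theorem enorm_charInt_le (c : ℝ) (F : ℝ × ℝ → ℂ) (p : ℝ × ℝ) :
    ‖charInt c F p‖ₑ ≤ charLInt c (fun q => ‖F q‖ₑ) p := by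
  rw [charInt, charLInt, ← ofReal_norm, intervalIntegral.norm_intervalIntegral_eq,
    ofReal_norm]
  exact enorm_integral_le_lintegral_enorm _

theorem IsMildTransport.slice {c : ℝ} {f₀ : ℝ → ℂ} {F f : ℝ × ℝ → ℂ}
    (h : IsMildTransport c f₀ F f) :
    ∀ᵐ y : ℝ, ∀ᵐ t : ℝ, f (t, y - c * t) = f₀ y + ∫ s in (0 : ℝ)..t, F (s, y - c * s) := by
  filter_upwards [ae_slice_shear c h] with y hy
  filter_upwards [hy] with t ht
  rw [ht, charInt_shear_symm]
  simp

theorem ae_locallyIntegrable_characteristic {E : Type*} [NormedAddCommGroup E] (c : ℝ)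
    {F : ℝ × ℝ → E} (hF : LocallyIntegrable F) :
    ∀ᵐ y : ℝ, LocallyIntegrable fun t => F (t, y - c * t) :=
  ae_locallyIntegrable_slice (LocallyIntegrable.comp_shear_symm hF c)

theorem IsTestFunction.hasDerivAt_characteristic {φ : ℝ × ℝ → ℝ} (hφ : IsTestFunction univ φ)
    (c y t : ℝ) :
    HasDerivAt (fun t => φ (t, y - c * t)) (fderiv ℝ φ (t, y - c * t) (1, -c)) t := by
  have h1 : HasFDerivAt φ (fderiv ℝ φ (t, y - c * t)) (t, y - c * t) :=
    (hφ.1.differentiable (by simp) _).hasFDerivAt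
  have h2 : HasDerivAt (fun t : ℝ => (t, y - c * t)) (1, -c) t := by
    refine (hasDerivAt_id t).prodMk ?_
    simpa using ((hasDerivAt_id t).const_mul c).const_sub y
  exact h1.comp_hasDerivAt t h2

theorem IsTestFunction.continuous_fderiv_apply {φ : ℝ × ℝ → ℝ} {Ω : Set (ℝ × ℝ)}
    (hφ : IsTestFunction Ω φ) (v : ℝ × ℝ) : Continuous fun p => fderiv ℝ φ p v :=
  (hφ.1.continuous_fderiv (by simp)).clm_apply continuous_const

theorem IsTestFunction.hasCompactSupport_fderiv_apply {φ : ℝ × ℝ → ℝ} {Ω : Set (ℝ × ℝ)}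
    (hφ : IsTestFunction Ω φ) (v : ℝ × ℝ) : HasCompactSupport fun p => fderiv ℝ φ p v :=
  hφ.2.1.fderiv_apply (𝕜 := ℝ) v

/-- The integrated form of the transport equation implies the weak form. -/
theorem IsMildTransport.hasWeakDirDeriv {c : ℝ} {f₀ : ℝ → ℂ} {F f : ℝ × ℝ → ℂ}
    (h : IsMildTransport c f₀ F f) (hf : LocallyIntegrable f) (hF : LocallyIntegrable F) :
    HasWeakDirDeriv univ f (1, -c) F := by
  intro φ hφ
  rw [Measure.restrict_univ]
  have i1 : Integrable fun p => fderiv ℝ φ p (1, -c) • f p :=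
    hf.integrable_smul_left_of_hasCompactSupport (hφ.continuous_fderiv_apply _)
      (hφ.hasCompactSupport_fderiv_apply _)
  have i2 : Integrable fun p => φ p • F p :=
    hF.integrable_smul_left_of_hasCompactSupport hφ.1.continuous hφ.2.1
  have mp := measurePreserving_shear_symm c
  have me : MeasurableEmbedding (shear c).symm := (shear c).symm.toHomeomorph.measurableEmbedding
  have j1 := (mp.integrable_comp_emb me).mpr i1
  have j2 := (mp.integrable_comp_emb me).mpr i2
  rw [← mp.integral_comp me (fun p => fderiv ℝ φ p (1, -c) • f p),
    ← mp.integral_comp me (fun p => φ p • F p)]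
  rw [Measure.volume_eq_prod, Function.comp_def] at j1 j2
  rw [Measure.volume_eq_prod]
  rw [integral_prod_symm _ j1, integral_prod_symm _ j2, ← integral_neg]
  refine integral_congr_ae ?_
  filter_upwards [h.slice, ae_locallyIntegrable_characteristic c hF] with y hy hFy
  have hχ : ContDiff ℝ ∞ fun t : ℝ => φ (t, y - c * t) := hφ.1.comp (by fun_prop)
  have hχc : HasCompactSupport fun t : ℝ => φ (t, y - c * t) := by
    refine HasCompactSupport.intro (hφ.2.1.isCompact.image continuous_fst) fun t ht => ?_
    refine image_eq_zero_of_notMem_tsupport fun h' => ht ⟨_, h', rfl⟩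
  simp only [shear_symm_apply]
  rw [← integral_deriv_smul_add_primitive hFy (f₀ y) hχ hχc]
  refine integral_congr_ae ?_
  filter_upwards [hy] with t ht
  simp only [ht, (hφ.hasDerivAt_characteristic c y t).deriv]

theorem locallyIntegrable_integral_smul {G : ℝ × ℝ → ℂ} (hG : LocallyIntegrable G) {β : ℝ → ℝ}
    (hβ : Continuous β) (hc : HasCompactSupport β) :
    LocallyIntegrable fun t => ∫ y, β y • G (t, y) := by
  rw [locallyIntegrable_iff]
  intro K hK
  have h1 : IntegrableOn (fun p : ℝ × ℝ => β p.2 • G p) (K ×ˢ univ) := by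
    have hsub : IntegrableOn (fun p : ℝ × ℝ => β p.2 • G p) (K ×ˢ tsupport β) :=
      (hG.integrableOn_isCompact (hK.prod hc)).continuousOn_smul
        (hβ.comp continuous_snd).continuousOn (hK.prod hc)
    refine IntegrableOn.of_forall_sdiff_eq_zero hsub (hK.measurableSet.prod MeasurableSet.univ) ?_
    rintro ⟨t, y⟩ ⟨⟨h1, _⟩, h2⟩
    have : y ∉ tsupport β := fun h => h2 ⟨h1, h⟩
    simp [image_eq_zero_of_notMem_tsupport this]
  rw [IntegrableOn, Measure.volume_eq_prod, ← Measure.prod_restrict, Measure.restrict_univ] at h1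
  exact h1.integral_prod_left

/-- Fubini for a primitive in time, tested in space. -/
theorem intervalIntegral_integral_smul {G : ℝ × ℝ → ℂ} (hG : LocallyIntegrable G) {β : ℝ → ℝ}
    (hβ : Continuous β) (hc : HasCompactSupport β) (t : ℝ) :
    Integrable (fun y => β y • ∫ s in (0 : ℝ)..t, G (s, y)) ∧
    ∫ s in (0 : ℝ)..t, (∫ y, β y • G (s, y)) = ∫ y, β y • ∫ s in (0 : ℝ)..t, G (s, y) := by
  have h1 : IntegrableOn (fun p : ℝ × ℝ => β p.2 • G p) (uIoc 0 t ×ˢ univ) := by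
    have hsub : IntegrableOn (fun p : ℝ × ℝ => β p.2 • G p) (uIcc 0 t ×ˢ tsupport β) :=
      (hG.integrableOn_isCompact (isCompact_uIcc.prod hc)).continuousOn_smul
        (hβ.comp continuous_snd).continuousOn (isCompact_uIcc.prod hc)
    refine IntegrableOn.of_forall_sdiff_eq_zero
      (hsub.mono_set (prod_mono uIoc_subset_uIcc le_rfl))
      (measurableSet_uIoc.prod MeasurableSet.univ) ?_
    rintro ⟨t, y⟩ ⟨⟨h1, _⟩, h2⟩
    have : y ∉ tsupport β := fun h => h2 ⟨h1, h⟩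
    simp [image_eq_zero_of_notMem_tsupport this]
  rw [IntegrableOn, Measure.volume_eq_prod, ← Measure.prod_restrict, Measure.restrict_univ] at h1
  have e : ∀ y, ∫ s in uIoc 0 t, β y • G (s, y) = β y • ∫ s in uIoc 0 t, G (s, y) :=
    fun y => integral_smul _ _
  simp_rw [intervalIntegral.intervalIntegral_eq_integral_uIoc]
  constructor
  · have h2 := h1.integral_prod_right
    simp only [e] at h2
    convert h2.smul (if 0 ≤ t then (1 : ℝ) else -1) using 1
    ext y
    simp only [Pi.smul_apply]
    rw [smul_comm]
  · rw [integral_integral_swap h1, ← integral_smul]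
    refine integral_congr_ae (ae_of_all _ fun y => ?_)
    simp only [e]
    rw [smul_comm]

instance fact_two_ne_top : Fact ((2 : ℝ≥0∞) ≠ ⊤) := ⟨ENNReal.ofNat_ne_top⟩

/-- Translation of an `L²` function: `x ↦ f (h + x)`. -/
noncomputable def translateLp {E : Type*} [NormedAddCommGroup E] (h : ℝ)
    (f : Lp E 2 (volume : Measure ℝ)) : Lp E 2 (volume : Measure ℝ) :=
  DomAddAct.mk h +ᵥ f

theorem translateLp_ae_eq {E : Type*} [NormedAddCommGroup E] (h : ℝ)
    (f : Lp E 2 (volume : Measure ℝ)) : ∀ᵐ x, translateLp h f x = f (h + x) :=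
  DomAddAct.vadd_Lp_ae_eq (DomAddAct.mk h) f

theorem Continuous.translateLp {E : Type*} [NormedAddCommGroup E] {h : ℝ → ℝ}
    {f : ℝ → Lp E 2 (volume : Measure ℝ)} (hh : Continuous h) (hf : Continuous f) :
    Continuous fun t => translateLp (h t) (f t) :=
  (DomAddAct.continuous_mk.comp hh).vadd hf

theorem continuous_integral_smul_Lp {β : ℝ → ℝ} (hβ : Continuous β) (hc : HasCompactSupport β) :
    Continuous fun f : Lp ℂ 2 (volume : Measure ℝ) => ∫ y, β y • f y := by
  have hb : MemLp (fun y => (β y : ℂ)) 2 (volume : Measure ℝ) :=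
    (Complex.continuous_ofReal.comp hβ).memLp_of_hasCompactSupport
      (hc.comp_left Complex.ofReal_zero)
  have : (fun f : Lp ℂ 2 (volume : Measure ℝ) => ∫ y, β y • f y) =
      fun f => inner ℂ hb.toLp f := by
    ext f
    rw [L2.inner_def]
    refine integral_congr_ae ?_
    filter_upwards [hb.coeFn_toLp] with y hy
    rw [hy]
    simp [mul_comm]
  rw [this]
  fun_prop

/-- A weak solution of a transport equation that is a continuous curve in `L²` satisfies the
integrated equation. -/
theorem IsMildTransport.of_hasWeakDirDeriv {c : ℝ} {F f : ℝ × ℝ → ℂ}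
    (h : HasWeakDirDeriv univ f (1, -c) F) (hf : LocallyIntegrable f) (hF : LocallyIntegrable F)
    {v : ℝ → Lp ℂ 2 (volume : Measure ℝ)} (hv : Continuous v)
    (hvf : ∀ᵐ t, ∀ᵐ x, v t x = f (t, x)) : IsMildTransport c (v 0) F f := by
  set fe : ℝ × ℝ → ℂ := fun p => f ((shear c).symm p) with hfe
  set Fe : ℝ × ℝ → ℂ := fun p => F ((shear c).symm p) with hFe
  have lfe : LocallyIntegrable fe := LocallyIntegrable.comp_shear_symm hf c
  have lFe : LocallyIntegrable Fe := LocallyIntegrable.comp_shear_symm hF c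
  set V : ℝ → Lp ℂ 2 (volume : Measure ℝ) := fun t => translateLp (-(c * t)) (v t) with hV
  have hVc : Continuous V := Continuous.translateLp (by fun_prop) hv
  have hVf : ∀ᵐ t, ∀ᵐ y, V t y = fe (t, y) := by
    filter_upwards [hvf] with t ht
    filter_upwards [translateLp_ae_eq (-(c * t)) (v t),
      (measurePreserving_add_left volume (-(c * t))).quasiMeasurePreserving.ae ht] with y h1 h2
    rw [hV]
    simp only
    rw [h1, h2, hfe]
    simp only [shear_symm_apply]
    congr 2
    ring
  have hV0 : V 0 =ᵐ[volume] v 0 := by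
    filter_upwards [translateLp_ae_eq (-(c * 0)) (v 0)] with y h1
    rw [hV]
    simp only
    rw [h1]
    simp
  -- the equation tested with a product in straightened coordinates
  have weak : ∀ α β : ℝ → ℝ, ContDiff ℝ ∞ α → HasCompactSupport α → ContDiff ℝ ∞ β →
      HasCompactSupport β →
      ∫ t, deriv α t • (∫ y, β y • fe (t, y)) = -∫ t, α t • (∫ y, β y • Fe (t, y)) := by
    intro α β hα hαc hβ hβc
    set φ : ℝ × ℝ → ℝ := fun p => α p.1 * β (p.2 + c * p.1) with hφ
    have test : IsTestFunction univ φ := by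
      refine ⟨?_, ?_, subset_univ _⟩
      · exact (hα.comp contDiff_fst).mul (hβ.comp (by fun_prop))
      · refine HasCompactSupport.intro ((hαc.isCompact.prod hβc.isCompact).image
          (shear c).symm.continuous) fun p hp => ?_
        by_contra hne
        have h1 : α p.1 ≠ 0 := left_ne_zero_of_mul hne
        have h2 : β (p.2 + c * p.1) ≠ 0 := right_ne_zero_of_mul hne
        refine hp ⟨shear c p, ⟨subset_tsupport _ h1, subset_tsupport _ h2⟩, ?_⟩
        simp
    have hd : ∀ t y, fderiv ℝ φ (t, y - c * t) (1, -c) = deriv α t * β y := by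
      intro t y
      have h1 := test.hasDerivAt_characteristic c y t
      have h2 : (fun t => φ (t, y - c * t)) = fun t => α t * β y := by
        ext t; simp [hφ]
      rw [h2] at h1
      exact h1.unique (((hα.differentiable (by simp) t).hasDerivAt).mul_const _)
    have h0 := h φ test
    rw [Measure.restrict_univ] at h0
    have i1 : Integrable fun p => fderiv ℝ φ p (1, -c) • f p :=
      hf.integrable_smul_left_of_hasCompactSupport (test.continuous_fderiv_apply _)
        (test.hasCompactSupport_fderiv_apply _)
    have i2 : Integrable fun p => φ p • F p :=
      hF.integrable_smul_left_of_hasCompactSupport test.1.continuous test.2.1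
    have mp := measurePreserving_shear_symm c
    have me : MeasurableEmbedding (shear c).symm :=
      (shear c).symm.toHomeomorph.measurableEmbedding
    have j1 := (mp.integrable_comp_emb me).mpr i1
    have j2 := (mp.integrable_comp_emb me).mpr i2
    rw [← mp.integral_comp me (fun p => fderiv ℝ φ p (1, -c) • f p),
      ← mp.integral_comp me (fun p => φ p • F p)] at h0
    rw [Measure.volume_eq_prod, Function.comp_def] at j1 j2
    rw [Measure.volume_eq_prod] at h0
    rw [integral_prod _ j1, integral_prod _ j2] at h0
    have e1 : ∀ t y, fderiv ℝ φ ((shear c).symm (t, y)) (1, -c) • f ((shear c).symm (t, y)) =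
        deriv α t • (β y • fe (t, y)) := by
      intro t y
      simp only [shear_symm_apply, hd, hfe, mul_smul]
    have e2 : ∀ t y, φ ((shear c).symm (t, y)) • F ((shear c).symm (t, y)) =
        α t • (β y • Fe (t, y)) := by
      intro t y
      simp only [shear_symm_apply, hφ, hFe, mul_smul, sub_add_cancel]
    simp only [e1, e2, integral_smul] at h0
    exact h0
  -- tested with `β`, both sides are continuous in `t`, so that they agree at every time
  have slice : ∀ t, ∀ᵐ y, V t y = v 0 y + ∫ s in (0 : ℝ)..t, Fe (s, y) := by
    intro t
    have lprim : LocallyIntegrable fun y => ∫ s in (0 : ℝ)..t, Fe (s, y) := by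
      rw [locallyIntegrable_iff]
      intro K hK
      have h1 : IntegrableOn Fe (uIoc 0 t ×ˢ K) :=
        (lFe.integrableOn_isCompact (isCompact_uIcc.prod hK)).mono_set
          (prod_mono uIoc_subset_uIcc le_rfl)
      rw [IntegrableOn, Measure.volume_eq_prod, ← Measure.prod_restrict] at h1
      simp_rw [intervalIntegral.intervalIntegral_eq_integral_uIoc]
      exact h1.integral_prod_right.smul (if 0 ≤ t then (1 : ℝ) else -1)
    have lV : ∀ t, LocallyIntegrable (V t) := fun t =>
      (Lp.memLp (V t)).locallyIntegrable (by norm_num)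
    refine ae_eq_of_integral_contDiff_smul_eq (lV t)
      (((Lp.memLp (v 0)).locallyIntegrable (by norm_num)).add lprim) fun β hβ hβc => ?_
    have lE := locallyIntegrable_integral_smul lfe hβ.continuous hβc
    have lG := locallyIntegrable_integral_smul lFe hβ.continuous hβc
    obtain ⟨z, hz⟩ := ae_eq_add_primitive_of_weak lE lG fun α hα hαc => weak α β hα hαc hβ hβc
    have cE : Continuous fun t => ∫ y, β y • V t y :=
      (continuous_integral_smul_Lp hβ.continuous hβc).comp hVc
    have hEV : (fun t => ∫ y, β y • V t y) =
        fun t => z + ∫ s in (0 : ℝ)..t, (∫ y, β y • Fe (s, y)) := by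
      refine Measure.eq_of_ae_eq (μ := (volume : Measure ℝ)) ?_ cE (continuous_add_primitive lG z)
      filter_upwards [hz, hVf] with s hs hs'
      rw [← hs]
      refine integral_congr_ae ?_
      filter_upwards [hs'] with y hy
      rw [hy]
    have ez : z = ∫ y, β y • v 0 y := by
      have := congrFun hEV 0
      simp only [intervalIntegral.integral_same, add_zero] at this
      rw [← this]
      refine integral_congr_ae ?_
      filter_upwards [hV0] with y hy
      rw [hy]
    obtain ⟨ip, ep⟩ := intervalIntegral_integral_smul lFe hβ.continuous hβc t
    have := congrFun hEV t
    rw [this, ez, ep]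
    simp only [smul_add]
    exact (integral_add (((Lp.memLp (v 0)).locallyIntegrable
      (by norm_num)).integrable_smul_left_of_hasCompactSupport hβ.continuous hβc) ip).symm
  -- almost every time slice agrees, hence almost every point
  have hmeas : AEStronglyMeasurable (fun p : ℝ × ℝ => fe p -
      (v 0 p.2 + ∫ s in (0 : ℝ)..p.1, Fe (s, p.2))) := by
    refine lfe.aestronglyMeasurable.sub (AEStronglyMeasurable.add ?_ ?_)
    · exact (Lp.aestronglyMeasurable (v 0)).comp_snd
    · have e : (fun p : ℝ × ℝ => ∫ s in (0 : ℝ)..p.1, Fe (s, p.2)) = charInt 0 Fe := by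
        ext p; simp [charInt]
      rw [e]
      exact aestronglyMeasurable_charInt 0 lFe.aestronglyMeasurable
  have hae : ∀ᵐ p : ℝ × ℝ, fe p = v 0 p.2 + ∫ s in (0 : ℝ)..p.1, Fe (s, p.2) := by
    have h0 : ∫⁻ p : ℝ × ℝ, ‖fe p - (v 0 p.2 + ∫ s in (0 : ℝ)..p.1, Fe (s, p.2))‖ₑ = 0 := by
      rw [Measure.volume_eq_prod, lintegral_prod _ hmeas.enorm]
      refine lintegral_eq_zero_of_ae_eq_zero ?_
      filter_upwards [hVf] with t ht
      refine lintegral_eq_zero_of_ae_eq_zero ?_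
      filter_upwards [ht, slice t] with y h1 h2
      rw [← h1, h2]
      simp
    rw [lintegral_eq_zero_iff' hmeas.enorm] at h0
    filter_upwards [h0] with p hp
    simpa [sub_eq_zero] using hp
  filter_upwards [(measurePreserving_shear c).quasiMeasurePreserving.ae hae] with p hp
  simp only [hfe, ContinuousLinearEquiv.symm_apply_apply, hFe] at hp
  rw [hp]
  simp only [shear_apply, shear_symm_apply]
  congr 1
  refine intervalIntegral.integral_congr fun s _ => ?_
  congr 2
  ring

/-! ### The a priori bound -/

/-- The real potential `V` rotates the phase of `u` only, hence does not enter the bound on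
`|u|`. -/
theorem IsMildTransport.enorm_le {c lam ℓ M : ℝ} (hlam : |lam| ≤ ℓ) {u₀ : ℝ → ℂ}
    {u w : ℝ × ℝ → ℂ} {V : ℝ × ℝ → ℝ}
    (h : IsMildTransport c u₀ (fun p => -Complex.I * (lam * w p + V p * u p)) u)
    (hF : LocallyIntegrable fun p => -Complex.I * (lam * w p + V p * u p))
    (hw : LocallyIntegrable w) (hu₀ : ∀ᵐ x, ‖u₀ x‖ ≤ M) :
    ∀ᵐ p, ‖u p‖ₑ ≤ ENNReal.ofReal M +
      charLInt c (fun q => ENNReal.ofReal (2 * ℓ) * ‖w q‖ₑ) p := by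
  have hℓ : 0 ≤ ℓ := (abs_nonneg lam).trans hlam
  have key : ∀ᵐ y : ℝ, ∀ t : ℝ, ‖u₀ y + ∫ s in (0 : ℝ)..t,
      -Complex.I * (lam * w (s, y - c * s) + V (s, y - c * s) * u (s, y - c * s))‖ₑ ≤
      ENNReal.ofReal M + ∫⁻ s in uIoc 0 t, ENNReal.ofReal (2 * ℓ) * ‖w (s, y - c * s)‖ₑ := by
    filter_upwards [h.slice, ae_locallyIntegrable_characteristic c hF,
      ae_locallyIntegrable_characteristic c hw, hu₀] with y hy hFy hwy hy0 t
    have hq : LocallyIntegrable fun s => ℓ * ‖w (s, y - c * s)‖ := fun x =>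
      let ⟨S, hS, h⟩ := hwy x
      ⟨S, hS, h.norm.const_mul ℓ⟩
    have hle := norm_add_primitive_le hFy hq (fun s => by positivity) (u₀ y) (by
      filter_upwards [hy] with s hs
      rw [hs]
      set U := u₀ y + ∫ r in (0 : ℝ)..s, -Complex.I * (lam * w (r, y - c * r) +
        V (r, y - c * r) * u (r, y - c * r))
      have e : ((starRingEnd ℂ) U * (-Complex.I * (lam * w (s, y - c * s) +
          V (s, y - c * s) * U))).re = lam * ((starRingEnd ℂ) U * w (s, y - c * s)).im := by
        simp [Complex.mul_re, Complex.mul_im]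
        ring
      rw [e, abs_mul]
      calc |lam| * |((starRingEnd ℂ) U * w (s, y - c * s)).im|
          ≤ ℓ * ‖(starRingEnd ℂ) U * w (s, y - c * s)‖ := by
            gcongr
            exact Complex.abs_im_le_norm _
        _ = ‖U‖ * (ℓ * ‖w (s, y - c * s)‖) := by
            rw [norm_mul, RCLike.norm_conj]; ring) t
    have hint : IntegrableOn (fun s => ℓ * ‖w (s, y - c * s)‖) (uIoc 0 t) :=
      (hq.integrableOn_isCompact isCompact_uIcc).mono_set uIoc_subset_uIcc
    have e2 : ENNReal.ofReal (2 * ∫ s in uIoc 0 t, ℓ * ‖w (s, y - c * s)‖) =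
        ∫⁻ s in uIoc 0 t, ENNReal.ofReal (2 * ℓ) * ‖w (s, y - c * s)‖ₑ := by
      rw [← integral_const_mul, ofReal_integral_eq_lintegral_ofReal (hint.const_mul 2)
        (ae_of_all _ fun s => by positivity)]
      refine lintegral_congr fun s => ?_
      rw [← mul_assoc, ENNReal.ofReal_mul (by positivity), ofReal_norm]
    rw [← e2, ← ofReal_norm, ← ENNReal.ofReal_add ((norm_nonneg _).trans hy0)
      (mul_nonneg zero_le_two (integral_nonneg fun s => by positivity))]
    exact ENNReal.ofReal_le_ofReal (hle.trans (by gcongr))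
  filter_upwards [h, ae_foot c key] with p hp hk
  have := hk p.1
  have e : ∀ s, p.2 + c * p.1 - c * s = p.2 + c * (p.1 - s) := fun s => by ring
  simp only [e] at this
  rw [hp, charInt, charLInt]
  exact this

/-- The bound `M exp (2 ℓ |t|)` for solutions with initial data bounded by `M`. -/
noncomputable def growthBound (M ℓ t : ℝ) : ℝ := M * Real.exp (2 * ℓ * |t|)

theorem continuous_growthBound (M ℓ : ℝ) : Continuous (growthBound M ℓ) := by
  unfold growthBound; fun_prop

theorem growthBound_pos {M : ℝ} (hM : 0 < M) (ℓ t : ℝ) : 0 < growthBound M ℓ t :=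
  mul_pos hM (Real.exp_pos _)

/-- `growthBound` solves the integral equation that dominates the solution. -/
theorem growthBound_eq {M ℓ : ℝ} (hM : 0 ≤ M) (hℓ : 0 ≤ ℓ) (t : ℝ) :
    ENNReal.ofReal M + ∫⁻ s in uIoc 0 t, ENNReal.ofReal (2 * ℓ) *
      ENNReal.ofReal (growthBound M ℓ s) = ENNReal.ofReal (growthBound M ℓ t) := by
  have key : ∀ t : ℝ, 0 ≤ t → ENNReal.ofReal M + ∫⁻ s in Ioc 0 t, ENNReal.ofReal (2 * ℓ) *
      ENNReal.ofReal (growthBound M ℓ s) = ENNReal.ofReal (growthBound M ℓ t) := by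
    intro t ht
    have e1 : ∫⁻ s in Ioc 0 t, ENNReal.ofReal (2 * ℓ) * ENNReal.ofReal (growthBound M ℓ s) =
        ∫⁻ s in Ioc 0 t, ENNReal.ofReal (2 * ℓ * M * Real.exp (2 * ℓ * s)) := by
      refine setLIntegral_congr_fun measurableSet_Ioc fun s hs => ?_
      rw [← ENNReal.ofReal_mul (by positivity), growthBound, abs_of_pos hs.1, mul_assoc (2 * ℓ)]
    have hc : Continuous fun s => 2 * ℓ * M * Real.exp (2 * ℓ * s) := by fun_prop
    rw [e1, ← ofReal_integral_eq_lintegral_ofReal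
      ((hc.integrableOn_Icc).mono_set Ioc_subset_Icc_self)
      (ae_of_all _ fun s => by positivity), ← intervalIntegral.integral_of_le ht,
      intervalIntegral.integral_eq_sub_of_hasDerivAt (f := fun s => M * Real.exp (2 * ℓ * s)) _
        (hc.intervalIntegrable _ _), ← ENNReal.ofReal_add hM]
    · rw [growthBound, abs_of_nonneg ht]
      congr 1
      simp
    · have : (1 : ℝ) ≤ Real.exp (2 * ℓ * t) := Real.one_le_exp (by positivity)
      simp only [mul_zero, Real.exp_zero]
      nlinarith
    · intro s _
      have := (((hasDerivAt_id s).const_mul (2 * ℓ)).exp).const_mul M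
      refine this.congr_deriv ?_
      simp only [id]
      ring
  rcases le_total 0 t with ht | ht
  · rw [uIoc_of_le ht]; exact key t ht
  · have h2 := lintegral_uIoc_neg (fun s => ENNReal.ofReal (2 * ℓ) *
      ENNReal.ofReal (growthBound M ℓ s))
      ((continuous_growthBound M ℓ).measurable.ennreal_ofReal.const_mul _) (neg_nonneg.mpr ht)
    rw [neg_neg] at h2
    have h3 := key (-t) (neg_nonneg.mpr ht)
    have e : ∀ s, growthBound M ℓ (-s) = growthBound M ℓ s := fun s => by
      simp [growthBound]
    simp only [e] at h2 h3
    rw [h2, h3]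

/-- Any mild solution of a system with real potentials, square integrable on slabs, obeys the
bound `growthBound`. -/
theorem norm_le_growthBound {c c' lam lam' ℓ M : ℝ} (hlam : |lam| ≤ ℓ) (hlam' : |lam'| ≤ ℓ)
    (hM : 0 ≤ M) {u₀ w₀ : ℝ → ℂ} {u w : ℝ × ℝ → ℂ} {V V' : ℝ × ℝ → ℝ}
    (mu : StronglyMeasurable u) (mw : StronglyMeasurable w)
    (hu : IsMildTransport c u₀ (fun p => -Complex.I * (lam * w p + V p * u p)) u)
    (hw : IsMildTransport c' w₀ (fun p => -Complex.I * (lam' * u p + V' p * w p)) w)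
    (hFu : LocallyIntegrable fun p => -Complex.I * (lam * w p + V p * u p))
    (hFw : LocallyIntegrable fun p => -Complex.I * (lam' * u p + V' p * w p))
    (lu : LocallyIntegrable u) (lw : LocallyIntegrable w)
    (su : ∀ T, 0 < T → ∫⁻ p in slab T, ‖u p‖ₑ ^ 2 < ⊤)
    (sw : ∀ T, 0 < T → ∫⁻ p in slab T, ‖w p‖ₑ ^ 2 < ⊤)
    (hu₀ : ∀ᵐ x, ‖u₀ x‖ ≤ M) (hw₀ : ∀ᵐ x, ‖w₀ x‖ ≤ M) :
    ∀ᵐ p, ‖u p‖ ≤ growthBound M ℓ p.1 ∧ ‖w p‖ ≤ growthBound M ℓ p.1 := by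
  have hℓ : 0 ≤ ℓ := (abs_nonneg lam).trans hlam
  set b : ℝ × ℝ → ℝ≥0∞ := fun p => ENNReal.ofReal (growthBound M ℓ p.1) with hb
  have mb : Measurable b :=
    (continuous_growthBound M ℓ).measurable.ennreal_ofReal.comp measurable_fst
  set f : ℝ × ℝ → ℝ≥0∞ := fun p => ‖u p‖ₑ - b p with hf
  set g : ℝ × ℝ → ℝ≥0∞ := fun p => ‖w p‖ₑ - b p with hg
  have mf : Measurable f := mu.enorm.sub mb
  have mg : Measurable g := mw.enorm.sub mb
  -- the excess over the bound is dominated by its own integrals along characteristics; the rate is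
  -- `2 ℓ + 1` since it has to be positive also if `ℓ = 0`
  have aux : ∀ (c : ℝ) (v : ℝ × ℝ → ℂ) (r h : ℝ × ℝ → ℝ≥0∞), StronglyMeasurable v →
      (∀ p, ‖v p‖ₑ - b p ≤ h p) → (∀ᵐ p, r p ≤ ENNReal.ofReal M +
        charLInt c (fun q => ENNReal.ofReal (2 * ℓ) * ‖v q‖ₑ) p) →
      ∀ᵐ p, r p - b p ≤ charLInt c (fun q => ENNReal.ofReal (2 * ℓ + 1) * h q) p := by
    intro c v r h mv hvh hr
    filter_upwards [hr] with p hp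
    rw [tsub_le_iff_left]
    refine hp.trans ?_
    have h1 : charLInt c (fun q => ENNReal.ofReal (2 * ℓ) * ‖v q‖ₑ) p ≤
        charLInt c (fun q => ENNReal.ofReal (2 * ℓ) * b q +
          ENNReal.ofReal (2 * ℓ + 1) * h q) p := by
      refine charLInt_mono c (ae_of_all _ fun s => ?_)
      set q := (s, p.2 + c * (p.1 - s))
      calc ENNReal.ofReal (2 * ℓ) * ‖v q‖ₑ ≤ ENNReal.ofReal (2 * ℓ) * (b q + h q) := by
            gcongr
            exact tsub_le_iff_left.mp (hvh q)
        _ ≤ _ := by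
            rw [mul_add]
            gcongr
            linarith
    have h2 : charLInt c (fun q => ENNReal.ofReal (2 * ℓ) * b q +
        ENNReal.ofReal (2 * ℓ + 1) * h q) p =
        (∫⁻ s in uIoc 0 p.1, ENNReal.ofReal (2 * ℓ) * ENNReal.ofReal (growthBound M ℓ s)) +
        charLInt c (fun q => ENNReal.ofReal (2 * ℓ + 1) * h q) p := by
      rw [charLInt, charLInt, lintegral_add_left]
      exact (continuous_growthBound M ℓ).measurable.ennreal_ofReal.const_mul _
    calc _ ≤ _ := add_le_add le_rfl (h1.trans h2.le)
      _ = _ := by rw [← add_assoc, growthBound_eq hM hℓ]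
  have hL : Continuous fun _ : ℝ => 2 * ℓ + 1 := continuous_const
  have sq : ∀ (v : ℝ × ℝ → ℂ), (∀ T, 0 < T → ∫⁻ p in slab T, ‖v p‖ₑ ^ 2 < ⊤) →
      ∀ T, 0 < T → ∫⁻ p in slab T, (‖v p‖ₑ - b p) ^ 2 < ⊤ := fun v hv T hT =>
    (lintegral_mono fun p => pow_le_pow_left' tsub_le_self 2).trans_lt (hv T hT)
  have := ae_eq_zero_of_le_charLInt hL (fun _ => by positivity) c c' mf mg
    (aux c w (fun p => ‖u p‖ₑ) (fun q => f q + g q) mw (fun p => le_add_self)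
      (hu.enorm_le hlam hFu lw hu₀))
    (aux c' u (fun p => ‖w p‖ₑ) (fun q => f q + g q) mu (fun p => le_self_add)
      (hw.enorm_le hlam' hFw lu hw₀)) (sq u su) (sq w sw)
  filter_upwards [this] with p hp
  have conv : ∀ v : ℂ, ‖v‖ₑ - b p = 0 → ‖v‖ ≤ growthBound M ℓ p.1 := by
    intro v hv
    rw [tsub_eq_zero_iff_le, ← ofReal_norm] at hv
    exact (ENNReal.ofReal_le_ofReal_iff (mul_nonneg hM (Real.exp_pos _).le)).mp hv
  exact ⟨conv _ hp.1, conv _ hp.2⟩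

/-! ### The nonlinearity and its truncation -/

/-- The nonlinearity `-i (λ w + c |w|² z)` in null coordinates. -/
noncomputable def thirringNonlin (lam c : ℝ) (z w : ℂ) : ℂ :=
  -Complex.I * (lam * w + c * ‖w‖ ^ 2 * z)

/-- The radial retraction of the plane onto the disc of radius `R`. -/
noncomputable def discRetract (R : ℝ) (z : ℂ) : ℂ := ((R / max R ‖z‖ : ℝ) : ℂ) * z

/-- `thirringNonlin` with the cubic term truncated at radius `R`; a real multiple of `z` is
still added to `λ w`. -/
noncomputable def truncNonlin (lam c R : ℝ) (z w : ℂ) : ℂ :=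
  -Complex.I * (lam * w + c * ‖discRetract R w‖ ^ 2 * discRetract R z)

theorem discRetract_of_le {R : ℝ} (hR : 0 < R) {z : ℂ} (hz : ‖z‖ ≤ R) : discRetract R z = z := by
  rw [discRetract, max_eq_left hz, div_self hR.ne']; simp

theorem norm_discRetract_le {R : ℝ} (hR : 0 < R) (z : ℂ) : ‖discRetract R z‖ ≤ R := by
  have hm : 0 < max R ‖z‖ := lt_max_of_lt_left hR
  rw [discRetract, norm_mul, Complex.norm_real, Real.norm_of_nonneg (by positivity),
    div_mul_eq_mul_div, div_le_iff₀ hm]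
  gcongr
  exact le_max_right _ _

theorem norm_discRetract_sub_le {R : ℝ} (hR : 0 < R) (z w : ℂ) :
    ‖discRetract R z - discRetract R w‖ ≤ 2 * ‖z - w‖ := by
  set m := max R ‖z‖ with hm
  set n := max R ‖w‖ with hn
  have hm0 : 0 < m := lt_max_of_lt_left hR
  have hn0 : 0 < n := lt_max_of_lt_left hR
  have hmn : |n - m| ≤ ‖z - w‖ := by
    refine (abs_max_sub_max_le_max R ‖w‖ R ‖z‖).trans ?_
    rw [sub_self, abs_zero, max_eq_right (abs_nonneg _), norm_sub_rev]
    exact abs_norm_sub_norm_le w z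
  have e : discRetract R z - discRetract R w =
      ((R / m : ℝ) : ℂ) * (z - w) + ((R / m * ((n - m) / n) : ℝ) : ℂ) * w := by
    have h1 : (m : ℂ) ≠ 0 := by exact_mod_cast hm0.ne'
    have h2 : (n : ℂ) ≠ 0 := by exact_mod_cast hn0.ne'
    simp only [discRetract, ← hm, ← hn]
    push_cast
    field_simp
    ring
  have h1 : R / m ≤ 1 := (div_le_one hm0).mpr (le_max_left _ _)
  have h2 : ‖w‖ / n ≤ 1 := (div_le_one hn0).mpr (le_max_right _ _)
  have h3 : 0 ≤ R / m := by positivity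
  rw [e]
  refine (norm_add_le _ _).trans ?_
  rw [norm_mul, norm_mul, Complex.norm_real, Complex.norm_real, Real.norm_of_nonneg h3,
    Real.norm_eq_abs, abs_mul, abs_of_nonneg h3, abs_div, abs_of_pos hn0]
  have h4 : R / m * (|n - m| / n) * ‖w‖ = R / m * |n - m| * (‖w‖ / n) := by ring
  rw [h4, two_mul]
  refine add_le_add ?_ ?_
  · exact mul_le_of_le_one_left (norm_nonneg _) h1
  · calc R / m * |n - m| * (‖w‖ / n) ≤ 1 * |n - m| * 1 := by gcongr
      _ ≤ _ := by simpa using hmn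

theorem truncNonlin_zero (lam c R : ℝ) : truncNonlin lam c R 0 0 = 0 := by
  simp [truncNonlin, discRetract]

theorem truncNonlin_eq (lam c R : ℝ) (z w : ℂ) : truncNonlin lam c R z w =
    -Complex.I * (lam * w + ((c * ‖discRetract R w‖ ^ 2 * (R / max R ‖z‖) : ℝ) : ℂ) * z) := by
  rw [truncNonlin]
  conv_lhs => rw [discRetract.eq_def R z]
  push_cast
  ring

theorem truncNonlin_of_le (lam c : ℝ) {R : ℝ} (hR : 0 < R) {z w : ℂ} (hz : ‖z‖ ≤ R)
    (hw : ‖w‖ ≤ R) : truncNonlin lam c R z w = thirringNonlin lam c z w := by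
  rw [truncNonlin, discRetract_of_le hR hz, discRetract_of_le hR hw, thirringNonlin]

theorem norm_truncNonlin_sub_le {lam c ℓ C R : ℝ} (hlam : |lam| ≤ ℓ) (hc : |c| ≤ C) (hR : 0 < R)
    (z w z' w' : ℂ) :
    ‖truncNonlin lam c R z w - truncNonlin lam c R z' w'‖ ≤
      (ℓ + 4 * C * R ^ 2) * (‖z - z'‖ + ‖w - w'‖) := by
  set a := discRetract R z with ha
  set b := discRetract R w with hb
  set a' := discRetract R z' with ha'
  set b' := discRetract R w' with hb'
  have hC : 0 ≤ C := (abs_nonneg c).trans hc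
  have hℓ : 0 ≤ ℓ := (abs_nonneg lam).trans hlam
  have e : truncNonlin lam c R z w - truncNonlin lam c R z' w' =
      -Complex.I * (lam * (w - w') + c * ((‖b‖ ^ 2 : ℝ) * (a - a') +
        ((‖b‖ ^ 2 - ‖b'‖ ^ 2 : ℝ) : ℂ) * a')) := by
    simp only [truncNonlin, ← ha, ← hb, ← ha', ← hb']
    push_cast
    ring
  have na : ‖a - a'‖ ≤ 2 * ‖z - z'‖ := norm_discRetract_sub_le hR z z'
  have nb : ‖b - b'‖ ≤ 2 * ‖w - w'‖ := norm_discRetract_sub_le hR w w'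
  have b1 : ‖b‖ ≤ R := norm_discRetract_le hR w
  have b2 : ‖b'‖ ≤ R := norm_discRetract_le hR w'
  have a2 : ‖a'‖ ≤ R := norm_discRetract_le hR z'
  have h1 : |‖b‖ ^ 2 - ‖b'‖ ^ 2| ≤ 2 * R * (2 * ‖w - w'‖) := by
    rw [sq_sub_sq, abs_mul, abs_of_nonneg (by positivity)]
    gcongr
    · linarith
    · exact (abs_norm_sub_norm_le b b').trans nb
  have h2 : ‖(‖b‖ ^ 2 : ℝ) * (a - a') + ((‖b‖ ^ 2 - ‖b'‖ ^ 2 : ℝ) : ℂ) * a'‖ ≤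
      R ^ 2 * (2 * ‖z - z'‖) + 2 * R * (2 * ‖w - w'‖) * R := by
    refine (norm_add_le _ _).trans ?_
    rw [norm_mul, norm_mul, Complex.norm_real, Complex.norm_real,
      Real.norm_of_nonneg (by positivity), Real.norm_eq_abs]
    gcongr
  rw [e, norm_mul, norm_neg, Complex.norm_I, one_mul]
  refine (norm_add_le _ _).trans ?_
  rw [norm_mul, norm_mul, Complex.norm_real, Complex.norm_real, Real.norm_eq_abs,
    Real.norm_eq_abs]
  calc _ ≤ ℓ * ‖w - w'‖ + C * (R ^ 2 * (2 * ‖z - z'‖) + 2 * R * (2 * ‖w - w'‖) * R) := by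
        gcongr
    _ ≤ _ := by
        nlinarith [mul_nonneg hℓ (norm_nonneg (z - z')), norm_nonneg (w - w'),
          mul_nonneg (mul_nonneg hC (sq_nonneg R)) (norm_nonneg (z - z'))]

/-! ### Semilinear systems with Lipschitz nonlinearity -/

theorem eLpNorm_two_sq {X E : Type*} [MeasurableSpace X] [NormedAddCommGroup E] (m : Measure X)
    (f : X → E) : eLpNorm f 2 m ^ 2 = ∫⁻ x, ‖f x‖ₑ ^ 2 ∂m := by
  have := eLpNorm_nnreal_pow_eq_lintegral (μ := m) (f := f) (p := 2) (by norm_num)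
  simpa using this

theorem memLp_two_of_lintegral_lt_top {X E : Type*} [MeasurableSpace X] [NormedAddCommGroup E]
    {m : Measure X} {f : X → E} (hf : AEStronglyMeasurable f m)
    (h : ∫⁻ x, ‖f x‖ₑ ^ 2 ∂m < ⊤) : MemLp f 2 m := by
  refine ⟨hf, ?_⟩
  rw [← eLpNorm_two_sq] at h
  by_contra hcon
  rw [not_lt, top_le_iff] at hcon
  simp [hcon] at h

theorem MeasureTheory.MemLp.lintegral_sq_lt_top {X E : Type*} [MeasurableSpace X]
    [NormedAddCommGroup E] {m : Measure X} {f : X → E} (hf : MemLp f 2 m) :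
    ∫⁻ x, ‖f x‖ₑ ^ 2 ∂m < ⊤ := by
  rw [← eLpNorm_two_sq]
  exact ENNReal.pow_lt_top hf.2

/-- A time-dependent nonlinearity on pairs of complex numbers that vanishes at the origin and is
Lipschitz with constant `L t` at time `t`. -/
structure IsLipschitzNonlin (L : ℝ → ℝ) (N : ℝ → ℂ → ℂ → ℂ) : Prop where
  measurable : Measurable fun q : ℝ × ℂ × ℂ => N q.1 q.2.1 q.2.2
  lipschitz : ∀ t z w z' w', ‖N t z w - N t z' w'‖ ≤ L t * (‖z - z'‖ + ‖w - w'‖)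
  map_zero : ∀ t, N t 0 0 = 0

theorem IsLipschitzNonlin.stronglyMeasurable_comp {L : ℝ → ℝ} {N : ℝ → ℂ → ℂ → ℂ}
    (hN : IsLipschitzNonlin L N) {u w : ℝ × ℝ → ℂ} (hu : StronglyMeasurable u)
    (hw : StronglyMeasurable w) : StronglyMeasurable fun p : ℝ × ℝ => N p.1 (u p) (w p) :=
  (hN.measurable.comp
    (measurable_fst.prodMk (hu.measurable.prodMk hw.measurable))).stronglyMeasurable

theorem IsLipschitzNonlin.enorm_sub_le {L : ℝ → ℝ} {N : ℝ → ℂ → ℂ → ℂ}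
    (hN : IsLipschitzNonlin L N) (hpos : ∀ t, 0 < L t) (t : ℝ) (z w z' w' : ℂ) :
    ‖N t z w - N t z' w'‖ₑ ≤ ENNReal.ofReal (L t) * (‖z - z'‖ₑ + ‖w - w'‖ₑ) := by
  rw [← ofReal_norm, ← ofReal_norm, ← ofReal_norm, ← ENNReal.ofReal_add (norm_nonneg _)
    (norm_nonneg _), ← ENNReal.ofReal_mul (hpos t).le]
  exact ENNReal.ofReal_le_ofReal (hN.lipschitz t z w z' w')

theorem IsLipschitzNonlin.enorm_le {L : ℝ → ℝ} {N : ℝ → ℂ → ℂ → ℂ}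
    (hN : IsLipschitzNonlin L N) (hpos : ∀ t, 0 < L t) (t : ℝ) (z w : ℂ) :
    ‖N t z w‖ₑ ≤ ENNReal.ofReal (L t) * (‖z‖ₑ + ‖w‖ₑ) := by
  have := hN.enorm_sub_le hpos t z w 0 0
  rwa [hN.map_zero, sub_zero, sub_zero, sub_zero] at this

theorem intervalIntegrable_of_charLInt_lt_top (c : ℝ) {F : ℝ × ℝ → ℂ} (hF : StronglyMeasurable F)
    {p : ℝ × ℝ} (h : charLInt c (fun q => ‖F q‖ₑ) p < ⊤) :
    IntervalIntegrable (fun s => F (s, p.2 + c * (p.1 - s))) volume 0 p.1 := by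
  rw [intervalIntegrable_iff]
  exact ⟨(hF.comp_measurable (by fun_prop)).aestronglyMeasurable, h⟩

theorem enorm_charInt_sub_le (c : ℝ) {F G : ℝ × ℝ → ℂ} (hF : StronglyMeasurable F)
    (hG : StronglyMeasurable G) {p : ℝ × ℝ} (h : charLInt c (fun q => ‖F q‖ₑ) p < ⊤)
    (h' : charLInt c (fun q => ‖G q‖ₑ) p < ⊤) :
    ‖charInt c F p - charInt c G p‖ₑ ≤ charLInt c (fun q => ‖F q - G q‖ₑ) p := by
  have := enorm_charInt_le c (fun q => F q - G q) p
  rwa [charInt, intervalIntegral.integral_sub (intervalIntegrable_of_charLInt_lt_top c hF h)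
    (intervalIntegrable_of_charLInt_lt_top c hG h')] at this

theorem lintegral_foot {L : ℝ → ℝ} (hL : Continuous L) (c : ℝ) {h : ℝ → ℝ≥0∞}
    (hh : Measurable h) :
    ∫⁻ p : ℝ × ℝ, h (p.2 + c * p.1) ∂weightedVolume L =
      (∫⁻ t, ENNReal.ofReal (timeWeight L t)) * ∫⁻ x, h x := by
  have m1 : Measurable fun p : ℝ × ℝ => ENNReal.ofReal (timeWeight L p.1) * h p.2 :=
    (measurable_timeWeight_fst hL).mul (hh.comp measurable_snd)
  rw [lintegral_weightedVolume hL (f := fun p => h (p.2 + c * p.1)) (hh.comp (by fun_prop))]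
  have := lintegral_shear c m1
  simp only [shear_apply] at this
  rw [this, Measure.volume_eq_prod]
  exact lintegral_prod_mul (continuous_timeWeight hL).measurable.ennreal_ofReal.aemeasurable
    hh.aemeasurable

theorem lintegral_sq_add_le {X : Type*} [MeasurableSpace X] {m : Measure X} {f g : X → ℝ≥0∞}
    (mf : Measurable f) :
    ∫⁻ p, (f p + g p) ^ 2 ∂m ≤ 2 * (∫⁻ p, f p ^ 2 ∂m) + 2 * ∫⁻ p, g p ^ 2 ∂m := by
  refine (lintegral_mono fun p => ENNReal.add_sq_le (f p) (g p)).trans_eq ?_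
  rw [lintegral_add_left ((mf.pow_const 2).const_mul _),
    lintegral_const_mul' _ _ ENNReal.ofNat_ne_top, lintegral_const_mul' _ _ ENNReal.ofNat_ne_top]

theorem lintegral_sq_add_lt_top {X : Type*} [MeasurableSpace X] {m : Measure X} {f g : X → ℝ≥0∞}
    (mf : Measurable f) (hf : ∫⁻ p, f p ^ 2 ∂m < ⊤) (hg : ∫⁻ p, g p ^ 2 ∂m < ⊤) :
    ∫⁻ p, (f p + g p) ^ 2 ∂m < ⊤ := by
  refine (lintegral_sq_add_le mf).trans_lt ?_
  exact ENNReal.add_lt_top.mpr ⟨ENNReal.mul_lt_top (by simp) hf, ENNReal.mul_lt_top (by simp) hg⟩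

section Semilinear

variable {L : ℝ → ℝ}

theorem lintegral_sq_charLInt_lt_top (hL : Continuous L) (hpos : ∀ t, 0 < L t) (c : ℝ)
    {f g : ℝ × ℝ → ℝ≥0∞} (mf : Measurable f) (mg : Measurable g)
    (hf : ∫⁻ p, f p ^ 2 ∂weightedVolume L < ⊤) (hg : ∫⁻ p, g p ^ 2 ∂weightedVolume L < ⊤) :
    ∫⁻ p, charLInt c (fun q => ENNReal.ofReal (L q.1) * (f q + g q)) p ^ 2 ∂weightedVolume L <
      ⊤ :=
  (lintegral_sq_charLInt_le hL hpos c (mf.add mg)).trans_lt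
    (ENNReal.mul_lt_top ENNReal.ofReal_lt_top (lintegral_sq_add_lt_top mf hf hg))

theorem measurable_weighted_add (hL : Continuous L) {f g : ℝ × ℝ → ℝ≥0∞} (mf : Measurable f)
    (mg : Measurable g) : Measurable fun q : ℝ × ℝ => ENNReal.ofReal (L q.1) * (f q + g q) :=
  (hL.measurable.ennreal_ofReal.comp measurable_fst).mul (mf.add mg)

theorem ae_charLInt_lt_top (hL : Continuous L) (hpos : ∀ t, 0 < L t) (c : ℝ)
    {f g : ℝ × ℝ → ℝ≥0∞} (mf : Measurable f) (mg : Measurable g)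
    (hf : ∫⁻ p, f p ^ 2 ∂weightedVolume L < ⊤) (hg : ∫⁻ p, g p ^ 2 ∂weightedVolume L < ⊤) :
    ∀ᵐ p, charLInt c (fun q => ENNReal.ofReal (L q.1) * (f q + g q)) p < ⊤ := by
  rw [← ae_weightedVolume_iff hL hpos]
  filter_upwards [ae_lt_top
    ((measurable_charLInt c (measurable_weighted_add hL mf mg)).pow_const 2)
    (lintegral_sq_charLInt_lt_top hL hpos c mf mg hf hg).ne] with p hp
  by_contra hcon
  rw [not_lt, top_le_iff] at hcon
  simp [hcon] at hp

/-- The integrated nonlinearities of two pairs of functions differ at most by the integral of the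
difference. -/
theorem ae_enorm_charInt_nonlin_sub_le (hL : Continuous L) (hpos : ∀ t, 0 < L t) (c : ℝ)
    {N : ℝ → ℂ → ℂ → ℂ} (hN : IsLipschitzNonlin L N) {u w u' w' : ℝ × ℝ → ℂ}
    (mu : StronglyMeasurable u) (mw : StronglyMeasurable w) (mu' : StronglyMeasurable u')
    (mw' : StronglyMeasurable w')
    (hu : ∫⁻ p, ‖u p‖ₑ ^ 2 ∂weightedVolume L < ⊤) (hw : ∫⁻ p, ‖w p‖ₑ ^ 2 ∂weightedVolume L < ⊤)
    (hu' : ∫⁻ p, ‖u' p‖ₑ ^ 2 ∂weightedVolume L < ⊤)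
    (hw' : ∫⁻ p, ‖w' p‖ₑ ^ 2 ∂weightedVolume L < ⊤) :
    ∀ᵐ p : ℝ × ℝ, ‖charInt c (fun q => N q.1 (u q) (w q)) p -
        charInt c (fun q => N q.1 (u' q) (w' q)) p‖ₑ ≤
      charLInt c (fun q => ENNReal.ofReal (L q.1) * (‖u q - u' q‖ₑ + ‖w q - w' q‖ₑ)) p := by
  filter_upwards [ae_charLInt_lt_top hL hpos c mu.enorm mw.enorm hu hw,
    ae_charLInt_lt_top hL hpos c mu'.enorm mw'.enorm hu' hw'] with p h1 h2
  refine (enorm_charInt_sub_le c (hN.stronglyMeasurable_comp mu mw)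
    (hN.stronglyMeasurable_comp mu' mw') ?_ ?_).trans ?_
  · exact (charLInt_mono c (ae_of_all _ fun s => hN.enorm_le hpos _ _ _)).trans_lt h1
  · exact (charLInt_mono c (ae_of_all _ fun s => hN.enorm_le hpos _ _ _)).trans_lt h2
  · exact charLInt_mono c (ae_of_all _ fun s => hN.enorm_sub_le hpos _ _ _ _ _)

theorem memLp_foot_add_charInt (hL : Continuous L) (hpos : ∀ t, 0 < L t) (c : ℝ)
    {N : ℝ → ℂ → ℂ → ℂ} (hN : IsLipschitzNonlin L N) {u₀ : ℝ → ℂ} (mu₀ : StronglyMeasurable u₀)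
    (hu₀ : ∫⁻ x, ‖u₀ x‖ₑ ^ 2 < ⊤) {u w : ℝ × ℝ → ℂ}
    (mu : StronglyMeasurable u) (mw : StronglyMeasurable w)
    (hu : ∫⁻ p, ‖u p‖ₑ ^ 2 ∂weightedVolume L < ⊤)
    (hw : ∫⁻ p, ‖w p‖ₑ ^ 2 ∂weightedVolume L < ⊤) :
    MemLp (fun p : ℝ × ℝ => u₀ (p.2 + c * p.1) + charInt c (fun q => N q.1 (u q) (w q)) p) 2
      (weightedVolume L) := by
  refine MemLp.add (memLp_two_of_lintegral_lt_top ?_ ?_) (memLp_two_of_lintegral_lt_top ?_ ?_)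
  · exact (mu₀.comp_measurable (by fun_prop)).aestronglyMeasurable
  · rw [lintegral_foot hL c (h := fun x => ‖u₀ x‖ₑ ^ 2) (mu₀.enorm.pow_const 2)]
    exact ENNReal.mul_lt_top (lintegral_timeWeight_lt_top hL hpos) hu₀
  · exact (stronglyMeasurable_charInt c (hN.stronglyMeasurable_comp mu mw)).aestronglyMeasurable
  · refine (lintegral_mono fun p => pow_le_pow_left' ?_ 2).trans_lt
      (lintegral_sq_charLInt_lt_top hL hpos c mu.enorm mw.enorm hu hw)
    exact (enorm_charInt_le _ _ _).trans
      (charLInt_mono c (ae_of_all _ fun s => hN.enorm_le hpos _ _ _))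

/-- The map whose fixed points are the mild solutions is a contraction by the factor `1 / 2`. -/
theorem eLpNorm_charInt_nonlin_sub_le (hL : Continuous L) (hpos : ∀ t, 0 < L t) (c : ℝ)
    {N : ℝ → ℂ → ℂ → ℂ} (hN : IsLipschitzNonlin L N)
    (x y : Lp ℂ 2 (weightedVolume L) × Lp ℂ 2 (weightedVolume L)) (g : ℝ × ℝ → ℂ) :
    eLpNorm ((fun p => g p + charInt c (fun q => N q.1 (x.1 q) (x.2 q)) p) -
      fun p => g p + charInt c (fun q => N q.1 (y.1 q) (y.2 q)) p) 2 (weightedVolume L) ≤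
      2⁻¹ * edist x y := by
  have h1 : eLpNorm ((fun p => g p + charInt c (fun q => N q.1 (x.1 q) (x.2 q)) p) -
      fun p => g p + charInt c (fun q => N q.1 (y.1 q) (y.2 q)) p) 2 (weightedVolume L) ^ 2 ≤
      ENNReal.ofReal (1 / 16) * ∫⁻ p, (‖x.1 p - y.1 p‖ₑ + ‖x.2 p - y.2 p‖ₑ) ^ 2
        ∂weightedVolume L := by
    rw [eLpNorm_two_sq]
    refine le_trans ?_ (lintegral_sq_charLInt_le hL hpos c
      (f := fun p => ‖x.1 p - y.1 p‖ₑ + ‖x.2 p - y.2 p‖ₑ)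
      (((Lp.stronglyMeasurable x.1).sub (Lp.stronglyMeasurable y.1)).enorm.add
        ((Lp.stronglyMeasurable x.2).sub (Lp.stronglyMeasurable y.2)).enorm))
    refine lintegral_mono_ae ?_
    filter_upwards [(ae_weightedVolume_iff hL hpos).mpr (ae_enorm_charInt_nonlin_sub_le hL hpos c
      hN (Lp.stronglyMeasurable x.1) (Lp.stronglyMeasurable x.2) (Lp.stronglyMeasurable y.1)
      (Lp.stronglyMeasurable y.2) (Lp.memLp x.1).lintegral_sq_lt_top
      (Lp.memLp x.2).lintegral_sq_lt_top (Lp.memLp y.1).lintegral_sq_lt_top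
      (Lp.memLp y.2).lintegral_sq_lt_top)] with p hp
    refine pow_le_pow_left' ?_ 2
    simp only [Pi.sub_apply, add_sub_add_left_eq_sub]
    exact hp
  have d1 : ∫⁻ p, ‖x.1 p - y.1 p‖ₑ ^ 2 ∂weightedVolume L ≤ edist x y ^ 2 := by
    have := eLpNorm_two_sq (weightedVolume L) (⇑x.1 - ⇑y.1)
    rw [← Lp.edist_def] at this
    simp only [Pi.sub_apply] at this
    rw [← this, Prod.edist_eq]
    exact pow_le_pow_left' (le_max_left _ _) 2
  have d2 : ∫⁻ p, ‖x.2 p - y.2 p‖ₑ ^ 2 ∂weightedVolume L ≤ edist x y ^ 2 := by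
    have := eLpNorm_two_sq (weightedVolume L) (⇑x.2 - ⇑y.2)
    rw [← Lp.edist_def] at this
    simp only [Pi.sub_apply] at this
    rw [← this, Prod.edist_eq]
    exact pow_le_pow_left' (le_max_right _ _) 2
  have h2 : ∫⁻ p, (‖x.1 p - y.1 p‖ₑ + ‖x.2 p - y.2 p‖ₑ) ^ 2 ∂weightedVolume L ≤
      4 * edist x y ^ 2 := by
    refine (lintegral_sq_add_le (f := fun p => ‖x.1 p - y.1 p‖ₑ)
      ((Lp.stronglyMeasurable x.1).sub (Lp.stronglyMeasurable y.1)).enorm).trans ?_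
    calc _ ≤ 2 * edist x y ^ 2 + 2 * edist x y ^ 2 := by gcongr
      _ = _ := by ring
  have h3 : ENNReal.ofReal (1 / 16) * 4 = 2⁻¹ ^ 2 := by
    rw [← ENNReal.ofReal_ofNat, ← ENNReal.ofReal_mul (by norm_num), ← ENNReal.ofReal_ofNat 2,
      ← ENNReal.ofReal_inv_of_pos (by norm_num), ← ENNReal.ofReal_pow (by norm_num)]
    norm_num
  have h4 := h1.trans (mul_le_mul_right h2 (ENNReal.ofReal (1 / 16)))
  rw [← mul_assoc, h3, ← mul_pow] at h4
  exact (ENNReal.pow_right_strictMono two_ne_zero).le_iff_le.mp h4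

/-- A semilinear system of transport equations with Lipschitz nonlinearity has a mild solution:
Banach's fixed point theorem in the weighted `L²` space. -/
theorem exists_isMildTransport (hL : Continuous L) (hpos : ∀ t, 0 < L t) (c c' : ℝ)
    {N N' : ℝ → ℂ → ℂ → ℂ} (hN : IsLipschitzNonlin L N) (hN' : IsLipschitzNonlin L N')
    {u₀ w₀ : ℝ → ℂ} (mu₀ : StronglyMeasurable u₀) (mw₀ : StronglyMeasurable w₀)
    (hu₀ : ∫⁻ x, ‖u₀ x‖ₑ ^ 2 < ⊤) (hw₀ : ∫⁻ x, ‖w₀ x‖ₑ ^ 2 < ⊤) :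
    ∃ u w : ℝ × ℝ → ℂ, StronglyMeasurable u ∧ StronglyMeasurable w ∧
      ∫⁻ p, ‖u p‖ₑ ^ 2 ∂weightedVolume L < ⊤ ∧ ∫⁻ p, ‖w p‖ₑ ^ 2 ∂weightedVolume L < ⊤ ∧
      IsMildTransport c u₀ (fun p => N p.1 (u p) (w p)) u ∧
      IsMildTransport c' w₀ (fun p => N' p.1 (u p) (w p)) w := by
  have mem : ∀ (c : ℝ) {N : ℝ → ℂ → ℂ → ℂ}, IsLipschitzNonlin L N → ∀ {u₀ : ℝ → ℂ},
      StronglyMeasurable u₀ → ∫⁻ x, ‖u₀ x‖ₑ ^ 2 < ⊤ →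
      ∀ x : Lp ℂ 2 (weightedVolume L) × Lp ℂ 2 (weightedVolume L),
      MemLp (fun p : ℝ × ℝ => u₀ (p.2 + c * p.1) +
        charInt c (fun q => N q.1 (x.1 q) (x.2 q)) p) 2 (weightedVolume L) :=
    fun c N hN u₀ mu₀ hu₀ x => memLp_foot_add_charInt hL hpos c hN mu₀ hu₀
      (Lp.stronglyMeasurable x.1) (Lp.stronglyMeasurable x.2)
      (Lp.memLp x.1).lintegral_sq_lt_top (Lp.memLp x.2).lintegral_sq_lt_top
  let Φ : Lp ℂ 2 (weightedVolume L) × Lp ℂ 2 (weightedVolume L) →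
      Lp ℂ 2 (weightedVolume L) × Lp ℂ 2 (weightedVolume L) := fun x =>
    ((mem c hN mu₀ hu₀ x).toLp, (mem c' hN' mw₀ hw₀ x).toLp)
  have hΦ : ContractingWith 2⁻¹ Φ := by
    refine ⟨by norm_num, fun x y => ?_⟩
    have e : ((2⁻¹ : NNReal) : ℝ≥0∞) = 2⁻¹ := by simp
    rw [e, Prod.edist_eq]
    refine max_le ?_ ?_
    · simp only [Φ, Lp.edist_toLp_toLp]
      exact eLpNorm_charInt_nonlin_sub_le hL hpos c hN x y _
    · simp only [Φ, Lp.edist_toLp_toLp]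
      exact eLpNorm_charInt_nonlin_sub_le hL hpos c' hN' x y _
  have hfix : Φ (ContractingWith.fixedPoint Φ hΦ) = ContractingWith.fixedPoint Φ hΦ :=
    hΦ.fixedPoint_isFixedPt
  set x := ContractingWith.fixedPoint Φ hΦ
  refine ⟨x.1, x.2, Lp.stronglyMeasurable x.1, Lp.stronglyMeasurable x.2,
    (Lp.memLp x.1).lintegral_sq_lt_top, (Lp.memLp x.2).lintegral_sq_lt_top, ?_, ?_⟩
  · have h1 : x.1 = (mem c hN mu₀ hu₀ x).toLp := (congrArg Prod.fst hfix).symm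
    have h2 := (mem c hN mu₀ hu₀ x).coeFn_toLp
    rw [← h1] at h2
    exact (ae_weightedVolume_iff hL hpos).mp h2
  · have h1 : x.2 = (mem c' hN' mw₀ hw₀ x).toLp := (congrArg Prod.snd hfix).symm
    have h2 := (mem c' hN' mw₀ hw₀ x).coeFn_toLp
    rw [← h1] at h2
    exact (ae_weightedVolume_iff hL hpos).mp h2

/-- Mild solutions in the weighted space depend Lipschitz continuously on the initial values. -/
theorem lintegral_sq_sub_le_of_isMildTransport (hL : Continuous L) (hpos : ∀ t, 0 < L t)
    (c c' : ℝ) {N N' : ℝ → ℂ → ℂ → ℂ} (hN : IsLipschitzNonlin L N) (hN' : IsLipschitzNonlin L N')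
    {u₀ w₀ v₀ z₀ : ℝ → ℂ} (mu₀ : StronglyMeasurable u₀) (mw₀ : StronglyMeasurable w₀)
    (mv₀ : StronglyMeasurable v₀) (mz₀ : StronglyMeasurable z₀)
    {u w v z : ℝ × ℝ → ℂ} (mu : StronglyMeasurable u) (mw : StronglyMeasurable w)
    (mv : StronglyMeasurable v) (mz : StronglyMeasurable z)
    (fu : ∫⁻ p, ‖u p‖ₑ ^ 2 ∂weightedVolume L < ⊤) (fw : ∫⁻ p, ‖w p‖ₑ ^ 2 ∂weightedVolume L < ⊤)
    (fv : ∫⁻ p, ‖v p‖ₑ ^ 2 ∂weightedVolume L < ⊤) (fz : ∫⁻ p, ‖z p‖ₑ ^ 2 ∂weightedVolume L < ⊤)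
    (hu : IsMildTransport c u₀ (fun p => N p.1 (u p) (w p)) u)
    (hw : IsMildTransport c' w₀ (fun p => N' p.1 (u p) (w p)) w)
    (hv : IsMildTransport c v₀ (fun p => N p.1 (v p) (z p)) v)
    (hz : IsMildTransport c' z₀ (fun p => N' p.1 (v p) (z p)) z) :
    (∫⁻ p, ‖u p - v p‖ₑ ^ 2 ∂weightedVolume L) + ∫⁻ p, ‖w p - z p‖ₑ ^ 2 ∂weightedVolume L ≤
      4 * (∫⁻ t, ENNReal.ofReal (timeWeight L t)) *
        ((∫⁻ x, ‖u₀ x - v₀ x‖ₑ ^ 2) + ∫⁻ x, ‖w₀ x - z₀ x‖ₑ ^ 2) := by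
  have diff : ∀ (c : ℝ) {N : ℝ → ℂ → ℂ → ℂ}, IsLipschitzNonlin L N → ∀ {a b : ℝ → ℂ}
      {f g : ℝ × ℝ → ℂ}, IsMildTransport c a (fun p => N p.1 (u p) (w p)) f →
      IsMildTransport c b (fun p => N p.1 (v p) (z p)) g →
      ∀ᵐ p : ℝ × ℝ, ‖f p - g p‖ₑ ≤ ‖a (p.2 + c * p.1) - b (p.2 + c * p.1)‖ₑ +
        charLInt c (fun q => ENNReal.ofReal (L q.1) * (‖u q - v q‖ₑ + ‖w q - z q‖ₑ)) p := by
    intro c N hN a b f g hf hg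
    filter_upwards [hf, hg, ae_enorm_charInt_nonlin_sub_le hL hpos c hN mu mw mv mz fu fw fv fz]
      with p h1 h2 h3
    rw [h1, h2, add_sub_add_comm]
    exact (enorm_add_le _ _).trans (by gcongr)
  have fin : ∀ {f g : ℝ × ℝ → ℂ}, StronglyMeasurable f →
      ∫⁻ p, ‖f p‖ₑ ^ 2 ∂weightedVolume L < ⊤ → ∫⁻ p, ‖g p‖ₑ ^ 2 ∂weightedVolume L < ⊤ →
      ∫⁻ p, ‖f p - g p‖ₑ ^ 2 ∂weightedVolume L ≠ ⊤ := by
    intro f g mf hf hg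
    refine ((lintegral_mono fun p => pow_le_pow_left' ?_ 2).trans_lt
      (lintegral_sq_add_lt_top mf.enorm hf hg)).ne
    exact enorm_sub_le
  have foot : ∀ (c : ℝ) {a b : ℝ → ℂ}, StronglyMeasurable a → StronglyMeasurable b →
      ∫⁻ p : ℝ × ℝ, ‖a (p.2 + c * p.1) - b (p.2 + c * p.1)‖ₑ ^ 2 ∂weightedVolume L =
      (∫⁻ t, ENNReal.ofReal (timeWeight L t)) * ∫⁻ x, ‖a x - b x‖ₑ ^ 2 := fun c a b ma mb =>
    lintegral_foot hL c (h := fun x => ‖a x - b x‖ₑ ^ 2) ((ma.sub mb).enorm.pow_const 2)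
  have key := gronwall_characteristics hL hpos c c' (mu.sub mv).enorm (mw.sub mz).enorm
    (a := fun p => ‖u₀ (p.2 + c * p.1) - v₀ (p.2 + c * p.1)‖ₑ)
    (b := fun p => ‖w₀ (p.2 + c' * p.1) - z₀ (p.2 + c' * p.1)‖ₑ)
    (((mu₀.sub mv₀).comp_measurable (by fun_prop)).enorm)
    (((mw₀.sub mz₀).comp_measurable (by fun_prop)).enorm)
    (diff c hN hu hv) (diff c' hN' hw hz) (fin mu fu fv) (fin mw fw fz)
  rw [foot c mu₀ mv₀, foot c' mw₀ mz₀] at key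
  refine key.trans (le_of_eq ?_)
  ring

end Semilinear

/-! ### Functions of class `H¹` on the line -/

theorem sq_lintegral_uIoc_le {f : ℝ → ℝ≥0∞} (hf : Measurable f) (a b : ℝ) :
    (∫⁻ s in uIoc a b, f s) ^ 2 ≤ ENNReal.ofReal |b - a| * ∫⁻ s in uIoc a b, f s ^ 2 := by
  have := sq_lintegral_mul_le (volume.restrict (uIoc a b)) (f := fun _ => 1) (g := f)
    aemeasurable_const hf.aemeasurable
  simpa using this

/-- An `L²` function with `L²` weak derivative `g` is almost everywhere a primitive of `g`. -/
theorem HasWeakDirDeriv.exists_ae_eq_primitive {f g : ℝ → ℂ} (hf : MemLp f 2) (hg : MemLp g 2)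
    (h : HasWeakDirDeriv univ f 1 g) :
    ∃ z : ℂ, ∀ᵐ t, f t = z + ∫ s in (0 : ℝ)..t, g s := by
  refine ae_eq_add_primitive_of_weak (hf.locallyIntegrable (by norm_num))
    (hg.locallyIntegrable (by norm_num)) fun α hα hc => ?_
  have := h α ⟨hα, hc, subset_univ _⟩
  simpa [fderiv_apply_one_eq_deriv] using this

theorem add_primitive_sub {g : ℝ → ℂ} (hg : LocallyIntegrable g) (z : ℂ) (x h : ℝ) :
    (z + ∫ s in (0 : ℝ)..(x + h), g s) - (z + ∫ s in (0 : ℝ)..x, g s) =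
      ∫ s in (0 : ℝ)..h, g (x + s) := by
  rw [intervalIntegral.integral_comp_add_left, add_sub_add_left_eq_sub, add_zero,
    intervalIntegral.integral_interval_sub_left (hg.intervalIntegrable_real _ _)
      (hg.intervalIntegrable_real _ _)]

theorem enorm_intervalIntegral_le (g : ℝ → ℂ) (a b : ℝ) :
    ‖∫ s in a..b, g s‖ₑ ≤ ∫⁻ s in uIoc a b, ‖g s‖ₑ := by
  rw [← ofReal_norm, intervalIntegral.norm_intervalIntegral_eq, ofReal_norm]
  exact enorm_integral_le_lintegral_enorm _

/-- Translates of an `H¹` function: `‖f(· + h) - f‖ ≤ |h| ‖f'‖` in `L²`. -/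
theorem HasWeakDirDeriv.lintegral_sq_translate_sub_le {f g : ℝ → ℂ} (hf : MemLp f 2)
    (hg : MemLp g 2) (h : HasWeakDirDeriv univ f 1 g) (a : ℝ) :
    ∫⁻ x, ‖f (x + a) - f x‖ₑ ^ 2 ≤ ENNReal.ofReal (a ^ 2) * ∫⁻ x, ‖g x‖ₑ ^ 2 := by
  obtain ⟨z, hz⟩ := h.exists_ae_eq_primitive hf hg
  set k := hg.1.mk g with hk
  have mk : StronglyMeasurable k := hg.1.stronglyMeasurable_mk
  have gk : g =ᵐ[volume] k := hg.1.ae_eq_mk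
  have mk2 : Measurable fun q : ℝ × ℝ => ‖k (q.1 + q.2)‖ₑ ^ 2 :=
    (mk.comp_measurable (by fun_prop)).enorm.pow_const 2
  have hz' : ∀ᵐ x, f (x + a) = z + ∫ s in (0 : ℝ)..(x + a), g s :=
    (measurePreserving_add_right volume a).quasiMeasurePreserving.ae hz
  calc ∫⁻ x, ‖f (x + a) - f x‖ₑ ^ 2
      ≤ ∫⁻ x, ENNReal.ofReal |a| * ∫⁻ s in uIoc 0 a, ‖k (x + s)‖ₑ ^ 2 := by
        refine lintegral_mono_ae ?_
        filter_upwards [hz, hz'] with x h1 h2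
        rw [h1, h2, add_primitive_sub (hg.locallyIntegrable (by norm_num))]
        refine (pow_le_pow_left' (enorm_intervalIntegral_le _ _ _) 2).trans ?_
        have e : ∫⁻ s in uIoc 0 a, ‖g (x + s)‖ₑ = ∫⁻ s in uIoc 0 a, ‖k (x + s)‖ₑ := by
          refine lintegral_congr_ae (ae_restrict_of_ae ?_)
          filter_upwards [(measurePreserving_add_left volume x).quasiMeasurePreserving.ae gk]
            with s hs
          rw [hs]
        rw [e]
        simpa using sq_lintegral_uIoc_le
          (mk.comp_measurable (measurable_const_add x)).enorm 0 a
    _ = ENNReal.ofReal |a| * ∫⁻ s in uIoc 0 a, ∫⁻ x, ‖k (x + s)‖ₑ ^ 2 := by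
        rw [lintegral_const_mul' _ _ ENNReal.ofReal_ne_top]
        congr 1
        exact lintegral_lintegral_swap mk2.aemeasurable
    _ = ENNReal.ofReal |a| * ∫⁻ s in uIoc 0 a, ∫⁻ x, ‖k x‖ₑ ^ 2 := by
        congr 1
        refine lintegral_congr fun s => ?_
        exact lintegral_add_right_eq_self (fun x => ‖k x‖ₑ ^ 2) s
    _ = ENNReal.ofReal (a ^ 2) * ∫⁻ x, ‖g x‖ₑ ^ 2 := by
        have e : ∫⁻ x, ‖g x‖ₑ ^ 2 = ∫⁻ x, ‖k x‖ₑ ^ 2 := by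
          refine lintegral_congr_ae ?_
          filter_upwards [gk] with x hx
          rw [hx]
        have v : volume (uIoc 0 a) = ENNReal.ofReal |a| := by simp
        rw [setLIntegral_const, v, e, mul_comm _ (ENNReal.ofReal |a|), ← mul_assoc,
          ← ENNReal.ofReal_mul (abs_nonneg a), ← sq, sq_abs]

/-- An `H¹` function on the line is essentially bounded. -/
theorem HasWeakDirDeriv.exists_ae_norm_le {f g : ℝ → ℂ} (hf : MemLp f 2) (hg : MemLp g 2)
    (h : HasWeakDirDeriv univ f 1 g) : ∃ M : ℝ, ∀ᵐ x, ‖f x‖ ≤ M := by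
  obtain ⟨z, hz⟩ := h.exists_ae_eq_primitive hf hg
  have lg : LocallyIntegrable g := hg.locallyIntegrable (by norm_num)
  set F : ℝ → ℂ := fun t => z + ∫ s in (0 : ℝ)..t, g s with hF
  have cF : Continuous F := continuous_add_primitive lg z
  set k := hg.1.mk g with hk
  have mk : StronglyMeasurable k := hg.1.stronglyMeasurable_mk
  have gk : g =ᵐ[volume] k := hg.1.ae_eq_mk
  have v : volume (uIoc (0 : ℝ) 1) = 1 := by simp
  have sq : ∀ {r : ℝ → ℂ}, StronglyMeasurable r → ∀ x : ℝ,
      (∫⁻ s in uIoc 0 1, ‖r (x + s)‖ₑ) ^ 2 ≤ ∫⁻ s, ‖r s‖ₑ ^ 2 := by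
    intro r mr x
    refine (sq_lintegral_uIoc_le (mr.comp_measurable (by fun_prop)).enorm 0 1).trans ?_
    simp only [sub_zero, abs_one, ENNReal.ofReal_one, one_mul]
    refine (setLIntegral_le_lintegral _ _).trans (le_of_eq ?_)
    exact lintegral_add_left_eq_self (fun s => ‖r s‖ₑ ^ 2) x
  -- averaging `F x = F (x + s) - ∫₀ˢ g (x + r) dr` over `s ∈ (0, 1)`
  have hFz : ∀ x, ‖F x‖ₑ ^ 2 ≤ 2 * (∫⁻ s, ‖F s‖ₑ ^ 2) + 2 * ∫⁻ s, ‖k s‖ₑ ^ 2 := by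
    intro x
    have e : ∫⁻ s in uIoc 0 1, ‖g (x + s)‖ₑ = ∫⁻ s in uIoc 0 1, ‖k (x + s)‖ₑ := by
      refine lintegral_congr_ae (ae_restrict_of_ae ?_)
      filter_upwards [(measurePreserving_add_left volume x).quasiMeasurePreserving.ae gk]
        with s hs
      rw [hs]
    have h1 : ∀ s ∈ uIoc (0 : ℝ) 1, ‖F x‖ₑ ≤ ‖F (x + s)‖ₑ +
        ∫⁻ s in uIoc 0 1, ‖k (x + s)‖ₑ := by
      intro s hs
      have h2 : F x = F (x + s) - ∫ r in (0 : ℝ)..s, g (x + r) := by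
        rw [← add_primitive_sub lg z, sub_sub_cancel]
      rw [h2]
      refine enorm_sub_le.trans (add_le_add le_rfl ?_)
      refine (enorm_intervalIntegral_le _ _ _).trans ?_
      rw [← e]
      refine lintegral_mono_set ?_
      rw [uIoc_of_le zero_le_one] at hs ⊢
      rw [uIoc_of_le hs.1.le]
      exact Ioc_subset_Ioc_right hs.2
    have h3 : ‖F x‖ₑ ≤ (∫⁻ s in uIoc 0 1, ‖F (x + s)‖ₑ) + ∫⁻ s in uIoc 0 1, ‖k (x + s)‖ₑ := by
      calc ‖F x‖ₑ = ∫⁻ s in uIoc 0 1, ‖F x‖ₑ := by rw [setLIntegral_const, v, mul_one]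
        _ ≤ ∫⁻ s in uIoc 0 1, (‖F (x + s)‖ₑ + ∫⁻ s in uIoc 0 1, ‖k (x + s)‖ₑ) :=
            setLIntegral_mono' measurableSet_uIoc h1
        _ = _ := by
            rw [lintegral_add_right _ measurable_const, setLIntegral_const, v, mul_one]
    calc ‖F x‖ₑ ^ 2 ≤ _ := pow_le_pow_left' h3 2
      _ ≤ _ := ENNReal.add_sq_le _ _
      _ ≤ _ := by
        gcongr
        · exact sq cF.stronglyMeasurable x
        · exact sq mk x
  have fin : 2 * (∫⁻ s, ‖F s‖ₑ ^ 2) + 2 * ∫⁻ s, ‖k s‖ₑ ^ 2 ≠ ⊤ := by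
    have e1 : ∫⁻ s, ‖F s‖ₑ ^ 2 = ∫⁻ s, ‖f s‖ₑ ^ 2 := by
      refine lintegral_congr_ae ?_
      filter_upwards [hz] with x hx
      rw [hx]
    have e2 : ∫⁻ s, ‖k s‖ₑ ^ 2 = ∫⁻ s, ‖g s‖ₑ ^ 2 := by
      refine lintegral_congr_ae ?_
      filter_upwards [gk] with x hx
      rw [hx]
    rw [e1, e2]
    exact (ENNReal.add_lt_top.mpr ⟨ENNReal.mul_lt_top (by simp) hf.lintegral_sq_lt_top,
      ENNReal.mul_lt_top (by simp) hg.lintegral_sq_lt_top⟩).ne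
  refine ⟨Real.sqrt (2 * (∫⁻ s, ‖F s‖ₑ ^ 2) + 2 * ∫⁻ s, ‖k s‖ₑ ^ 2).toReal, ?_⟩
  filter_upwards [hz] with x hx
  rw [hx]
  refine Real.le_sqrt_of_sq_le ?_
  have := ENNReal.toReal_mono fin (hFz x)
  simpa using this

/-! ### Weak derivatives from difference quotients -/

/-- A bounded sequence in a Hilbert space has a weak cluster point `g`; inner products with `g` are
the limits of the inner products along the sequence, whenever these limits exist. -/
theorem exists_inner_eq_of_bounded {H : Type*} [NormedAddCommGroup H] [InnerProductSpace ℂ H]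
    [CompleteSpace H] {x : ℕ → H} {R : ℝ} (hx : ∀ n, ‖x n‖ ≤ R) :
    ∃ g : H, ∀ (φ : H) (l : ℂ),
      Tendsto (fun n => inner ℂ (x n) φ) atTop (𝓝 l) → inner ℂ g φ = l := by
  set y : ℕ → WeakDual ℂ H := fun n =>
    StrongDual.toWeakDual (InnerProductSpace.toDual ℂ H (x n)) with hy
  have hc := WeakDual.isCompact_closedBall (𝕜 := ℂ) (E := H) 0 R
  have hmem : ∀ n, y n ∈ WeakDual.toStrongDual ⁻¹' Metric.closedBall (0 : StrongDual ℂ H) R := by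
    intro n
    rw [mem_preimage, mem_closedBall_zero_iff]
    simpa [hy] using hx n
  obtain ⟨a, _, ha⟩ := hc.exists_mapClusterPt (f := atTop) (u := y)
    (by rw [le_principal_iff]; exact mem_map.mpr (Eventually.of_forall hmem))
  refine ⟨(InnerProductSpace.toDual ℂ H).symm (WeakDual.toStrongDual a), fun φ l hl => ?_⟩
  rw [InnerProductSpace.toDual_symm_apply]
  have hcl : MapClusterPt (a φ) atTop (fun n => y n φ) :=
    ha.continuousAt_comp (WeakDual.eval_continuous φ).continuousAt
  have hl' : Tendsto (fun n => y n φ) atTop (𝓝 l) := by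
    simpa [hy] using hl
  have : (𝓝 (a φ) ⊓ 𝓝 l).NeBot := hcl.clusterPt.mono hl'
  exact eq_of_nhds_neBot this

theorem isOpen_slab (T : ℝ) : IsOpen (slab T) := isOpen_Ioo.prod isOpen_univ

/-- Functions that are square integrable on every slab are locally integrable. -/
theorem locallyIntegrable_of_memLp_slab {E : Type*} [NormedAddCommGroup E] {f : ℝ × ℝ → E}
    (h : ∀ T, 0 < T → MemLp f 2 (volume.restrict (slab T))) : LocallyIntegrable f := by
  intro p
  set T := |p.1| + 1
  have hT : 0 < T := by positivity
  have hp : p ∈ slab T := ⟨by rw [mem_Ioo, ← abs_lt]; simp [T], mem_univ _⟩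
  have h1 : LocallyIntegrable f (volume.restrict (slab T)) :=
    (h T hT).locallyIntegrable (by norm_num)
  obtain ⟨s, hs, hi⟩ := h1 p
  refine ⟨s ∩ slab T, inter_mem hs ((isOpen_slab T).mem_nhds hp), ?_⟩
  rw [IntegrableOn, Measure.restrict_restrict' (isOpen_slab T).measurableSet] at hi
  exact hi

/-- Difference quotients of test functions converge in the pairing with a locally integrable
function. -/
theorem tendsto_integral_difference_quotient {φ : ℝ × ℝ → ℝ} {Ω : Set (ℝ × ℝ)}
    (hφ : IsTestFunction Ω φ) {u : ℝ × ℝ → ℂ} (hu : LocallyIntegrable u) :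
    Tendsto (fun n : ℕ => ∫ p : ℝ × ℝ, (((n : ℝ) + 1) *
      (φ (p.1, p.2 - 1 / ((n : ℝ) + 1)) - φ p)) • u p) atTop
      (𝓝 (-∫ p, fderiv ℝ φ p (0, 1) • u p)) := by
  obtain ⟨C, hC⟩ := hφ.1.lipschitzWith_of_hasCompactSupport hφ.2.1 (by simp)
  have hK : IsCompact (Metric.cthickening 1 (tsupport φ)) := hφ.2.1.isCompact.cthickening
  rw [← integral_neg]
  refine tendsto_integral_of_dominated_convergence
    (fun p => C * (Metric.cthickening 1 (tsupport φ)).indicator (fun p => ‖u p‖) p) ?_ ?_ ?_ ?_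
  · intro n
    have := hφ.1.continuous
    have hc : Continuous fun p : ℝ × ℝ => ((n : ℝ) + 1) *
      (φ (p.1, p.2 - 1 / ((n : ℝ) + 1)) - φ p) := by fun_prop
    exact hc.aestronglyMeasurable.smul hu.aestronglyMeasurable
  · refine Integrable.const_mul ?_ _
    rw [integrable_indicator_iff hK.measurableSet]
    exact (hu.integrableOn_isCompact hK).norm
  · intro n
    refine ae_of_all _ fun p => ?_
    have hn : (0 : ℝ) < (n : ℝ) + 1 := by positivity
    have hdist : dist (p.1, p.2 - 1 / ((n : ℝ) + 1)) p = 1 / ((n : ℝ) + 1) := by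
      rw [Prod.dist_eq, dist_self, Real.dist_eq, sub_sub_cancel_left, abs_neg,
        abs_of_pos (by positivity)]
      exact max_eq_right (by positivity)
    have h1 : (1 : ℝ) / ((n : ℝ) + 1) ≤ 1 := by
      rw [div_le_one hn]; linarith [(Nat.cast_nonneg n : (0 : ℝ) ≤ n)]
    by_cases hp : p ∈ Metric.cthickening 1 (tsupport φ)
    · rw [indicator_of_mem hp, norm_smul]
      refine mul_le_mul_of_nonneg_right ?_ (norm_nonneg _)
      rw [norm_mul, Real.norm_of_nonneg hn.le]
      have := hC.dist_le_mul (p.1, p.2 - 1 / ((n : ℝ) + 1)) p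
      rw [hdist, dist_eq_norm] at this
      calc ((n : ℝ) + 1) * ‖φ (p.1, p.2 - 1 / ((n : ℝ) + 1)) - φ p‖
          ≤ ((n : ℝ) + 1) * (C * (1 / ((n : ℝ) + 1))) := by gcongr
        _ = C := by field_simp
    · have z1 : φ p = 0 := image_eq_zero_of_notMem_tsupport fun h =>
        hp (Metric.self_subset_cthickening _ h)
      have z2 : φ (p.1, p.2 - 1 / ((n : ℝ) + 1)) = 0 := image_eq_zero_of_notMem_tsupport fun h =>
        hp (Metric.mem_cthickening_of_dist_le p _ 1 _ h (by rw [dist_comm, hdist]; exact h1))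
      rw [indicator_of_notMem hp, z1, z2]
      simp
  · refine ae_of_all _ fun p => ?_
    have hd : HasDerivAt (fun s : ℝ => φ (p.1, p.2 - s)) (-fderiv ℝ φ p (0, 1)) 0 := by
      have h1 : HasFDerivAt φ (fderiv ℝ φ p) (p.1, p.2 - 0) := by
        rw [sub_zero]
        exact (hφ.1.differentiable (by simp) _).hasFDerivAt
      have h2 : HasDerivAt (fun s : ℝ => (p.1, p.2 - s)) (0, -1) 0 :=
        (hasDerivAt_const _ _).prodMk (by simpa using (hasDerivAt_id (0 : ℝ)).const_sub p.2)
      have h3 := h1.comp_hasDerivAt 0 h2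
      have e : ((0 : ℝ), (-1 : ℝ)) = -(0, 1) := by simp
      rw [e, map_neg] at h3
      exact h3
    have ht := hd.tendsto_slope_zero_right
    have hseq : Tendsto (fun n : ℕ => 1 / ((n : ℝ) + 1)) atTop (𝓝[>] 0) := by
      rw [tendsto_nhdsWithin_iff]
      exact ⟨tendsto_one_div_add_atTop_nhds_zero_nat, Eventually.of_forall fun n => by
        rw [mem_Ioi]; positivity⟩
    have := (ht.comp hseq).smul_const (u p)
    rw [neg_smul] at this
    refine this.congr fun n => ?_
    simp [Function.comp]

theorem IsTestFunction.eq_zero_of_notMem {φ : ℝ × ℝ → ℝ} {Ω : Set (ℝ × ℝ)}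
    (hφ : IsTestFunction Ω φ) {p : ℝ × ℝ} (hp : p ∉ Ω) : φ p = 0 :=
  image_eq_zero_of_notMem_tsupport fun h => hp (hφ.2.2 h)

theorem IsTestFunction.fderiv_eq_zero_of_notMem {φ : ℝ × ℝ → ℝ} {Ω : Set (ℝ × ℝ)}
    (hφ : IsTestFunction Ω φ) {p : ℝ × ℝ} (hp : p ∉ Ω) : fderiv ℝ φ p = 0 := by
  by_contra hcon
  exact hp (hφ.2.2 (support_fderiv_subset ℝ hcon))

theorem IsTestFunction.setIntegral_smul {E : Type*} [NormedAddCommGroup E] [NormedSpace ℝ E]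
    {φ : ℝ × ℝ → ℝ} {Ω : Set (ℝ × ℝ)} (hφ : IsTestFunction Ω φ) (g : ℝ × ℝ → E) :
    ∫ p in Ω, φ p • g p = ∫ p, φ p • g p :=
  setIntegral_eq_integral_of_forall_compl_eq_zero fun p hp => by
    rw [hφ.eq_zero_of_notMem hp, zero_smul]

theorem IsTestFunction.setIntegral_fderiv_smul {E : Type*} [NormedAddCommGroup E]
    [NormedSpace ℝ E] {φ : ℝ × ℝ → ℝ} {Ω : Set (ℝ × ℝ)} (hφ : IsTestFunction Ω φ) (v : ℝ × ℝ)
    (g : ℝ × ℝ → E) : ∫ p in Ω, fderiv ℝ φ p v • g p = ∫ p, fderiv ℝ φ p v • g p :=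
  setIntegral_eq_integral_of_forall_compl_eq_zero fun p hp => by
    rw [hφ.fderiv_eq_zero_of_notMem hp, zero_apply, zero_smul]

/-- Bounded difference quotients in `x` give a weak derivative in `x`. -/
theorem exists_hasWeakDirDeriv_of_difference_quotient {u : ℝ × ℝ → ℂ} (mu : StronglyMeasurable u)
    (hu : LocallyIntegrable u) (T : ℝ) {K : ℝ≥0∞} (hK : K ≠ ⊤)
    (h : ∀ a : ℝ, ∫⁻ p in slab T, ‖u (p.1, p.2 + a) - u p‖ₑ ^ 2 ≤ ENNReal.ofReal (a ^ 2) * K) :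
    ∃ g : ℝ × ℝ → ℂ, MemLp g 2 (volume.restrict (slab T)) ∧
      HasWeakDirDeriv (slab T) u (0, 1) g := by
  set d : ℕ → ℝ × ℝ → ℂ := fun n p =>
    ((n : ℝ) + 1) • (u (p.1, p.2 + 1 / ((n : ℝ) + 1)) - u p) with hd
  have mu' : ∀ a : ℝ, StronglyMeasurable fun p : ℝ × ℝ => u (p.1, p.2 + a) := fun a =>
    mu.comp_measurable (by fun_prop)
  have md : ∀ n, StronglyMeasurable (d n) := fun n =>
    ((mu' (1 / ((n : ℝ) + 1))).sub mu).const_smul ((n : ℝ) + 1)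
  have hdK : ∀ n, ∫⁻ p in slab T, ‖d n p‖ₑ ^ 2 ≤ K := by
    intro n
    have hn : (0 : ℝ) < (n : ℝ) + 1 := by positivity
    have e : ∀ p, ‖d n p‖ₑ ^ 2 = ENNReal.ofReal (((n : ℝ) + 1) ^ 2) *
        ‖u (p.1, p.2 + 1 / ((n : ℝ) + 1)) - u p‖ₑ ^ 2 := by
      intro p
      rw [hd]
      simp only
      rw [enorm_smul, mul_pow, Real.enorm_of_nonneg hn.le, ENNReal.ofReal_pow hn.le]
    simp_rw [e]
    rw [lintegral_const_mul' _ _ ENNReal.ofReal_ne_top]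
    calc _ ≤ ENNReal.ofReal (((n : ℝ) + 1) ^ 2) *
          (ENNReal.ofReal ((1 / ((n : ℝ) + 1)) ^ 2) * K) := by gcongr; exact h _
      _ = K := by
          rw [← mul_assoc, ← ENNReal.ofReal_mul (by positivity)]
          have : ((n : ℝ) + 1) ^ 2 * (1 / ((n : ℝ) + 1)) ^ 2 = 1 := by field_simp
          rw [this, ENNReal.ofReal_one, one_mul]
  have mem : ∀ n, MemLp (d n) 2 (volume.restrict (slab T)) := fun n =>
    memLp_two_of_lintegral_lt_top (md n).aestronglyMeasurable ((hdK n).trans_lt hK.lt_top)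
  have hbound : ∀ n, ‖(mem n).toLp‖ ≤ Real.sqrt K.toReal := by
    intro n
    refine Real.le_sqrt_of_sq_le ?_
    rw [Lp.norm_toLp, ← ENNReal.toReal_pow, eLpNorm_two_sq]
    exact ENNReal.toReal_mono hK (hdK n)
  obtain ⟨g, hg⟩ := exists_inner_eq_of_bounded hbound
  refine ⟨g, Lp.memLp g, fun φ hφ => ?_⟩
  have mφ : MemLp (fun p => (φ p : ℂ)) 2 (volume.restrict (slab T)) :=
    ((Complex.continuous_ofReal.comp hφ.1.continuous).memLp_of_hasCompactSupport
      (hφ.2.1.comp_left Complex.ofReal_zero)).restrict _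
  have inner_eq : ∀ (f : Lp ℂ 2 (volume.restrict (slab T))) (f' : ℝ × ℝ → ℂ),
      f =ᵐ[volume.restrict (slab T)] f' →
      inner ℂ f mφ.toLp = (starRingEnd ℂ) (∫ p, φ p • f' p) := by
    intro f f' hf
    rw [← hφ.setIntegral_smul, ← inner_conj_symm, L2.inner_def]
    congr 1
    refine integral_congr_ae ?_
    filter_upwards [hf, mφ.coeFn_toLp] with p h1 h2
    rw [h1, h2]
    simp [mul_comm]
  -- the difference quotient is moved to the test function
  have conv : ∀ n, ∫ p, φ p • d n p = ∫ p : ℝ × ℝ, (((n : ℝ) + 1) *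
      (φ (p.1, p.2 - 1 / ((n : ℝ) + 1)) - φ p)) • u p := by
    intro n
    set a : ℝ := 1 / ((n : ℝ) + 1) with ha
    have tr : MeasurePreserving (fun p : ℝ × ℝ => p + (0, a)) volume volume :=
      measurePreserving_add_right volume (0, a)
    have e1 : ∀ p : ℝ × ℝ, p + (0, a) = (p.1, p.2 + a) := fun p => by ext <;> simp
    have lu' : LocallyIntegrable fun p : ℝ × ℝ => u (p.1, p.2 + a) := by
      have := (locallyIntegrable_map_homeomorph (Homeomorph.addRight ((0 : ℝ), a)) (f := u)
        (μ := (volume : Measure (ℝ × ℝ)))).mp (by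
          change LocallyIntegrable u (Measure.map (fun p : ℝ × ℝ => p + (0, a)) volume)
          rwa [tr.map_eq])
      simpa [Function.comp_def, e1] using this
    have i1 : Integrable fun p : ℝ × ℝ => φ p • u (p.1, p.2 + a) :=
      lu'.integrable_smul_left_of_hasCompactSupport hφ.1.continuous hφ.2.1
    have i2 : Integrable fun p : ℝ × ℝ => φ p • u p :=
      hu.integrable_smul_left_of_hasCompactSupport hφ.1.continuous hφ.2.1
    have e2 : ∫ p : ℝ × ℝ, φ p • u (p.1, p.2 + a) = ∫ p : ℝ × ℝ, φ (p.1, p.2 - a) • u p := by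
      rw [← integral_add_right_eq_self (fun p : ℝ × ℝ => φ (p.1, p.2 - a) • u p) (0, a)]
      refine integral_congr_ae (ae_of_all _ fun p => ?_)
      simp [e1]
    have i3 : Integrable fun p : ℝ × ℝ => φ (p.1, p.2 - a) • u p := by
      have h3 : Integrable fun p : ℝ × ℝ => (fun p : ℝ × ℝ => φ (p.1, p.2 - a) • u p)
          (p + (0, a)) := by
        refine i1.congr (ae_of_all _ fun p => ?_)
        simp [e1]
      exact (tr.integrable_comp_emb (measurableEmbedding_addRight _)).mp h3
    calc ∫ p, φ p • d n p
        = ∫ p : ℝ × ℝ, ((n : ℝ) + 1) • (φ p • u (p.1, p.2 + a) - φ p • u p) := by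
          refine integral_congr_ae (ae_of_all _ fun p => ?_)
          simp only [hd, ← ha]
          rw [smul_comm, smul_sub]
      _ = ∫ p : ℝ × ℝ, ((n : ℝ) + 1) • (φ (p.1, p.2 - a) • u p - φ p • u p) := by
          rw [integral_smul, integral_smul, integral_sub i1 i2, integral_sub i3 i2, e2]
      _ = _ := by
          refine integral_congr_ae (ae_of_all _ fun p => ?_)
          simp only [mul_smul, sub_smul]
  have lim := tendsto_integral_difference_quotient hφ hu
  have key := hg mφ.toLp ((starRingEnd ℂ) (-∫ p, fderiv ℝ φ p (0, 1) • u p)) (by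
    refine ((Complex.continuous_conj.tendsto _).comp lim).congr fun n => ?_
    rw [inner_eq _ _ (mem n).coeFn_toLp, conv]
    rfl)
  rw [inner_eq g g (ae_eq_refl _)] at key
  have := (starRingEnd ℂ).injective key
  rw [hφ.setIntegral_fderiv_smul, hφ.setIntegral_smul, this, neg_neg]

theorem HasWeakDirDeriv.mono_of_univ {E : Type*} [NormedAddCommGroup E] [NormedSpace ℝ E]
    {f g : ℝ × ℝ → E} {v : ℝ × ℝ} (h : HasWeakDirDeriv univ f v g) (Ω : Set (ℝ × ℝ)) :
    HasWeakDirDeriv Ω f v g := by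
  intro φ hφ
  have := h φ ⟨hφ.1, hφ.2.1, subset_univ _⟩
  rw [Measure.restrict_univ] at this
  rwa [hφ.setIntegral_fderiv_smul, hφ.setIntegral_smul]

/-- Weak directional derivatives are linear in the direction. -/
theorem HasWeakDirDeriv.smul_add_smul {E : Type*} [NormedAddCommGroup E] [NormedSpace ℝ E]
    {Ω : Set (ℝ × ℝ)} {f g g' : ℝ × ℝ → E} {v v' : ℝ × ℝ} (a b : ℝ)
    (hf : MemLp f 2 (volume.restrict Ω)) (hg : MemLp g 2 (volume.restrict Ω))
    (hg' : MemLp g' 2 (volume.restrict Ω)) (h : HasWeakDirDeriv Ω f v g)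
    (h' : HasWeakDirDeriv Ω f v' g') :
    HasWeakDirDeriv Ω f (a • v + b • v') (fun p => a • g p + b • g' p) := by
  intro φ hφ
  have int : ∀ {r : ℝ × ℝ → E} {χ : ℝ × ℝ → ℝ} (a : ℝ), MemLp r 2 (volume.restrict Ω) →
      Continuous χ → HasCompactSupport χ →
      Integrable (fun p => a • (χ p • r p)) (volume.restrict Ω) :=
    fun a hr hχ hc => ((hr.locallyIntegrable
      (by norm_num)).integrable_smul_left_of_hasCompactSupport hχ hc).smul a
  have e1 : ∀ p, fderiv ℝ φ p (a • v + b • v') • f p =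
      a • (fderiv ℝ φ p v • f p) + b • (fderiv ℝ φ p v' • f p) := fun p => by
    rw [map_add, map_smul, map_smul, add_smul, smul_assoc, smul_assoc]
  have e2 : ∀ p, φ p • (a • g p + b • g' p) = a • (φ p • g p) + b • (φ p • g' p) := fun p => by
    rw [smul_add, smul_comm, smul_comm (φ p) b]
  simp_rw [e1, e2]
  rw [integral_add (int a hf (hφ.continuous_fderiv_apply v) (hφ.hasCompactSupport_fderiv_apply v))
      (int b hf (hφ.continuous_fderiv_apply v') (hφ.hasCompactSupport_fderiv_apply v')),
    integral_add (int a hg hφ.1.continuous hφ.2.1) (int b hg' hφ.1.continuous hφ.2.1),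
    integral_smul, integral_smul, integral_smul, integral_smul, h φ hφ, h' φ hφ]
  simp only [smul_neg, neg_add]

/-! ### The Thirring system in null coordinates -/

theorem IsMildTransport.congr {c : ℝ} {f₀ f₀' : ℝ → ℂ} {F F' f f' : ℝ × ℝ → ℂ}
    (h : IsMildTransport c f₀ F f) (h₀ : f₀ =ᵐ[volume] f₀') (hF : F =ᵐ[volume] F')
    (hf : f =ᵐ[volume] f') : IsMildTransport c f₀' F' f' := by
  filter_upwards [h, ae_foot c h₀, charInt_congr c hF, hf] with p h1 h2 h3 h4
  rw [← h4, h1, h2, h3]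

/-- The Thirring equation in null coordinates, in integrated form: `u` moves to the left and `w`
to the right. -/
structure IsMildThirring (lam₁ lam₂ κ₁ κ₂ : ℝ) (u₀ w₀ : ℝ → ℂ) (u w : ℝ × ℝ → ℂ) : Prop where
  left : IsMildTransport 1 u₀ (fun p => thirringNonlin lam₁ κ₁ (u p) (w p)) u
  right : IsMildTransport (-1) w₀ (fun p => thirringNonlin lam₂ κ₂ (w p) (u p)) w
  memLp_left : ∀ T, 0 < T → MemLp u 2 (volume.restrict (slab T))
  memLp_right : ∀ T, 0 < T → MemLp w 2 (volume.restrict (slab T))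
  locallyIntegrable_left : LocallyIntegrable fun p => thirringNonlin lam₁ κ₁ (u p) (w p)
  locallyIntegrable_right : LocallyIntegrable fun p => thirringNonlin lam₂ κ₂ (w p) (u p)

theorem IsMildThirring.congr {lam₁ lam₂ κ₁ κ₂ : ℝ} {u₀ w₀ u₀' w₀' : ℝ → ℂ}
    {u w u' w' : ℝ × ℝ → ℂ} (h : IsMildThirring lam₁ lam₂ κ₁ κ₂ u₀ w₀ u w)
    (hu₀ : u₀ =ᵐ[volume] u₀') (hw₀ : w₀ =ᵐ[volume] w₀') (hu : u =ᵐ[volume] u')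
    (hw : w =ᵐ[volume] w') : IsMildThirring lam₁ lam₂ κ₁ κ₂ u₀' w₀' u' w' := by
  have e1 : (fun p => thirringNonlin lam₁ κ₁ (u p) (w p)) =ᵐ[volume]
      fun p => thirringNonlin lam₁ κ₁ (u' p) (w' p) := by
    filter_upwards [hu, hw] with p h1 h2
    rw [h1, h2]
  have e2 : (fun p => thirringNonlin lam₂ κ₂ (w p) (u p)) =ᵐ[volume]
      fun p => thirringNonlin lam₂ κ₂ (w' p) (u' p) := by
    filter_upwards [hu, hw] with p h1 h2
    rw [h1, h2]
  exact ⟨h.left.congr hu₀ e1 hu, h.right.congr hw₀ e2 hw,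
    fun T hT => (h.memLp_left T hT).ae_eq (ae_restrict_of_ae hu),
    fun T hT => (h.memLp_right T hT).ae_eq (ae_restrict_of_ae hw),
    h.locallyIntegrable_left.congr e1, h.locallyIntegrable_right.congr e2⟩

theorem thirringNonlin_eq (lam c : ℝ) (z w : ℂ) : thirringNonlin lam c z w =
    -Complex.I * (lam * w + ((c * ‖w‖ ^ 2 : ℝ) : ℂ) * z) := by
  rw [thirringNonlin]
  push_cast
  rfl

theorem IsMildThirring.norm_le {lam₁ lam₂ κ₁ κ₂ ℓ M : ℝ} (h₁ : |lam₁| ≤ ℓ) (h₂ : |lam₂| ≤ ℓ)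
    (hM : 0 ≤ M) {u₀ w₀ : ℝ → ℂ} {u w : ℝ × ℝ → ℂ} (mu : StronglyMeasurable u)
    (mw : StronglyMeasurable w) (h : IsMildThirring lam₁ lam₂ κ₁ κ₂ u₀ w₀ u w)
    (hu₀ : ∀ᵐ x, ‖u₀ x‖ ≤ M) (hw₀ : ∀ᵐ x, ‖w₀ x‖ ≤ M) :
    ∀ᵐ p, ‖u p‖ ≤ growthBound M ℓ p.1 ∧ ‖w p‖ ≤ growthBound M ℓ p.1 := by
  obtain ⟨h1, h2, h3, h4, h5, h6⟩ := h
  simp only [thirringNonlin_eq] at h1 h2 h5 h6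
  exact norm_le_growthBound h₁ h₂ hM (V := fun p => κ₁ * ‖w p‖ ^ 2)
    (V' := fun p => κ₂ * ‖u p‖ ^ 2) mu mw h1 h2 h5 h6
    (locallyIntegrable_of_memLp_slab h3) (locallyIntegrable_of_memLp_slab h4)
    (fun T hT => (h3 T hT).lintegral_sq_lt_top) (fun T hT => (h4 T hT).lintegral_sq_lt_top)
    hu₀ hw₀

/-- A Lipschitz constant at time `t` for the nonlinearities truncated at `growthBound M ℓ t`. -/
noncomputable def truncRate (ℓ C M t : ℝ) : ℝ := ℓ + 4 * C * growthBound M ℓ t ^ 2 + 1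

theorem continuous_truncRate (ℓ C M : ℝ) : Continuous (truncRate ℓ C M) := by
  have := continuous_growthBound M ℓ
  unfold truncRate
  fun_prop

theorem truncRate_pos {ℓ C : ℝ} (hℓ : 0 ≤ ℓ) (hC : 0 ≤ C) (M t : ℝ) : 0 < truncRate ℓ C M t := by
  unfold truncRate
  positivity

theorem isLipschitzNonlin_trunc {lam c ℓ C M : ℝ} (hlam : |lam| ≤ ℓ) (hc : |c| ≤ C) (hM : 0 < M) :
    IsLipschitzNonlin (truncRate ℓ C M) fun t => truncNonlin lam c (growthBound M ℓ t) := by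
  refine ⟨?_, fun t z w z' w' => ?_, fun t => truncNonlin_zero _ _ _⟩
  · have := (continuous_growthBound M ℓ).measurable
    unfold truncNonlin discRetract
    fun_prop
  · refine (norm_truncNonlin_sub_le hlam hc (growthBound_pos hM ℓ t) z w z' w').trans ?_
    exact mul_le_mul_of_nonneg_right (by rw [truncRate]; linarith) (by positivity)

theorem IsLipschitzNonlin.swap {L : ℝ → ℝ} {N : ℝ → ℂ → ℂ → ℂ} (hN : IsLipschitzNonlin L N) :
    IsLipschitzNonlin L fun t z w => N t w z :=
  ⟨hN.measurable.comp (measurable_fst.prodMk (measurable_snd.snd.prodMk measurable_snd.fst)),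
    fun t z w z' w' => (hN.lipschitz t w z w' z').trans_eq (by rw [add_comm]),
    hN.map_zero⟩

/-- The difference of two mild solutions with the same initial values is controlled by the integral
of the difference of the right-hand sides along characteristics. -/
theorem IsMildTransport.ae_enorm_sub_le {c : ℝ} {f₀ : ℝ → ℂ} {F G f g : ℝ × ℝ → ℂ}
    {r : ℝ × ℝ → ℝ≥0∞} (hf : IsMildTransport c f₀ F f) (hg : IsMildTransport c f₀ G g)
    (hF : LocallyIntegrable F) (hG : LocallyIntegrable G) (h : ∀ᵐ p, ‖F p - G p‖ₑ ≤ r p) :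
    ∀ᵐ p, ‖f p - g p‖ₑ ≤ charLInt c r p := by
  filter_upwards [hf, hg, ae_foot c (ae_locallyIntegrable_characteristic c hF),
    ae_foot c (ae_locallyIntegrable_characteristic c hG), ae_characteristic c h]
    with p h1 h2 h3 h4 h5
  have e : ∀ s, p.2 + c * p.1 - c * s = p.2 + c * (p.1 - s) := fun s => by ring
  simp only [e] at h3 h4
  rw [h1, h2, add_sub_add_left_eq_sub]
  have h6 := enorm_charInt_le c (fun q => F q - G q) p
  rw [charInt, intervalIntegral.integral_sub (h3.intervalIntegrable_real 0 p.1)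
    (h4.intervalIntegrable_real 0 p.1)] at h6
  exact h6.trans (charLInt_mono c h5)

/-- Uniqueness for the Thirring system with bounded initial values. -/
theorem IsMildThirring.ae_eq {lam₁ lam₂ κ₁ κ₂ M : ℝ} (hM : 0 < M) {u₀ w₀ : ℝ → ℂ}
    {u w u' w' : ℝ × ℝ → ℂ} (h : IsMildThirring lam₁ lam₂ κ₁ κ₂ u₀ w₀ u w)
    (h' : IsMildThirring lam₁ lam₂ κ₁ κ₂ u₀ w₀ u' w')
    (hu₀ : ∀ᵐ x, ‖u₀ x‖ ≤ M) (hw₀ : ∀ᵐ x, ‖w₀ x‖ ≤ M) :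
    u =ᵐ[volume] u' ∧ w =ᵐ[volume] w' := by
  wlog hmeas : (StronglyMeasurable u ∧ StronglyMeasurable w) ∧
    (StronglyMeasurable u' ∧ StronglyMeasurable w') generalizing u w u' w'
  · have a1 := (locallyIntegrable_of_memLp_slab h.memLp_left).aestronglyMeasurable
    have a2 := (locallyIntegrable_of_memLp_slab h.memLp_right).aestronglyMeasurable
    have a3 := (locallyIntegrable_of_memLp_slab h'.memLp_left).aestronglyMeasurable
    have a4 := (locallyIntegrable_of_memLp_slab h'.memLp_right).aestronglyMeasurable
    have := this (h.congr .rfl .rfl a1.ae_eq_mk a2.ae_eq_mk)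
      (h'.congr .rfl .rfl a3.ae_eq_mk a4.ae_eq_mk)
      ⟨⟨a1.stronglyMeasurable_mk, a2.stronglyMeasurable_mk⟩,
        a3.stronglyMeasurable_mk, a4.stronglyMeasurable_mk⟩
    exact ⟨a1.ae_eq_mk.trans (this.1.trans a3.ae_eq_mk.symm),
      a2.ae_eq_mk.trans (this.2.trans a4.ae_eq_mk.symm)⟩
  obtain ⟨⟨mu, mw⟩, mu', mw'⟩ := hmeas
  set ℓ := |lam₁| + |lam₂| with hℓ
  set C := |κ₁| + |κ₂| with hC
  have l1 : |lam₁| ≤ ℓ := le_add_of_nonneg_right (abs_nonneg _)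
  have l2 : |lam₂| ≤ ℓ := le_add_of_nonneg_left (abs_nonneg _)
  have c1 : |κ₁| ≤ C := le_add_of_nonneg_right (abs_nonneg _)
  have c2 : |κ₂| ≤ C := le_add_of_nonneg_left (abs_nonneg _)
  have hL := continuous_truncRate ℓ C M
  have hpos := truncRate_pos ((abs_nonneg _).trans l1) ((abs_nonneg _).trans c1) M
  have b := h.norm_le l1 l2 hM.le mu mw hu₀ hw₀
  have b' := h'.norm_le l1 l2 hM.le mu' mw' hu₀ hw₀
  -- on the a priori bound the nonlinearities agree with their truncations
  have d1 : ∀ᵐ p : ℝ × ℝ, ‖thirringNonlin lam₁ κ₁ (u p) (w p) -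
      thirringNonlin lam₁ κ₁ (u' p) (w' p)‖ₑ ≤ ENNReal.ofReal (truncRate ℓ C M p.1) *
        (‖u p - u' p‖ₑ + ‖w p - w' p‖ₑ) := by
    filter_upwards [b, b'] with p hp hp'
    rw [← truncNonlin_of_le _ _ (growthBound_pos hM ℓ p.1) hp.1 hp.2,
      ← truncNonlin_of_le _ _ (growthBound_pos hM ℓ p.1) hp'.1 hp'.2]
    exact (isLipschitzNonlin_trunc l1 c1 hM).enorm_sub_le hpos p.1 _ _ _ _
  have d2 : ∀ᵐ p : ℝ × ℝ, ‖thirringNonlin lam₂ κ₂ (w p) (u p) -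
      thirringNonlin lam₂ κ₂ (w' p) (u' p)‖ₑ ≤ ENNReal.ofReal (truncRate ℓ C M p.1) *
        (‖u p - u' p‖ₑ + ‖w p - w' p‖ₑ) := by
    filter_upwards [b, b'] with p hp hp'
    rw [← truncNonlin_of_le _ _ (growthBound_pos hM ℓ p.1) hp.2 hp.1,
      ← truncNonlin_of_le _ _ (growthBound_pos hM ℓ p.1) hp'.2 hp'.1]
    exact (isLipschitzNonlin_trunc l2 c2 hM).swap.enorm_sub_le hpos p.1 _ _ _ _
  have key := ae_eq_zero_of_le_charLInt hL hpos 1 (-1) (mu.sub mu').enorm (mw.sub mw').enorm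
    (h.left.ae_enorm_sub_le h'.left h.locallyIntegrable_left h'.locallyIntegrable_left d1)
    (h.right.ae_enorm_sub_le h'.right h.locallyIntegrable_right h'.locallyIntegrable_right d2)
    (fun T hT => ((h.memLp_left T hT).sub (h'.memLp_left T hT)).lintegral_sq_lt_top)
    (fun T hT => ((h.memLp_right T hT).sub (h'.memLp_right T hT)).lintegral_sq_lt_top)
  constructor
  · filter_upwards [key] with p hp
    exact sub_eq_zero.mp (enorm_eq_zero.mp hp.1)
  · filter_upwards [key] with p hp
    exact sub_eq_zero.mp (enorm_eq_zero.mp hp.2)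

/-! ### Existence in null coordinates -/

theorem lintegral_translate_snd (a : ℝ) (f : ℝ × ℝ → ℝ≥0∞) :
    ∫⁻ p : ℝ × ℝ, f (p.1, p.2 + a) = ∫⁻ p, f p := by
  have := lintegral_add_right_eq_self (μ := (volume : Measure (ℝ × ℝ))) f ((0, a) : ℝ × ℝ)
  simpa [Prod.add_def] using this

theorem ae_translate_snd (a : ℝ) {P : ℝ × ℝ → Prop} (h : ∀ᵐ p, P p) :
    ∀ᵐ p : ℝ × ℝ, P (p.1, p.2 + a) := by
  have := (measurePreserving_add_right (volume : Measure (ℝ × ℝ))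
    ((0, a) : ℝ × ℝ)).quasiMeasurePreserving.ae h
  simpa [Prod.add_def] using this

theorem lintegral_weightedVolume_translate_snd {L : ℝ → ℝ} (hL : Continuous L) (a : ℝ)
    {f : ℝ × ℝ → ℝ≥0∞} (hf : Measurable f) :
    ∫⁻ p : ℝ × ℝ, f (p.1, p.2 + a) ∂weightedVolume L = ∫⁻ p, f p ∂weightedVolume L := by
  rw [lintegral_weightedVolume hL hf, lintegral_weightedVolume hL (f := fun p => f (p.1, p.2 + a))
    (hf.comp (by fun_prop))]
  exact lintegral_translate_snd a fun p => ENNReal.ofReal (timeWeight L p.1) * f p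

theorem IsMildTransport.translate_snd {c : ℝ} {f₀ : ℝ → ℂ} {F f : ℝ × ℝ → ℂ}
    (h : IsMildTransport c f₀ F f) (a : ℝ) :
    IsMildTransport c (fun x => f₀ (x + a)) (fun p => F (p.1, p.2 + a))
      fun p => f (p.1, p.2 + a) := by
  filter_upwards [ae_translate_snd a h] with p hp
  rw [hp, charInt, charInt]
  simp only [add_right_comm]

theorem memLp_slab_of_lintegral_weightedVolume_lt_top {L : ℝ → ℝ} (hL : Continuous L)
    (hpos : ∀ t, 0 < L t) {u : ℝ × ℝ → ℂ} (mu : StronglyMeasurable u)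
    (hu : ∫⁻ p, ‖u p‖ₑ ^ 2 ∂weightedVolume L < ⊤) (T : ℝ) :
    MemLp u 2 (volume.restrict (slab T)) := by
  obtain ⟨C, h⟩ := exists_setLIntegral_slab_le hL hpos T
  exact memLp_two_of_lintegral_lt_top mu.aestronglyMeasurable
    ((h _ (mu.enorm.pow_const 2)).trans_lt (ENNReal.mul_lt_top ENNReal.ofReal_lt_top hu))

theorem memLp_slab_of_norm_le {L : ℝ → ℝ} (hL : Continuous L) {F u w : ℝ × ℝ → ℂ} {T : ℝ}
    (hF : AEStronglyMeasurable F) (hu : MemLp u 2 (volume.restrict (slab T)))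
    (hw : MemLp w 2 (volume.restrict (slab T)))
    (h : ∀ᵐ p, ‖F p‖ ≤ L p.1 * (‖u p‖ + ‖w p‖)) : MemLp F 2 (volume.restrict (slab T)) := by
  obtain ⟨K, hK⟩ := (isCompact_Icc (a := -T) (b := T)).exists_bound_of_continuousOn hL.continuousOn
  refine (hu.norm.add hw.norm).of_le_mul (c := K) hF.restrict ?_
  rw [ae_restrict_iff' (isOpen_slab T).measurableSet]
  filter_upwards [h] with p hp hT
  refine hp.trans ?_
  simp only [Pi.add_apply]
  rw [Real.norm_of_nonneg (by positivity)]
  gcongr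
  exact (le_abs_self _).trans (hK p.1 (Ioo_subset_Icc_self hT.1))

/-- Solutions of a semilinear system with weakly differentiable initial values have a square
integrable weak spatial derivative: the translates solve the same system, so that the difference
quotients are controlled by those of the initial values. -/
theorem exists_hasWeakDirDeriv_of_isMildTransport {L : ℝ → ℝ} (hL : Continuous L)
    (hpos : ∀ t, 0 < L t) (c c' : ℝ)
    {N N' : ℝ → ℂ → ℂ → ℂ} (hN : IsLipschitzNonlin L N) (hN' : IsLipschitzNonlin L N')
    {u₀ w₀ g₁ g₂ : ℝ → ℂ} (mu₀ : StronglyMeasurable u₀) (mw₀ : StronglyMeasurable w₀)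
    (hu₀ : MemLp u₀ 2) (hw₀ : MemLp w₀ 2) (hg₁ : MemLp g₁ 2) (hg₂ : MemLp g₂ 2)
    (h₁ : HasWeakDirDeriv univ u₀ 1 g₁) (h₂ : HasWeakDirDeriv univ w₀ 1 g₂)
    {u w : ℝ × ℝ → ℂ} (mu : StronglyMeasurable u) (mw : StronglyMeasurable w)
    (fu : ∫⁻ p, ‖u p‖ₑ ^ 2 ∂weightedVolume L < ⊤) (fw : ∫⁻ p, ‖w p‖ₑ ^ 2 ∂weightedVolume L < ⊤)
    (hu : IsMildTransport c u₀ (fun p => N p.1 (u p) (w p)) u)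
    (hw : IsMildTransport c' w₀ (fun p => N' p.1 (u p) (w p)) w) (T : ℝ) :
    (∃ g, MemLp g 2 (volume.restrict (slab T)) ∧ HasWeakDirDeriv (slab T) u (0, 1) g) ∧
      ∃ g, MemLp g 2 (volume.restrict (slab T)) ∧ HasWeakDirDeriv (slab T) w (0, 1) g := by
  have sm : ∀ {v : ℝ × ℝ → ℂ}, StronglyMeasurable v → ∀ a,
      StronglyMeasurable fun p : ℝ × ℝ => v (p.1, p.2 + a) := fun hv a =>
    hv.comp_measurable (by fun_prop)
  have sm₀ : ∀ {v : ℝ → ℂ}, StronglyMeasurable v → ∀ a,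
      StronglyMeasurable fun x : ℝ => v (x + a) := fun hv a =>
    hv.comp_measurable (by fun_prop)
  have ft : ∀ {v : ℝ × ℝ → ℂ}, StronglyMeasurable v → ∫⁻ p, ‖v p‖ₑ ^ 2 ∂weightedVolume L < ⊤ →
      ∀ a, ∫⁻ p : ℝ × ℝ, ‖v (p.1, p.2 + a)‖ₑ ^ 2 ∂weightedVolume L < ⊤ := fun hv hf a =>
    (lintegral_weightedVolume_translate_snd hL a (hv.enorm.pow_const 2)).trans_lt hf
  set D := 4 * (∫⁻ t, ENNReal.ofReal (timeWeight L t)) *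
    ((∫⁻ x, ‖g₁ x‖ₑ ^ 2) + ∫⁻ x, ‖g₂ x‖ₑ ^ 2) with hD
  have hDtop : D < ⊤ := ENNReal.mul_lt_top (ENNReal.mul_lt_top (by simp)
    (lintegral_timeWeight_lt_top hL hpos))
    (ENNReal.add_lt_top.mpr ⟨hg₁.lintegral_sq_lt_top, hg₂.lintegral_sq_lt_top⟩)
  have key : ∀ a : ℝ, (∫⁻ p : ℝ × ℝ, ‖u (p.1, p.2 + a) - u p‖ₑ ^ 2 ∂weightedVolume L) +
      ∫⁻ p : ℝ × ℝ, ‖w (p.1, p.2 + a) - w p‖ₑ ^ 2 ∂weightedVolume L ≤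
      ENNReal.ofReal (a ^ 2) * D := by
    intro a
    refine (lintegral_sq_sub_le_of_isMildTransport hL hpos c c' hN hN' (sm₀ mu₀ a) (sm₀ mw₀ a)
      mu₀ mw₀ (sm mu a) (sm mw a) mu mw (ft mu fu a) (ft mw fw a) fu fw
      (hu.translate_snd a) (hw.translate_snd a) hu hw).trans ?_
    calc _ ≤ 4 * (∫⁻ t, ENNReal.ofReal (timeWeight L t)) *
          (ENNReal.ofReal (a ^ 2) * (∫⁻ x, ‖g₁ x‖ₑ ^ 2) +
            ENNReal.ofReal (a ^ 2) * ∫⁻ x, ‖g₂ x‖ₑ ^ 2) := by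
          gcongr
          · exact h₁.lintegral_sq_translate_sub_le hu₀ hg₁ a
          · exact h₂.lintegral_sq_translate_sub_le hw₀ hg₂ a
      _ = _ := by rw [hD]; ring
  have concl : ∀ {v : ℝ × ℝ → ℂ}, StronglyMeasurable v →
      ∫⁻ p, ‖v p‖ₑ ^ 2 ∂weightedVolume L < ⊤ →
      (∀ a : ℝ, ∫⁻ p : ℝ × ℝ, ‖v (p.1, p.2 + a) - v p‖ₑ ^ 2 ∂weightedVolume L ≤
        ENNReal.ofReal (a ^ 2) * D) →
      ∃ g, MemLp g 2 (volume.restrict (slab T)) ∧ HasWeakDirDeriv (slab T) v (0, 1) g := by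
    intro v mv fv hv
    obtain ⟨K, hK⟩ := exists_setLIntegral_slab_le hL hpos T
    refine exists_hasWeakDirDeriv_of_difference_quotient mv (locallyIntegrable_of_memLp_slab
      fun T _ => memLp_slab_of_lintegral_weightedVolume_lt_top hL hpos mv fv T) T
      (K := ENNReal.ofReal K * D) (ENNReal.mul_lt_top ENNReal.ofReal_lt_top hDtop).ne fun a => ?_
    refine (hK _ (((sm mv a).sub mv).enorm.pow_const 2)).trans ?_
    calc _ ≤ ENNReal.ofReal K * (ENNReal.ofReal (a ^ 2) * D) := by
          gcongr
          exact hv a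
      _ = _ := by ring
  exact ⟨concl mu fu fun a => le_self_add.trans (key a),
    concl mw fw fun a => le_add_self.trans (key a)⟩

/-- A null derivative and the spatial derivative determine all directional derivatives. -/
theorem MemH1.of_null {c : ℝ} {T : ℝ} {f F : ℝ × ℝ → ℂ}
    (hf : MemLp f 2 (volume.restrict (slab T))) (hF : MemLp F 2 (volume.restrict (slab T)))
    (h : HasWeakDirDeriv (slab T) f (1, -c) F)
    (hx : ∃ g, MemLp g 2 (volume.restrict (slab T)) ∧ HasWeakDirDeriv (slab T) f (0, 1) g) :
    MemH1 (slab T) f := by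
  obtain ⟨g, hg, hfg⟩ := hx
  refine ⟨hf, fun v => ⟨fun p => v.1 • F p + (v.2 + c * v.1) • g p,
    (hF.const_smul v.1).add (hg.const_smul (v.2 + c * v.1)), ?_⟩⟩
  have e : v = v.1 • ((1, -c) : ℝ × ℝ) + (v.2 + c * v.1) • ((0, 1) : ℝ × ℝ) := by
    ext <;> simp
    ring
  have := h.smul_add_smul v.1 (v.2 + c * v.1) hf hF hg hfg
  rwa [← e] at this

/-- The Thirring system has a mild solution of class `H¹` on slabs: the truncated system has one,
and the a priori bound shows that the truncation is not active. -/
theorem exists_isMildThirring (lam₁ lam₂ κ₁ κ₂ : ℝ) {M : ℝ} (hM : 0 < M)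
    {u₀ w₀ g₁ g₂ : ℝ → ℂ} (mu₀ : StronglyMeasurable u₀) (mw₀ : StronglyMeasurable w₀)
    (hu₀ : MemLp u₀ 2) (hw₀ : MemLp w₀ 2) (hg₁ : MemLp g₁ 2) (hg₂ : MemLp g₂ 2)
    (h₁ : HasWeakDirDeriv univ u₀ 1 g₁) (h₂ : HasWeakDirDeriv univ w₀ 1 g₂)
    (bu₀ : ∀ᵐ x, ‖u₀ x‖ ≤ M) (bw₀ : ∀ᵐ x, ‖w₀ x‖ ≤ M) :
    ∃ u w : ℝ × ℝ → ℂ, IsMildThirring lam₁ lam₂ κ₁ κ₂ u₀ w₀ u w ∧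
      ∀ T, 0 < T → MemH1 (slab T) u ∧ MemH1 (slab T) w ∧
        MemLp (fun p => thirringNonlin lam₁ κ₁ (u p) (w p)) 2 (volume.restrict (slab T)) ∧
        MemLp (fun p => thirringNonlin lam₂ κ₂ (w p) (u p)) 2 (volume.restrict (slab T)) := by
  set ℓ := |lam₁| + |lam₂| with hℓ
  set C := |κ₁| + |κ₂| with hC
  have l1 : |lam₁| ≤ ℓ := le_add_of_nonneg_right (abs_nonneg _)
  have l2 : |lam₂| ≤ ℓ := le_add_of_nonneg_left (abs_nonneg _)
  have c1 : |κ₁| ≤ C := le_add_of_nonneg_right (abs_nonneg _)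
  have c2 : |κ₂| ≤ C := le_add_of_nonneg_left (abs_nonneg _)
  have hL := continuous_truncRate ℓ C M
  have hpos := truncRate_pos ((abs_nonneg _).trans l1) ((abs_nonneg _).trans c1) M
  have hN := isLipschitzNonlin_trunc l1 c1 hM
  have hN' := (isLipschitzNonlin_trunc l2 c2 hM).swap
  obtain ⟨u, w, mu, mw, fu, fw, hu, hw⟩ := exists_isMildTransport hL hpos 1 (-1) hN hN' mu₀ mw₀
    hu₀.lintegral_sq_lt_top hw₀.lintegral_sq_lt_top
  have Lu := memLp_slab_of_lintegral_weightedVolume_lt_top hL hpos mu fu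
  have Lw := memLp_slab_of_lintegral_weightedVolume_lt_top hL hpos mw fw
  have slabF : ∀ {N : ℝ → ℂ → ℂ → ℂ}, IsLipschitzNonlin (truncRate ℓ C M) N → ∀ T,
      MemLp (fun p : ℝ × ℝ => N p.1 (u p) (w p)) 2 (volume.restrict (slab T)) := by
    intro N hN T
    refine memLp_slab_of_norm_le hL (hN.stronglyMeasurable_comp mu mw).aestronglyMeasurable
      (Lu T) (Lw T) (ae_of_all _ fun p => ?_)
    simpa [hN.map_zero] using hN.lipschitz p.1 (u p) (w p) 0 0
  have F1 := slabF hN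
  have F2 := slabF hN'
  have I1 := locallyIntegrable_of_memLp_slab fun T _ => F1 T
  have I2 := locallyIntegrable_of_memLp_slab fun T _ => F2 T
  have hx := exists_hasWeakDirDeriv_of_isMildTransport hL hpos 1 (-1) hN hN' mu₀ mw₀ hu₀ hw₀
    hg₁ hg₂ h₁ h₂ mu mw fu fw hu hw
  have lu := locallyIntegrable_of_memLp_slab fun T _ => Lu T
  have lw := locallyIntegrable_of_memLp_slab fun T _ => Lw T
  have H1 := fun T => MemH1.of_null (Lu T) (F1 T)
    ((hu.hasWeakDirDeriv lu I1).mono_of_univ (slab T)) (hx T).1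
  have H2 := fun T => MemH1.of_null (Lw T) (F2 T)
    ((hw.hasWeakDirDeriv lw I2).mono_of_univ (slab T)) (hx T).2
  have b : ∀ᵐ p, ‖u p‖ ≤ growthBound M ℓ p.1 ∧ ‖w p‖ ≤ growthBound M ℓ p.1 := by
    have hu' := hu
    have hw' := hw
    have I1' := I1
    have I2' := I2
    simp only [truncNonlin_eq] at hu' hw' I1' I2'
    exact norm_le_growthBound l1 l2 hM.le mu mw hu' hw' I1' I2' lu lw
      (fun T _ => (Lu T).lintegral_sq_lt_top) (fun T _ => (Lw T).lintegral_sq_lt_top) bu₀ bw₀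
  have e1 : (fun p : ℝ × ℝ => truncNonlin lam₁ κ₁ (growthBound M ℓ p.1) (u p) (w p))
      =ᵐ[volume] fun p => thirringNonlin lam₁ κ₁ (u p) (w p) := by
    filter_upwards [b] with p hp
    exact truncNonlin_of_le _ _ (growthBound_pos hM ℓ p.1) hp.1 hp.2
  have e2 : (fun p : ℝ × ℝ => truncNonlin lam₂ κ₂ (growthBound M ℓ p.1) (w p) (u p))
      =ᵐ[volume] fun p => thirringNonlin lam₂ κ₂ (w p) (u p) := by
    filter_upwards [b] with p hp
    exact truncNonlin_of_le _ _ (growthBound_pos hM ℓ p.1) hp.2 hp.1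
  exact ⟨u, w, ⟨hu.congr .rfl e1 .rfl, hw.congr .rfl e2 .rfl, fun T _ => Lu T, fun T _ => Lw T,
    I1.congr e1, I2.congr e2⟩, fun T _ => ⟨H1 T, H2 T, (F1 T).ae_eq (ae_restrict_of_ae e1),
    (F2 T).ae_eq (ae_restrict_of_ae e2)⟩⟩

/-! ### Mild solutions as continuous curves in `L²` -/

theorem lintegral_sq_charInt_sub_le {c : ℝ} {F : ℝ × ℝ → ℂ} (mF : StronglyMeasurable F)
    (lF : LocallyIntegrable F) {T t t' : ℝ} (ht : t ∈ Ioo (-T) T) (ht' : t' ∈ Ioo (-T) T) :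
    ∫⁻ y, ‖(∫ s in (0 : ℝ)..t, F (s, y - c * s)) - ∫ s in (0 : ℝ)..t', F (s, y - c * s)‖ₑ ^ 2 ≤
      ENNReal.ofReal |t - t'| * ∫⁻ p in slab T, ‖F p‖ₑ ^ 2 := by
  have hT : MeasurableSet (slab T) := measurableSet_Ioo.prod MeasurableSet.univ
  have hsub : uIoc t' t ⊆ Ioo (-T) T := fun s hs => by
    rw [mem_uIoc] at hs
    rcases hs with hs | hs <;> constructor <;> linarith [ht.1, ht.2, ht'.1, ht'.2]
  set h : ℝ × ℝ → ℝ≥0∞ := (slab T).indicator fun p => ‖F p‖ₑ ^ 2 with hh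
  have mh : Measurable h := (mF.enorm.pow_const 2).indicator hT
  have pt : ∀ᵐ y : ℝ, ‖(∫ s in (0 : ℝ)..t, F (s, y - c * s)) -
      ∫ s in (0 : ℝ)..t', F (s, y - c * s)‖ₑ ^ 2 ≤
      ENNReal.ofReal |t - t'| * ∫⁻ s, h (s, y - c * s) := by
    filter_upwards [ae_locallyIntegrable_characteristic c lF] with y hy
    rw [intervalIntegral.integral_interval_sub_left (hy.intervalIntegrable_real _ _)
      (hy.intervalIntegrable_real _ _)]
    refine (pow_le_pow_left' (enorm_intervalIntegral_le _ _ _) 2).trans ?_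
    have m1 : Measurable fun s => ‖F (s, y - c * s)‖ₑ :=
      (mF.comp_measurable (by fun_prop : Measurable fun s : ℝ => (s, y - c * s))).enorm
    refine (sq_lintegral_uIoc_le m1 t' t).trans ?_
    refine mul_le_mul_right ?_ _
    rw [← lintegral_indicator measurableSet_uIoc]
    refine lintegral_mono fun s => ?_
    by_cases hs : s ∈ uIoc t' t
    · have : (s, y - c * s) ∈ slab T := ⟨hsub hs, mem_univ _⟩
      simp [hs, hh, this]
    · simp [hs]
  have m2 : Measurable fun p : ℝ × ℝ => h (p.1, p.2 - c * p.1) := mh.comp (by fun_prop)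
  refine (lintegral_mono_ae pt).trans ?_
  rw [lintegral_const_mul' _ _ ENNReal.ofReal_ne_top]
  gcongr
  rw [← lintegral_indicator hT, ← hh, ← lintegral_shear c (f := h) mh]
  have e := (measurePreserving_shear c).lintegral_comp m2
  have e2 := lintegral_prod_symm' (μ := (volume : Measure ℝ)) (ν := (volume : Measure ℝ))
    (fun p : ℝ × ℝ => h (p.1, p.2 - c * p.1)) m2
  rw [← e2, ← Measure.volume_eq_prod, ← e, lintegral_shear c mh]
  simp [shear_apply]

/-- A mild solution with square integrable right-hand side is, up to modification on a null set,
a continuous curve in `L²`. -/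
theorem IsMildTransport.exists_continuous_curve {c : ℝ} {f₀ : ℝ → ℂ} {F f : ℝ × ℝ → ℂ}
    (h : IsMildTransport c f₀ F f) (hf₀ : MemLp f₀ 2)
    (hF : ∀ T, 0 < T → MemLp F 2 (volume.restrict (slab T))) :
    ∃ v : ℝ → Lp ℂ 2 (volume : Measure ℝ), Continuous v ∧ (∀ᵐ t, ∀ᵐ x, v t x = f (t, x)) ∧
      ∀ᵐ x, v 0 x = f₀ x := by
  wlog mF : StronglyMeasurable F generalizing F
  · have a := (locallyIntegrable_of_memLp_slab hF).aestronglyMeasurable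
    exact this (h.congr .rfl a.ae_eq_mk .rfl)
      (fun T hT => (hF T hT).ae_eq (ae_restrict_of_ae a.ae_eq_mk)) a.stronglyMeasurable_mk
  have lF := locallyIntegrable_of_memLp_slab hF
  set G : ℝ → ℝ → ℂ := fun t y => ∫ s in (0 : ℝ)..t, F (s, y - c * s) with hG
  have mG : ∀ t, StronglyMeasurable (G t) := fun t => by
    have := (stronglyMeasurable_charInt c mF).comp_measurable
      (by fun_prop : Measurable fun y : ℝ => (t, y - c * t))
    simpa only [Function.comp_def, charInt_shear_symm] using this
  have hGL : ∀ t, MemLp (G t) 2 := fun t => by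
    refine memLp_two_of_lintegral_lt_top (mG t).aestronglyMeasurable ?_
    have h1 := abs_nonneg t
    have := lintegral_sq_charInt_sub_le (c := c) mF lF (T := |t| + 1) (t := t) (t' := 0)
      (abs_lt.mp (by linarith)) (by constructor <;> linarith)
    simp only [intervalIntegral.integral_same, sub_zero] at this
    exact this.trans_lt (ENNReal.mul_lt_top ENNReal.ofReal_lt_top
      (hF _ (by positivity)).lintegral_sq_lt_top)
  set U : ℝ → Lp ℂ 2 (volume : Measure ℝ) := fun t => (hf₀.add (hGL t)).toLp with hU
  have hUc : Continuous U := by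
    rw [continuous_iff_continuousAt]
    intro t₀
    have h1 := abs_nonneg t₀
    set K := ∫⁻ p in slab (|t₀| + 1), ‖F p‖ₑ ^ 2 with hK
    have hKt : K ≠ ⊤ := (hF _ (by positivity)).lintegral_sq_lt_top.ne
    have hb : ∀ᶠ t in 𝓝 t₀, dist (U t) (U t₀) ≤ √(|t - t₀| * K.toReal) := by
      have : Ioo (-(|t₀| + 1)) (|t₀| + 1) ∈ 𝓝 t₀ :=
        isOpen_Ioo.mem_nhds (abs_lt.mp (by linarith))
      filter_upwards [this] with t ht
      refine Real.le_sqrt_of_sq_le ?_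
      have h2 := lintegral_sq_charInt_sub_le (c := c) mF lF ht (abs_lt.mp (by linarith))
      rw [← eLpNorm_two_sq] at h2
      rw [hU, dist_edist, Lp.edist_toLp_toLp, add_sub_add_left_eq_sub, ← ENNReal.toReal_pow]
      refine (ENNReal.toReal_mono (ENNReal.mul_ne_top ENNReal.ofReal_ne_top hKt) h2).trans_eq ?_
      rw [ENNReal.toReal_mul, ENNReal.toReal_ofReal (abs_nonneg _)]
    rw [ContinuousAt, tendsto_iff_dist_tendsto_zero]
    have hc : Continuous fun t => √(|t - t₀| * K.toReal) := by fun_prop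
    refine squeeze_zero' (Eventually.of_forall fun _ => dist_nonneg) hb ?_
    have := hc.tendsto t₀
    simpa using this
  refine ⟨fun t => translateLp (c * t) (U t), Continuous.translateLp (by fun_prop) hUc, ?_, ?_⟩
  · have hs : ∀ᵐ t : ℝ, ∀ᵐ x : ℝ, f (t, x) = f₀ (x + c * t) + charInt c F (t, x) :=
      Measure.ae_ae_of_ae_prod (μ := (volume : Measure ℝ)) (ν := (volume : Measure ℝ)) h
    filter_upwards [hs] with t ht
    filter_upwards [ht, translateLp_ae_eq (c * t) (U t), (measurePreserving_add_left volume
      (c * t)).quasiMeasurePreserving.ae (hf₀.add (hGL t)).coeFn_toLp] with x h1 h2 h3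
    rw [h2, h1, hU, h3, Pi.add_apply, hG]
    simp only
    rw [← charInt_shear_symm, add_sub_cancel_left, add_comm x]
  · filter_upwards [translateLp_ae_eq (c * 0) (U 0), (hf₀.add (hGL 0)).coeFn_toLp] with x h1 h2
    rw [h1, mul_zero, zero_add, hU, h2]
    simp [hG]

/-! ### Null frames of the spinor bundle -/

/-- A basis `b₀, b₁` of spinors consisting of eigenvectors of the multiplication by
`σ e₀ · e₁`, for the eigenvalues `1` and `-1`, which `e₀` and `e₁` exchange up to a sign. Both
vectors are isotropic, and `⟨b₀, b₁⟩ = a` is real. -/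
structure SpinorStructure.IsNullBasis (S : SpinorStructure)
    (b : Module.Basis (Fin 2) ℂ Spinor) (a : ℝ) : Prop where
  time_zero : S.cliff (1, 0) (b 0) = b 1
  time_one : S.cliff (1, 0) (b 1) = (S.sign : ℂ) • b 0
  space_zero : S.cliff (0, 1) (b 0) = b 1
  space_one : S.cliff (0, 1) (b 1) = -((S.sign : ℂ) • b 0)
  form_zero : S.form (b 0) (b 0) = 0
  form_one : S.form (b 1) (b 1) = 0
  form_zero_one : S.form (b 0) (b 1) = a
  form_one_zero : S.form (b 1) (b 0) = a

theorem SpinorStructure.sign_sq (S : SpinorStructure) : (S.sign : ℂ) * S.sign = 1 := by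
  rcases S.sign_eq with h | h <;> simp [h]

theorem SpinorStructure.sign_ne_zero (S : SpinorStructure) : (S.sign : ℂ) ≠ 0 := by
  rcases S.sign_eq with h | h <;> simp [h]

theorem SpinorStructure.cliff_time_time (S : SpinorStructure) (ψ : Spinor) :
    S.cliff (1, 0) (S.cliff (1, 0) ψ) = (S.sign : ℂ) • ψ := by
  have h := S.clifford (1, 0) (1, 0) ψ
  rw [← two_smul ℂ] at h
  have h2 : (2 : ℂ) • S.cliff (1, 0) (S.cliff (1, 0) ψ) = (2 : ℂ) • ((S.sign : ℂ) • ψ) := by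
    rw [h, smul_smul, ← Complex.coe_smul]
    congr 1
    simp [minkowskiMetric]
  exact smul_right_injective _ two_ne_zero h2

theorem SpinorStructure.cliff_space_space (S : SpinorStructure) (ψ : Spinor) :
    S.cliff (0, 1) (S.cliff (0, 1) ψ) = -((S.sign : ℂ) • ψ) := by
  have h := S.clifford (0, 1) (0, 1) ψ
  rw [← two_smul ℂ] at h
  have h2 : (2 : ℂ) • S.cliff (0, 1) (S.cliff (0, 1) ψ) = (2 : ℂ) • (-((S.sign : ℂ) • ψ)) := by
    rw [h, ← neg_smul, smul_smul, ← Complex.coe_smul]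
    congr 1
    simp [minkowskiMetric]
  exact smul_right_injective _ two_ne_zero h2

theorem SpinorStructure.cliff_space_time (S : SpinorStructure) (ψ : Spinor) :
    S.cliff (0, 1) (S.cliff (1, 0) ψ) = -S.cliff (1, 0) (S.cliff (0, 1) ψ) := by
  have h := S.clifford (0, 1) (1, 0) ψ
  simp only [minkowskiMetric, mul_zero, sub_zero, mul_one, zero_smul] at h
  simpa [eq_neg_iff_add_eq_zero] using h

/-- The multiplication by `σ e₀ · e₁` has the eigenvalue `1`: otherwise `e₀` and `e₁` would act in
the same way, although their squares differ. -/
theorem SpinorStructure.exists_eigenvector (S : SpinorStructure) :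
    ∃ v : Spinor, v ≠ 0 ∧ S.cliff (0, 1) v = S.cliff (1, 0) v := by
  by_contra! hcon
  -- if nonzero, `e₀ · (e₀ + e₁) · ψ` is such a spinor
  have h : ∀ ψ : Spinor, S.cliff (1, 0) ψ + S.cliff (0, 1) ψ = 0 := by
    intro ψ
    by_contra hne
    refine hcon (S.cliff (1, 0) (S.cliff (1, 0) ψ + S.cliff (0, 1) ψ)) (fun h0 => hne ?_) ?_
    · have := congrArg (S.cliff (1, 0)) h0
      rw [S.cliff_time_time, map_zero] at this
      exact (smul_eq_zero.mp this).resolve_left S.sign_ne_zero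
    · simp only [map_add, S.cliff_time_time, S.cliff_space_time, S.cliff_space_space, map_neg,
        map_smul]
      abel
  obtain ⟨ψ, hψ⟩ := exists_ne (0 : Spinor)
  have h1 := S.cliff_space_space ψ
  rw [← neg_eq_of_add_eq_zero_right (h ψ), map_neg,
    ← neg_eq_of_add_eq_zero_right (h (S.cliff (1, 0) ψ)), neg_neg, S.cliff_time_time,
    eq_neg_iff_add_eq_zero, ← two_smul ℂ] at h1
  exact hψ ((smul_eq_zero.mp ((smul_eq_zero.mp h1).resolve_left two_ne_zero)).resolve_left
    S.sign_ne_zero)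

theorem SpinorStructure.exists_isNullBasis (S : SpinorStructure) :
    ∃ (b : Module.Basis (Fin 2) ℂ Spinor) (a : ℝ), S.IsNullBasis b a := by
  obtain ⟨v, hv, hBA⟩ := S.exists_eigenvector
  set w := S.cliff (1, 0) v with hw
  have hAw : S.cliff (1, 0) w = (S.sign : ℂ) • v := S.cliff_time_time v
  have hBw : S.cliff (0, 1) w = -((S.sign : ℂ) • v) := by rw [← hBA, S.cliff_space_space]
  have hw0 : w ≠ 0 := fun h => by
    rw [h, map_zero] at hAw
    exact hv ((smul_eq_zero.mp hAw.symm).resolve_left S.sign_ne_zero)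
  have li : LinearIndependent ℂ ![v, w] := by
    rw [LinearIndependent.pair_iff]
    intro s t hst
    -- the difference of the two multiplications annihilates `v` but not `w`
    have h1 := congrArg (S.cliff (1, 0)) hst
    have h2 := congrArg (S.cliff (0, 1)) hst
    simp only [map_add, map_smul, map_zero, ← hw, hBA, hAw, hBw] at h1 h2
    have h3 := congrArg₂ (· - ·) h1 h2
    simp only [smul_neg, sub_zero] at h3
    have h4 : (2 * t * S.sign) • v = 0 := by
      rw [← h3]
      module
    have ht : t = 0 := by
      have := (smul_eq_zero.mp h4).resolve_right hv
      simpa [S.sign_ne_zero, Complex.ofReal_eq_zero] using this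
    rw [ht, zero_smul, add_zero] at hst
    exact ⟨(smul_eq_zero.mp hst).resolve_right hv, ht⟩
  set b := basisOfLinearIndependentOfCardEqFinrank li (by simp) with hb
  have b0 : b 0 = v := by simp [hb]
  have b1 : b 1 = w := by simp [hb]
  have f1 : S.form w w = S.sign * S.form v v := by
    conv_lhs => rw [hw, S.cliff_symm, ← hw, hAw]
    simp [-Complex.coe_smul]
  have f2 : S.form w w = -(S.sign * S.form v v) := by
    conv_lhs => rw [← hBA, S.cliff_symm, hBA, hBw]
    simp [-Complex.coe_smul]
  have f3 : S.form w w = 0 := by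
    rw [← f1] at f2
    exact self_eq_neg.mp f2
  have f4 : S.form v v = 0 := by
    rw [f1] at f3
    exact (mul_eq_zero.mp f3).resolve_left S.sign_ne_zero
  have f5 : S.form w v = S.form v w := by
    rw [hw, S.cliff_symm]
  have f6 : ((S.form v w).re : ℂ) = S.form v w := by
    rw [← Complex.conj_eq_iff_re, S.form_conj, f5]
  refine ⟨b, (S.form v w).re, ?_, ?_, ?_, ?_, ?_, ?_, ?_, ?_⟩ <;> simp only [b0, b1]
  · rfl
  · exact hAw
  · exact hBA
  · exact hBw
  · exact f4
  · exact f3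
  · exact f6.symm
  · exact f5.trans f6.symm

section NullBasis

variable {S : SpinorStructure} {b : Module.Basis (Fin 2) ℂ Spinor} {a : ℝ}

theorem SpinorStructure.IsNullBasis.cliff_time (h : S.IsNullBasis b a) (u w : ℂ) :
    S.cliff (1, 0) (u • b 0 + w • b 1) = u • b 1 + (S.sign * w) • b 0 := by
  rw [map_add, map_smul, map_smul, h.time_zero, h.time_one]
  module

theorem SpinorStructure.IsNullBasis.cliff_space (h : S.IsNullBasis b a) (u w : ℂ) :
    S.cliff (0, 1) (u • b 0 + w • b 1) = u • b 1 - (S.sign * w) • b 0 := by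
  rw [map_add, map_smul, map_smul, h.space_zero, h.space_one]
  module

theorem SpinorStructure.IsNullBasis.form_time (h : S.IsNullBasis b a) (u w : ℂ) :
    S.form (u • b 0 + w • b 1) (u • b 1 + (S.sign * w) • b 0) =
      a * (‖u‖ ^ 2 + S.sign * ‖w‖ ^ 2) := by
  simp only [map_add, LinearMap.add_apply, map_smul, LinearMap.smul_apply, map_smulₛₗ,
    smul_eq_mul, h.form_zero, h.form_one, h.form_zero_one, h.form_one_zero, map_mul,
    Complex.conj_ofReal]
  rw [← Complex.mul_conj', ← Complex.mul_conj']
  ring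

theorem SpinorStructure.IsNullBasis.form_space (h : S.IsNullBasis b a) (u w : ℂ) :
    S.form (u • b 0 + w • b 1) (u • b 1 - (S.sign * w) • b 0) =
      a * (‖u‖ ^ 2 - S.sign * ‖w‖ ^ 2) := by
  simp only [map_add, map_sub, LinearMap.add_apply, map_smul, LinearMap.smul_apply, map_smulₛₗ,
    smul_eq_mul, h.form_zero, h.form_one, h.form_zero_one, h.form_one_zero, map_mul,
    Complex.conj_ofReal]
  rw [← Complex.mul_conj', ← Complex.mul_conj']
  ring

/-- In a null basis the two equations exchange the components: the coefficient of `b₁` on the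
right-hand side drives `u`, that of `b₀` drives `w`. -/
theorem SpinorStructure.IsNullBasis.thirringRhs_eq (h : S.IsNullBasis b a) (lam κ : ℝ) (u w : ℂ) :
    S.thirringRhs lam κ (u • b 0 + w • b 1) =
      (Complex.I * thirringNonlin lam (2 * κ * a * S.sign) u w) • b 1 +
      (Complex.I * S.sign * thirringNonlin (S.sign * lam) (2 * κ * a) w u) • b 0 := by
  have hs := S.sign_sq
  have e1 : Complex.I * thirringNonlin lam (2 * κ * a * S.sign) u w =
      lam * w + 2 * κ * a * S.sign * ‖w‖ ^ 2 * u := by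
    rw [thirringNonlin]
    push_cast
    linear_combination (-(lam * w + 2 * κ * a * S.sign * ‖w‖ ^ 2 * u)) * Complex.I_mul_I
  have e2 : Complex.I * S.sign * thirringNonlin (S.sign * lam) (2 * κ * a) w u =
      lam * u + 2 * κ * a * S.sign * ‖u‖ ^ 2 * w := by
    rw [thirringNonlin]
    push_cast
    linear_combination (-(S.sign * (S.sign * lam * u + 2 * κ * a * ‖u‖ ^ 2 * w))) *
      Complex.I_mul_I + lam * u * hs
  rw [e1, e2, thirringRhs, Fin.sum_univ_two]
  simp only [frameSign, frame, minkowskiMetric, Matrix.cons_val_zero, Matrix.cons_val_one,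
    mul_one, mul_zero, sub_zero, zero_sub, one_smul, neg_smul, h.cliff_time, h.cliff_space,
    h.form_time, h.form_space, ← Complex.coe_smul]
  module

end NullBasis

/-! ### Passing to components -/

theorem MeasureTheory.LocallyIntegrable.clm_comp {X F G : Type*} [MeasurableSpace X]
    [TopologicalSpace X] {μ : Measure X} [NormedAddCommGroup F] [NormedSpace ℝ F]
    [NormedAddCommGroup G] [NormedSpace ℝ G] (L : F →L[ℝ] G) {f : X → F}
    (hf : LocallyIntegrable f μ) : LocallyIntegrable (fun x => L (f x)) μ := fun x =>
  let ⟨s, hs, h⟩ := hf x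
  ⟨s, hs, L.integrable_comp h⟩

theorem HasWeakDirDeriv.congr {E F : Type*} [NormedAddCommGroup E] [NormedSpace ℝ E]
    [MeasureSpace E] [NormedAddCommGroup F] [NormedSpace ℝ F] {Ω : Set E} {f f' g : E → F} {v : E}
    (h : HasWeakDirDeriv Ω f v g)
    (hf : f =ᵐ[volume] f') : HasWeakDirDeriv Ω f' v g := by
  intro φ hφ
  rw [← h φ hφ]
  refine integral_congr_ae (ae_restrict_of_ae ?_)
  filter_upwards [hf] with p hp
  rw [hp]

section Components

variable {E F G : Type*} [NormedAddCommGroup E] [NormedSpace ℝ E] [MeasureSpace E] [BorelSpace E]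
  [IsLocallyFiniteMeasure (volume : Measure E)]
  [NormedAddCommGroup F] [NormedSpace ℝ F] [NormedAddCommGroup G] [NormedSpace ℝ G]

theorem IsTestFunction.integrable_fderiv_smul {Ω Ω' : Set E} {φ : E → ℝ}
    (hφ : IsTestFunction Ω' φ) (v : E) {f : E → F} (hf : MemLp f 2 (volume.restrict Ω)) :
    Integrable (fun p => fderiv ℝ φ p v • f p) (volume.restrict Ω) :=
  (hf.locallyIntegrable (by norm_num)).integrable_smul_left_of_hasCompactSupport
    ((hφ.1.continuous_fderiv (by simp)).clm_apply continuous_const) (hφ.2.1.fderiv_apply ℝ v)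

theorem IsTestFunction.integrable_smul {Ω Ω' : Set E} {φ : E → ℝ}
    (hφ : IsTestFunction Ω' φ) {f : E → F} (hf : MemLp f 2 (volume.restrict Ω)) :
    Integrable (fun p => φ p • f p) (volume.restrict Ω) :=
  (hf.locallyIntegrable (by norm_num)).integrable_smul_left_of_hasCompactSupport
    hφ.1.continuous hφ.2.1

theorem MemH1.clm_comp [CompleteSpace F] [CompleteSpace G] (L : F →L[ℝ] G) {Ω : Set E} {f : E → F}
    (h : MemH1 Ω f) : MemH1 Ω fun p => L (f p) := by
  refine ⟨L.comp_memLp' h.1, fun v => ?_⟩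
  obtain ⟨g, hg, hfg⟩ := h.2 v
  refine ⟨fun p => L (g p), L.comp_memLp' hg, fun φ hφ => ?_⟩
  simp only [← map_smul]
  rw [L.integral_comp_comm (hφ.integrable_fderiv_smul v h.1),
    L.integral_comp_comm (hφ.integrable_smul hg), hfg φ hφ, map_neg]

theorem MemH1.add {Ω : Set E} {f g : E → F} (hf : MemH1 Ω f) (hg : MemH1 Ω g) :
    MemH1 Ω fun p => f p + g p := by
  refine ⟨hf.1.add hg.1, fun v => ?_⟩
  obtain ⟨f', hf', hff⟩ := hf.2 v
  obtain ⟨g', hg', hgg⟩ := hg.2 v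
  refine ⟨fun p => f' p + g' p, hf'.add hg', fun φ hφ => ?_⟩
  simp only [smul_add]
  rw [integral_add (hφ.integrable_fderiv_smul v hf.1) (hφ.integrable_fderiv_smul v hg.1),
    integral_add (hφ.integrable_smul hf') (hφ.integrable_smul hg'), hff φ hφ, hgg φ hφ, neg_add]

end Components

section NullBasis

variable {S : SpinorStructure} {b : Module.Basis (Fin 2) ℂ Spinor} {a : ℝ}

/-- The coordinate with respect to a basis of spinors, as a continuous linear map. -/
noncomputable def spinorCoord (b : Module.Basis (Fin 2) ℂ Spinor) (i : Fin 2) : Spinor →L[ℝ] ℂ :=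
  (LinearMap.toContinuousLinearMap (b.coord i)).restrictScalars ℝ

/-- The inclusion of a coordinate line, as a continuous linear map. -/
noncomputable def spinorLine (b : Module.Basis (Fin 2) ℂ Spinor) (i : Fin 2) : ℂ →L[ℝ] Spinor :=
  (ContinuousLinearMap.toSpanSingleton ℂ (b i)).restrictScalars ℝ

theorem spinorLine_apply (b : Module.Basis (Fin 2) ℂ Spinor) (i : Fin 2) (z : ℂ) :
    spinorLine b i z = z • b i := rfl

theorem spinorCoord_add (b : Module.Basis (Fin 2) ℂ Spinor) (ψ : Spinor) :
    spinorCoord b 0 ψ • b 0 + spinorCoord b 1 ψ • b 1 = ψ := by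
  have := b.sum_repr ψ
  rwa [Fin.sum_univ_two] at this

theorem spinorCoord_zero (b : Module.Basis (Fin 2) ℂ Spinor) (u w : ℂ) :
    spinorCoord b 0 (u • b 0 + w • b 1) = u := by
  change b.coord 0 (u • b 0 + w • b 1) = u
  simp

theorem spinorCoord_one (b : Module.Basis (Fin 2) ℂ Spinor) (u w : ℂ) :
    spinorCoord b 1 (u • b 0 + w • b 1) = w := by
  change b.coord 1 (u • b 0 + w • b 1) = w
  simp

/-- The weak Thirring equation for a spinor field amounts to transport equations for its
components in a null basis. -/
theorem SpinorStructure.IsNullBasis.weak_iff (h : S.IsNullBasis b a) (lam κ : ℝ)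
    {u w : ℝ × ℝ → ℂ} (hu : LocallyIntegrable u) (hw : LocallyIntegrable w)
    (hN : LocallyIntegrable fun p => thirringNonlin lam (2 * κ * a * S.sign) (u p) (w p))
    (hN' : LocallyIntegrable fun p => thirringNonlin (S.sign * lam) (2 * κ * a) (w p) (u p)) :
    (∀ φ : ℝ × ℝ → ℝ, IsTestFunction univ φ →
      -∫ p, Complex.I • ∑ j : Fin 2, frameSign j •
          (fderiv ℝ φ p (frame j) • S.cliff (frame j) (u p • b 0 + w p • b 1)) =
        ∫ p, φ p • S.thirringRhs lam κ (u p • b 0 + w p • b 1)) ↔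
    HasWeakDirDeriv univ u (1, -1)
        (fun p => thirringNonlin lam (2 * κ * a * S.sign) (u p) (w p)) ∧
      HasWeakDirDeriv univ w (1, 1)
        (fun p => thirringNonlin (S.sign * lam) (2 * κ * a) (w p) (u p)) := by
  have hI := Complex.I_ne_zero
  have hs := S.sign_ne_zero
  have split : ∀ {X Y : ℝ × ℝ → ℂ}, Integrable X → Integrable Y →
      ∫ p, ((Complex.I * X p) • b 1 + (Complex.I * S.sign * Y p) • b 0) =
      (Complex.I * S.sign * ∫ p, Y p) • b 0 + (Complex.I * ∫ p, X p) • b 1 := by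
    intro X Y hX hY
    rw [integral_add ((hX.const_mul _).smul_const _) ((hY.const_mul _).smul_const _),
      integral_smul_const, integral_smul_const, integral_const_mul, integral_const_mul, add_comm]
  have key : ∀ φ : ℝ × ℝ → ℝ, IsTestFunction univ φ →
      (-∫ p, Complex.I • ∑ j : Fin 2, frameSign j •
          (fderiv ℝ φ p (frame j) • S.cliff (frame j) (u p • b 0 + w p • b 1)) =
        ∫ p, φ p • S.thirringRhs lam κ (u p • b 0 + w p • b 1) ↔
      (∫ p, fderiv ℝ φ p (1, -1) • u p =
        -∫ p, φ p • thirringNonlin lam (2 * κ * a * S.sign) (u p) (w p)) ∧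
      ∫ p, fderiv ℝ φ p (1, 1) • w p =
        -∫ p, φ p • thirringNonlin (S.sign * lam) (2 * κ * a) (w p) (u p)) := by
    intro φ hφ
    have i1 := hu.integrable_smul_left_of_hasCompactSupport (hφ.continuous_fderiv_apply (1, -1))
      (hφ.hasCompactSupport_fderiv_apply (1, -1))
    have i2 := hw.integrable_smul_left_of_hasCompactSupport (hφ.continuous_fderiv_apply (1, 1))
      (hφ.hasCompactSupport_fderiv_apply (1, 1))
    have i3 := hN.integrable_smul_left_of_hasCompactSupport hφ.1.continuous hφ.2.1
    have i4 := hN'.integrable_smul_left_of_hasCompactSupport hφ.1.continuous hφ.2.1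
    have e1 : ∀ p, Complex.I • ∑ j : Fin 2, frameSign j •
        (fderiv ℝ φ p (frame j) • S.cliff (frame j) (u p • b 0 + w p • b 1)) =
        (Complex.I * (fderiv ℝ φ p (1, -1) • u p)) • b 1 +
          (Complex.I * S.sign * (fderiv ℝ φ p (1, 1) • w p)) • b 0 := by
      intro p
      have d1 : fderiv ℝ φ p (1, -1) = fderiv ℝ φ p (1, 0) - fderiv ℝ φ p (0, 1) := by
        rw [← map_sub]; simp
      have d2 : fderiv ℝ φ p (1, 1) = fderiv ℝ φ p (1, 0) + fderiv ℝ φ p (0, 1) := by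
        rw [← map_add]; simp
      rw [Fin.sum_univ_two, d1, d2]
      simp only [frameSign, frame, minkowskiMetric, Matrix.cons_val_zero, Matrix.cons_val_one,
        mul_one, mul_zero, sub_zero, zero_sub, one_smul, neg_smul, h.cliff_time, h.cliff_space,
        ← Complex.coe_smul, smul_eq_mul, Complex.ofReal_sub, Complex.ofReal_add]
      module
    have e2 : ∀ p, φ p • S.thirringRhs lam κ (u p • b 0 + w p • b 1) =
        (Complex.I * (φ p • thirringNonlin lam (2 * κ * a * S.sign) (u p) (w p))) • b 1 +
          (Complex.I * S.sign *
            (φ p • thirringNonlin (S.sign * lam) (2 * κ * a) (w p) (u p))) • b 0 := by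
      intro p
      rw [h.thirringRhs_eq]
      simp only [← Complex.coe_smul, smul_eq_mul]
      module
    simp only [e1, e2]
    rw [split i1 i2, split i3 i4]
    constructor
    · intro heq
      have c0 := congrArg (spinorCoord b 0) heq
      have c1 := congrArg (spinorCoord b 1) heq
      simp only [map_neg, spinorCoord_zero, spinorCoord_one] at c0 c1
      rw [← mul_neg] at c0 c1
      exact ⟨neg_eq_iff_eq_neg.mp (mul_left_cancel₀ hI c1),
        neg_eq_iff_eq_neg.mp (mul_left_cancel₀ (mul_ne_zero hI hs) c0)⟩
    · rintro ⟨c1, c0⟩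
      rw [c1, c0]
      module
  simp only [HasWeakDirDeriv, setIntegral_univ]
  exact ⟨fun H => ⟨fun φ hφ => ((key φ hφ).mp (H φ hφ)).1, fun φ hφ => ((key φ hφ).mp (H φ hφ)).2⟩,
    fun H φ hφ => (key φ hφ).mpr ⟨H.1 φ hφ, H.2 φ hφ⟩⟩

/-- The components of a global solution form a mild solution of the Thirring system. -/
theorem IsGlobalThirringSolution.isMildThirring (h : S.IsNullBasis b a) {lam κ : ℝ}
    {ψ₀ : ℝ → Spinor} {ξ : ℝ × ℝ → Spinor} (hξ : IsGlobalThirringSolution S lam κ ψ₀ ξ) :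
    IsMildThirring lam (S.sign * lam) (2 * κ * a * S.sign) (2 * κ * a)
      (fun x => spinorCoord b 0 (ψ₀ x)) (fun x => spinorCoord b 1 (ψ₀ x))
      (fun p => spinorCoord b 0 (ξ p)) (fun p => spinorCoord b 1 (ξ p)) := by
  obtain ⟨hH, ⟨lξ, lR, hweak⟩, V, hV, hVξ, hV0⟩ := hξ
  set u := fun p => spinorCoord b 0 (ξ p) with hu
  set w := fun p => spinorCoord b 1 (ξ p) with hw
  have hξe : ∀ p, ξ p = u p • b 0 + w p • b 1 := fun p => (spinorCoord_add b (ξ p)).symm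
  simp only [hξe] at hweak lR
  have lu : LocallyIntegrable u := lξ.clm_comp _
  have lw : LocallyIntegrable w := lξ.clm_comp _
  have l1 : LocallyIntegrable fun p => thirringNonlin lam (2 * κ * a * S.sign) (u p) (w p) := by
    have := (lR.clm_comp (spinorCoord b 1)).smul (-Complex.I)
    refine this.congr (ae_of_all _ fun p => ?_)
    simp only [Pi.smul_apply]
    rw [h.thirringRhs_eq, add_comm, spinorCoord_one, smul_eq_mul]
    linear_combination (-thirringNonlin lam (2 * κ * a * S.sign) (u p) (w p)) * Complex.I_mul_I
  have l2 : LocallyIntegrable fun p => thirringNonlin (S.sign * lam) (2 * κ * a) (w p) (u p) := by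
    have := (lR.clm_comp (spinorCoord b 0)).smul (-Complex.I * S.sign)
    refine this.congr (ae_of_all _ fun p => ?_)
    simp only [Pi.smul_apply]
    rw [h.thirringRhs_eq, add_comm, spinorCoord_zero, smul_eq_mul]
    linear_combination (-(S.sign * S.sign *
      thirringNonlin (S.sign * lam) (2 * κ * a) (w p) (u p))) * Complex.I_mul_I +
      thirringNonlin (S.sign * lam) (2 * κ * a) (w p) (u p) * S.sign_sq
  obtain ⟨d1, d2⟩ := (h.weak_iff lam κ lu lw l1 l2).mp hweak
  have curve : ∀ i, (Continuous fun t => (spinorCoord b i).compLpL 2 volume (V t)) ∧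
      (∀ᵐ t, ∀ᵐ x, (spinorCoord b i).compLpL 2 volume (V t) x = spinorCoord b i (ξ (t, x))) ∧
      ((spinorCoord b i).compLpL 2 volume (V 0) =ᵐ[volume] fun x => spinorCoord b i (ψ₀ x)) := by
    intro i
    refine ⟨((spinorCoord b i).compLpL 2 volume).continuous.comp hV, ?_, ?_⟩
    · filter_upwards [hVξ] with t ht
      filter_upwards [ht, (spinorCoord b i).coeFn_compLpL (V t)] with x h1 h2
      rw [h2, h1]
    · filter_upwards [hV0, (spinorCoord b i).coeFn_compLpL (V 0)] with x h1 h2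
      rw [h2, h1]
  have m1 := IsMildTransport.of_hasWeakDirDeriv (c := 1) d1 lu l1 (curve 0).1 (curve 0).2.1
  have m2 := IsMildTransport.of_hasWeakDirDeriv (c := -1) (by rwa [neg_neg]) lw l2
    (curve 1).1 (curve 1).2.1
  exact ⟨m1.congr (curve 0).2.2 .rfl .rfl, m2.congr (curve 1).2.2 .rfl .rfl,
    fun T hT => (spinorCoord b 0).comp_memLp' (hH T hT).1,
    fun T hT => (spinorCoord b 1).comp_memLp' (hH T hT).1, l1, l2⟩

theorem hasInitialValue_of_components {ψ₀ : ℝ → Spinor} {u₀ w₀ : ℝ → ℂ} {u w : ℝ × ℝ → ℂ}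
    (hψ₀ : ∀ᵐ x, u₀ x • b 0 + w₀ x • b 1 = ψ₀ x) {v z : ℝ → Lp ℂ 2 (volume : Measure ℝ)}
    (hv : Continuous v) (hz : Continuous z) (hvu : ∀ᵐ t, ∀ᵐ x, v t x = u (t, x))
    (hzw : ∀ᵐ t, ∀ᵐ x, z t x = w (t, x)) (hv0 : ∀ᵐ x, v 0 x = u₀ x) (hz0 : ∀ᵐ x, z 0 x = w₀ x) :
    HasInitialValue (fun p => u p • b 0 + w p • b 1) ψ₀ := by
  refine ⟨fun t => (spinorLine b 0).compLpL 2 volume (v t) +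
      (spinorLine b 1).compLpL 2 volume (z t),
    (((spinorLine b 0).compLpL 2 volume).continuous.comp hv).add
      (((spinorLine b 1).compLpL 2 volume).continuous.comp hz), ?_, ?_⟩
  · filter_upwards [hvu, hzw] with t h1 h2
    filter_upwards [h1, h2, (spinorLine b 0).coeFn_compLpL (v t),
      (spinorLine b 1).coeFn_compLpL (z t), Lp.coeFn_add ((spinorLine b 0).compLpL 2 volume (v t))
        ((spinorLine b 1).compLpL 2 volume (z t))] with x k1 k2 k3 k4 k5
    rw [k5, Pi.add_apply, k3, k4, k1, k2, spinorLine_apply, spinorLine_apply]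
  · filter_upwards [hψ₀, hv0, hz0, (spinorLine b 0).coeFn_compLpL (v 0),
      (spinorLine b 1).coeFn_compLpL (z 0), Lp.coeFn_add ((spinorLine b 0).compLpL 2 volume (v 0))
        ((spinorLine b 1).compLpL 2 volume (z 0))] with x k0 k1 k2 k3 k4 k5
    rw [k5, Pi.add_apply, k3, k4, k1, k2, spinorLine_apply, spinorLine_apply, k0]

/-- A mild solution of the Thirring system of class `H¹` on slabs yields a global solution. -/
theorem IsMildThirring.isGlobalThirringSolution (h : S.IsNullBasis b a) {lam κ : ℝ}
    {ψ₀ : ℝ → Spinor} {u₀ w₀ : ℝ → ℂ} {u w : ℝ × ℝ → ℂ}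
    (hψ₀ : ∀ᵐ x, u₀ x • b 0 + w₀ x • b 1 = ψ₀ x) (hu₀ : MemLp u₀ 2) (hw₀ : MemLp w₀ 2)
    (hm : IsMildThirring lam (S.sign * lam) (2 * κ * a * S.sign) (2 * κ * a) u₀ w₀ u w)
    (hH : ∀ T, 0 < T → MemH1 (slab T) u ∧ MemH1 (slab T) w ∧
      MemLp (fun p => thirringNonlin lam (2 * κ * a * S.sign) (u p) (w p)) 2
        (volume.restrict (slab T)) ∧
      MemLp (fun p => thirringNonlin (S.sign * lam) (2 * κ * a) (w p) (u p)) 2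
        (volume.restrict (slab T))) :
    IsGlobalThirringSolution S lam κ ψ₀ fun p => u p • b 0 + w p • b 1 := by
  have lu := locallyIntegrable_of_memLp_slab hm.memLp_left
  have lw := locallyIntegrable_of_memLp_slab hm.memLp_right
  have l1 := hm.locallyIntegrable_left
  have l2 := hm.locallyIntegrable_right
  obtain ⟨v, hv, hvu, hv0⟩ := hm.left.exists_continuous_curve hu₀ fun T hT => (hH T hT).2.2.1
  obtain ⟨z, hz, hzw, hz0⟩ := hm.right.exists_continuous_curve hw₀ fun T hT => (hH T hT).2.2.2
  refine ⟨fun T hT => ((hH T hT).1.clm_comp (spinorLine b 0)).add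
    ((hH T hT).2.1.clm_comp (spinorLine b 1)),
    ⟨(lu.clm_comp (spinorLine b 0)).add (lw.clm_comp (spinorLine b 1)), ?_,
      (h.weak_iff lam κ lu lw l1 l2).mpr ⟨hm.left.hasWeakDirDeriv lu l1, ?_⟩⟩,
    hasInitialValue_of_components hψ₀ hv hz hvu hzw hv0 hz0⟩
  · simp only [h.thirringRhs_eq]
    exact ((l1.smul Complex.I).clm_comp (spinorLine b 1)).add
      ((l2.smul (Complex.I * S.sign)).clm_comp (spinorLine b 0))
  · have := hm.right.hasWeakDirDeriv lw l2
    rwa [neg_neg] at this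

end NullBasis

theorem mainTheorem2 (S : SpinorStructure) (lam κ : ℝ) (ψ₀ : ℝ → Spinor)
    (hψ₀ : MemH1 univ ψ₀) :
    ∃ ψ : ℝ × ℝ → Spinor, IsGlobalThirringSolution S lam κ ψ₀ ψ ∧
      ∀ ξ : ℝ × ℝ → Spinor, IsGlobalThirringSolution S lam κ ψ₀ ξ → ξ =ᵐ[volume] ψ := by
  obtain ⟨b, a, h⟩ := S.exists_isNullBasis
  have data : ∀ i, ∃ f g : ℝ → ℂ, StronglyMeasurable f ∧ MemLp f 2 ∧ MemLp g 2 ∧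
      HasWeakDirDeriv univ f 1 g ∧ (fun x => spinorCoord b i (ψ₀ x)) =ᵐ[volume] f := by
    intro i
    have hi := hψ₀.clm_comp (spinorCoord b i)
    obtain ⟨g, hg, hfg⟩ := hi.2 1
    have hm := hi.1
    rw [Measure.restrict_univ] at hm hg
    exact ⟨_, g, hm.1.stronglyMeasurable_mk, hm.ae_eq hm.1.ae_eq_mk, hg,
      hfg.congr hm.1.ae_eq_mk, hm.1.ae_eq_mk⟩
  obtain ⟨u₀, g₁, mu₀, hu₀, hg₁, h₁, e₁⟩ := data 0
  obtain ⟨w₀, g₂, mw₀, hw₀, hg₂, h₂, e₂⟩ := data 1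
  obtain ⟨M₁, hM₁⟩ := h₁.exists_ae_norm_le hu₀ hg₁
  obtain ⟨M₂, hM₂⟩ := h₂.exists_ae_norm_le hw₀ hg₂
  set M := max 1 (max M₁ M₂) with hM
  have hM0 : 0 < M := lt_max_of_lt_left one_pos
  have bu : ∀ᵐ x, ‖u₀ x‖ ≤ M := hM₁.mono fun x hx =>
    hx.trans ((le_max_left _ _).trans (le_max_right _ _))
  have bw : ∀ᵐ x, ‖w₀ x‖ ≤ M := hM₂.mono fun x hx =>
    hx.trans ((le_max_right _ _).trans (le_max_right _ _))
  obtain ⟨u, w, hm, hH⟩ := exists_isMildThirring lam (S.sign * lam) (2 * κ * a * S.sign)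
    (2 * κ * a) hM0 mu₀ mw₀ hu₀ hw₀ hg₁ hg₂ h₁ h₂ bu bw
  have hψ : ∀ᵐ x, u₀ x • b 0 + w₀ x • b 1 = ψ₀ x := by
    filter_upwards [e₁, e₂] with x h1 h2
    rw [← h1, ← h2, spinorCoord_add]
  refine ⟨_, hm.isGlobalThirringSolution h hψ hu₀ hw₀ hH, fun ξ hξ => ?_⟩
  have := ((hξ.isMildThirring h).congr e₁ e₂ .rfl .rfl).ae_eq hM0 hm bu bw
  filter_upwards [this.1, this.2] with p h1 h2
  rw [← h1, ← h2, spinorCoord_add]
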